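/- **Setting.** Let $n\ge 1$ and let the vertices of a convex $(n+1)$-gon be numbered clockwise. A *noncrossing hypertree* $\tau$ is a finite set of subsets of the vertices (hyperedges, each with at least two elements) that is connected, has no simple cycle (of length at least $2$), and is such that the convex hulls of any two hyperedges have at most one vertex and no other point in common; it is a *noncrossing tree* if all hyperedges have two elements. Order noncrossing hypertrees by $\sigma\le\tau$ iff every hyperedge of $\sigma$ is contained in a hyperedge of $\tau$. The hyperedges of $\tau$ are partially ordered by the transitive closure of the relations "$e$ and $e'$ share a vertex $v$ and $e$ is to the left of $e'$ as seen from $v$ looking into the polygon"; a *proper ordering* of $\tau$ is a linear extension of this order. Let $\mathrm{NCPart}_{n+1}$ be the lattice of noncrossing partitions of the vertices, each identified with the permutation that moves every vertex to the clockwise next one in its block, and let $L$ be the link of the long diagonal in its orthoscheme complex: a piecewise spherical complex with one closed simplex for each chain of $\mathrm{NCPart}_{n+1}\setminus\{\hat 0,\hat 1\}$. For a noncrossing hypertree $\tau$ with $k$ hyperedges let $\mathrm{Simplex}(\tau)\subseteq L$ be the union of the closed $(k-2)$-simplices given by the chains $\hat 0=c_0<c_1<\dots<c_k=\hat 1$ for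 which there is a proper ordering $e_1,\dots,e_k$ of $\tau$ such that for every $i$ the permutation $c_{i-1}^{-1}c_i$ (products read from left to right) is the clockwise cycle on $e_i$. The *metric noncrossing hypertree complex* is $L$ with the sets $\mathrm{Simplex}(\tau)$, of dimension $k-2$, as its simplices, $\mathrm{Simplex}(\rho)$ being a face of $\mathrm{Simplex}(\tau)$ iff $\tau\le\rho$. Subcomplexes carry their intrinsic (length) metric, with distances truncated at $\pi$ so that a pair of points not joined by a path has distance $\pi$; unit spheres carry the angular metric. Finally, $\mathrm{Sphere}(\tau)\subseteq L$ is the union of the closed simplices of the chains of partitions in the special Boolean subposet of $\tau$, which consists of the partitions into connected components of the hypergraphs formed by the subsets of the hyperedges of $\tau$. **Theorem (Simplices and Spheres).** For every noncrossing hypertree $\tau$ with $k$ hyperedges, $\mathrm{Sphere}(\tau)$ is a subcomplex of the metric noncrossing hypertree complex that contains the simplex $\mathrm{Simplex}(\tau)$ and is isometric to the unit sphere $\mathbb S^{k-2}\subset\mathbb R^{k-1}$ of the same dimension. In the top dimension $n-2$, the map $\tau\mapsto\mathrm{Simplex}(\tau)$ is a bijection from noncrossing trees to the set of tree chambers (all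 $(n-2)$-dimensional simplices), the map $\tau\mapsto\mathrm{Sphere}(\tau)$ is a bijection from noncrossing trees to the set of apartments (all subcomplexes of the metric noncrossing hypertree complex isometric to the unit sphere $\mathbb S^{n-2}$), and hence $\mathrm{Simplex}(\tau)\mapsto\mathrm{Sphere}(\tau)$ is a well-defined bijection from tree chambers to apartments. -/

import Mathlib

noncomputable section

namespace NCHT

/-! ### Hypergraphs on the vertices of a convex polygon

The vertices of a convex `(n+1)`-gon, in clockwise order, are the elements of `Fin (n + 1)`.
A hyperedge is a finset of vertices, a hypergraph is a finset of hyperedges. -/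

/-- Two vertices are adjacent when they lie in a common hyperedge. -/
def Adj {n : ℕ} (E : Finset (Finset (Fin (n + 1)))) (a b : Fin (n + 1)) : Prop :=
  ∃ e ∈ E, a ∈ e ∧ b ∈ e

/-- The partition of the vertices into the connected components of a hypergraph
(a vertex in no hyperedge is a singleton block). -/
def components {n : ℕ} (E : Finset (Finset (Fin (n + 1)))) : Setoid (Fin (n + 1)) :=
  Relation.EqvGen.setoid (Adj E)

/-- A nontrivial simple cycle `v₀, e₀, v₁, e₁, …, v_{k-1}, e_{k-1}, v₀` with `k ≥ 2` distinct
vertices and `k` distinct hyperedges, each `eᵢ` containing `vᵢ` and its cyclic successor. -/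
def HasSimpleCycle {n : ℕ} (E : Finset (Finset (Fin (n + 1)))) : Prop :=
  ∃ (k : ℕ) (v : Fin k → Fin (n + 1)) (e : Fin k → Finset (Fin (n + 1))),
    2 ≤ k ∧ Function.Injective v ∧ Function.Injective e ∧
      ∀ i, e i ∈ E ∧ v i ∈ e i ∧ v (finRotate k i) ∈ e i

/-- `e` contains `a < c` and `e'` contains `b < d` with `a < b < c < d`. -/
def Interleave {n : ℕ} (e e' : Finset (Fin (n + 1))) : Prop :=
  ∃ a b c d : Fin (n + 1), a < b ∧ b < c ∧ c < d ∧ a ∈ e ∧ c ∈ e ∧ b ∈ e' ∧ d ∈ e'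

/-- The convex hulls of `e` and `e'` share at most one vertex of the polygon and no other point. -/
def WeaklyNoncrossing {n : ℕ} (e e' : Finset (Fin (n + 1))) : Prop :=
  (e ∩ e').card ≤ 1 ∧ ¬ Interleave e e' ∧ ¬ Interleave e' e

end NCHT

open NCHT in
/-- A noncrossing hypertree on `n + 1` vertices. -/
@[ext] structure NCHypertree (n : ℕ) where
  edges : Finset (Finset (Fin (n + 1)))
  two_le_card : ∀ e ∈ edges, 2 ≤ e.card
  connected : ∀ a b, (components edges) a b
  acyclic : ¬ HasSimpleCycle edges
  noncrossing : ∀ e ∈ edges, ∀ e' ∈ edges, e ≠ e' → WeaklyNoncrossing e e'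

namespace NCHypertree

/-- The order of the noncrossing hypertree poset. Its dual is the face poset of the
noncrossing hypertree complex: `ρ` labels a face of the simplex labelled `τ` iff `τ ≤ ρ`. -/
instance (n : ℕ) : LE (NCHypertree n) :=
  ⟨fun σ τ => ∀ e ∈ σ.edges, ∃ e' ∈ τ.edges, e ⊆ e'⟩

/-- A noncrossing tree: all hyperedges are edges. -/
def IsTree {n : ℕ} (τ : NCHypertree n) : Prop := ∀ e ∈ τ.edges, e.card = 2

/-- The local linear order at `v`: both hyperedges contain `v`, and `e` is to the left of `e'`
for an observer at `v` who looks into the polygon. From left to right the observer sees the other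
vertices in clockwise order `v + 1, v + 2, …, v - 1`. -/
def LocalLT {n : ℕ} (τ : NCHypertree n) (v : Fin (n + 1)) (e e' : Finset (Fin (n + 1))) : Prop :=
  e ∈ τ.edges ∧ e' ∈ τ.edges ∧ e ≠ e' ∧ v ∈ e ∧ v ∈ e' ∧
    ∀ a ∈ e, ∀ b ∈ e', a ≠ v → b ≠ v → a - v < b - v

/-- The strict order of the hyperedge poset of `τ`, generated by the local linear orders. -/
def EdgeLT {n : ℕ} (τ : NCHypertree n) : Finset (Fin (n + 1)) → Finset (Fin (n + 1)) → Prop :=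
  Relation.TransGen fun e e' => ∃ v, τ.LocalLT v e e'

/-- A proper ordering of `τ`: a list of all its hyperedges, each once, which is a linear extension
of the hyperedge poset. -/
def IsProperOrdering {n : ℕ} (τ : NCHypertree n) (l : List (Finset (Fin (n + 1)))) : Prop :=
  l.Nodup ∧ l.toFinset = τ.edges ∧ l.Pairwise fun e e' => ¬ τ.EdgeLT e' e

end NCHypertree

/-! ### The noncrossing partition lattice -/

/-- Noncrossing partitions of the vertices, as equivalence relations. The order is refinement. -/
def NCPart (n : ℕ) : Type :=
  {s : Setoid (Fin (n + 1)) // ∀ a b c d, a < b → b < c → c < d → s a c → s b d → s a b}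

namespace NCPart

instance (n : ℕ) : PartialOrder (NCPart n) := Subtype.partialOrder _

instance (n : ℕ) : BoundedOrder (NCPart n) where
  bot := ⟨⊥, fun _ _ _ _ hab hbc _ hac _ => absurd hac (hab.trans hbc).ne⟩
  top := ⟨⊤, fun _ _ _ _ _ _ _ _ _ => trivial⟩
  bot_le p := show (⊥ : Setoid _) ≤ p.1 from bot_le
  le_top p := show p.1 ≤ (⊤ : Setoid _) from le_top

instance (n : ℕ) : Finite (NCPart n) := by
  refine Finite.of_injective (fun p : NCPart n => fun a b => p.1 a b) ?_
  intro p q h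
  refine Subtype.ext (Setoid.ext fun a b => ?_)
  exact iff_of_eq (congrFun (congrFun h a) b)

instance (n : ℕ) : Fintype (NCPart n) := Fintype.ofFinite _

/-- The rank: the number of vertices minus the number of blocks. -/
def rank {n : ℕ} (p : NCPart n) : ℕ := n + 1 - Nat.card (Quotient p.1)

open Classical in
/-- The block of a vertex. -/
def block {n : ℕ} (p : NCPart n) (a : Fin (n + 1)) : Finset (Fin (n + 1)) :=
  Finset.univ.filter fun b => p.1 a b

end NCPart

namespace NCHT

/-- The irreducible permutation of a hyperedge: the cycle that runs through its elements in
clockwise order. -/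
def edgePerm {n : ℕ} (e : Finset (Fin (n + 1))) : Equiv.Perm (Fin (n + 1)) :=
  (e.sort (· ≤ ·)).formPerm

theorem edgePerm_mem {n : ℕ} (e : Finset (Fin (n + 1))) (a : Fin (n + 1)) :
    edgePerm e a ∈ e ↔ a ∈ e := by
  have h : edgePerm e a ∈ e.sort (· ≤ ·) ↔ a ∈ e.sort (· ≤ ·) := List.formPerm_mem_iff_mem
  rwa [Finset.mem_sort, Finset.mem_sort] at h

theorem block_eq {n : ℕ} (p : NCPart n) {a b : Fin (n + 1)} (h : b ∈ p.block a) :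
    p.block b = p.block a := by
  have hab : p.1 a b := by simpa [NCPart.block] using h
  ext c
  simp only [NCPart.block, Finset.mem_filter, Finset.mem_univ, true_and]
  exact ⟨fun h => p.1.trans hab h, fun h => p.1.trans (p.1.symm hab) h⟩

theorem self_mem_block {n : ℕ} (p : NCPart n) (a : Fin (n + 1)) : a ∈ p.block a := by
  simp only [NCPart.block, Finset.mem_filter, Finset.mem_univ, true_and]
  exact p.1.refl a

end NCHT

open NCHT in
/-- The noncrossing permutation of a noncrossing partition: the product of the commuting
irreducible permutations of its blocks, i.e. each vertex is moved by the cycle of its block. -/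
def NCPart.perm {n : ℕ} (p : NCPart n) : Equiv.Perm (Fin (n + 1)) where
  toFun a := edgePerm (p.block a) a
  invFun a := (edgePerm (p.block a))⁻¹ a
  left_inv a := by
    show (edgePerm (p.block (edgePerm (p.block a) a)))⁻¹ (edgePerm (p.block a) a) = a
    rw [block_eq p ((edgePerm_mem _ _).2 (self_mem_block p a))]
    simp
  right_inv a := by
    have h : (edgePerm (p.block a))⁻¹ a ∈ p.block a := by
      rw [← edgePerm_mem]
      simpa using self_mem_block p a
    show edgePerm (p.block _) _ = a
    rw [block_eq p h]
    simp

namespace NCHT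

/-! ### The noncrossing partition link -/

/-- The vertex `(1, …, 1, 0, …, 0)` (with `r` ones) of the standard `n`-orthoscheme in `ℝⁿ`,
projected orthogonally to the hyperplane perpendicular to the long diagonal `(1, …, 1)`. -/
def orthoVec (n r : ℕ) : EuclideanSpace ℝ (Fin n) :=
  WithLp.toLp 2 fun i => (if (i : ℕ) < r then 1 else 0) - (r : ℝ) / n

/-- The vector with the given coefficients with respect to the orthoscheme vertices. -/
def develop {n : ℕ} (t : NCPart n → ℝ) : EuclideanSpace ℝ (Fin n) :=
  ∑ p, t p • orthoVec n p.rank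

end NCHT

open NCHT in
/-- The points of the noncrossing partition link, i.e. of the link of the long diagonal in the
orthoscheme complex of the noncrossing partition lattice. The closed simplex of a chain
`p₁ < ⋯ < pₘ` of proper elements consists of the unit vectors `∑ tᵢ • orthoVec n (rank pᵢ)` with
`tᵢ ≥ 0`; a point is given by its coefficients `tᵢ`, extended by zero, so that the simplices are
glued along common faces. -/
def NCLink (n : ℕ) : Type :=
  {t : NCPart n → ℝ // (∀ p, 0 ≤ t p) ∧ t ⊥ = 0 ∧ t ⊤ = 0 ∧
    IsChain (· ≤ ·) {p | t p ≠ 0} ∧ ‖develop t‖ = 1}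

namespace NCHT

/-- The union of the closed simplices spanned by chains in `c`; for a chain `c` this is the closed
partition simplex with vertices the proper elements of `c`. -/
def closedSimplex {n : ℕ} (c : Set (NCPart n)) : Set (NCLink n) :=
  {x | ∀ p, x.1 p ≠ 0 → p ∈ c}

/-- Angular distance between two points, meaningful inside one closed partition simplex. -/
def simplexDist {n : ℕ} (x y : NCLink n) : ℝ :=
  InnerProductGeometry.angle (develop x.1) (develop y.1)

/-- A string in `K`: consecutive points lie in a common closed partition simplex inside `K`. -/
def IsString {n : ℕ} (K : Set (NCLink n)) (m : ℕ) (x : Fin (m + 1) → NCLink n) : Prop :=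
  ∀ i : Fin m, ∃ c : Set (NCPart n), IsChain (· ≤ ·) c ∧ closedSimplex c ⊆ K ∧
    x i.castSucc ∈ closedSimplex c ∧ x i.succ ∈ closedSimplex c

/-- The intrinsic metric of a subcomplex `K`: the infimum of the lengths of the strings in `K`
joining two points, truncated at `π`. (The truncation is the usual convention for links; it only
matters for points that are not joined by a path of length less than `π`.) -/
def intrinsicDist {n : ℕ} (K : Set (NCLink n)) (x y : NCLink n) : ℝ :=
  sInf ({Real.pi} ∪ {ℓ : ℝ | ∃ (m : ℕ) (z : Fin (m + 1) → NCLink n),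
    IsString K m z ∧ z 0 = x ∧ z (Fin.last m) = y ∧
      ℓ = ∑ i : Fin m, simplexDist (z i.castSucc) (z i.succ)})

/-- `K`, with its intrinsic metric, is isometric to the unit sphere of `ℝᵐ` (which has dimension
`m - 1`) with its angular metric. -/
def IsUnitSphere {n : ℕ} (m : ℕ) (K : Set (NCLink n)) : Prop :=
  ∃ φ : K ≃ Metric.sphere (0 : EuclideanSpace ℝ (Fin m)) 1,
    ∀ x y : K, intrinsicDist K x y = InnerProductGeometry.angle (φ x).1 (φ y).1

/-! ### The metric noncrossing hypertree complex -/

/-- The chain `⊥ = c₀ < c₁ < ⋯ < c_k = ⊤` has standard name `e₁, …, e_k`: the label of each pair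
`c_{i-1} < cᵢ`, i.e. the permutation `σ` with `c_{i-1} σ = cᵢ`, is the permutation of `eᵢ`.
Products of permutations are read from left to right here, which is the order opposite to
that of `Equiv.Perm`. -/
def HasStandardName {n : ℕ} (l : List (Finset (Fin (n + 1)))) (c : Fin (l.length + 1) → NCPart n) :
    Prop :=
  StrictMono c ∧ c 0 = ⊥ ∧ c (Fin.last _) = ⊤ ∧
    ∀ i : Fin l.length, edgePerm (l.get i) * (c i.castSucc).perm = (c i.succ).perm

end NCHT

namespace NCHypertree

open NCHT

/-- The tree simplex labelled `τ`: the union of the closed partition simplices whose standard name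
is `τ` with a proper ordering of its hyperedges. If `τ` has `k` hyperedges, these have
`k - 1` vertices, and the tree simplex has dimension `k - 2`. -/
def simplex {n : ℕ} (τ : NCHypertree n) : Set (NCLink n) :=
  {x | ∃ l, τ.IsProperOrdering l ∧ ∃ c : Fin (l.length + 1) → NCPart n,
    HasStandardName l c ∧ x ∈ closedSimplex (Set.range c)}

/-- The special Boolean subposet of `τ`: the noncrossing partitions into the connected components
of the hyperforests formed by subsets of the hyperedges of `τ`. -/
def boolean {n : ℕ} (τ : NCHypertree n) : Set (NCPart n) :=
  {p | ∃ F ⊆ τ.edges, p.1 = components F}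

/-- `Sphere(τ)`: the link of the special Boolean subposet of `τ`. -/
def sphere {n : ℕ} (τ : NCHypertree n) : Set (NCLink n) := closedSimplex τ.boolean

/-- A subcomplex of the noncrossing hypertree complex is a set of simplices closed under passing to
faces, i.e. an upper set of noncrossing hypertrees; this is its underlying space. -/
def space {n : ℕ} (𝒦 : UpperSet (NCHypertree n)) : Set (NCLink n) :=
  ⋃ τ ∈ 𝒦, τ.simplex

/-- The tree chambers: the simplices of top dimension `n - 2`. -/
def chambers (n : ℕ) : Set (Set (NCLink n)) :=
  {S | ∃ τ : NCHypertree n, τ.edges.card = n ∧ S = τ.simplex}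

/-- The apartments: all subcomplexes of the metric noncrossing hypertree complex that are
isometric to the unit sphere of top dimension `n - 2`. -/
def apartments (n : ℕ) : Set (Set (NCLink n)) :=
  {K | (∃ 𝒦 : UpperSet (NCHypertree n), space 𝒦 = K) ∧ IsUnitSphere (n - 1) K}

end NCHypertree

end

/-! The components of a set of hyperedges of a noncrossing hypertree form a noncrossing partition of
rank `∑ (|e| - 1)`, and acyclicity makes the set recoverable from it. Hence the special Boolean
subposet is a Boolean lattice with a weighted cardinality as rank. Give each hyperedge a vector `u
e`, the projection of one of several orthogonal vectors of squared lengths `|e| - 1` to the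
complement of their sum (`IsFrame`), and send the partition of a set `A` to `∑ e ∈ A, u e`.
Comparable partitions then have the inner products of orthoscheme vertices, so each simplex is
developed isometrically. Every real function on the hyperedges is, up to a constant, a unique
nonnegative combination of indicators of a chain of sets (`exists_isLayer`, `IsLayer.unique`), so
the sphere of the hypertree is developed bijectively onto a unit sphere, subdivided like a Coxeter
complex of type A. A great arc can be cut at the walls it crosses, so the intrinsic metric is the
angular one (`hasString_angle`).

Names of chains enter through the operation of merging all blocks that meet `e`. Under the star
condition, merging multiplies the permutation by the cycle of `e` (`perm_merge`), and conversely
such a product forces a merge (`eq_merge_of_perm`). Proper orderings satisfy the star condition, and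
a list of hyperedges that satisfies it along a chain of noncrossing partitions up to the top is a
proper ordering of a hypertree (`exists_hypertree_of_star`). A maximal chain of the Boolean subposet
of `τ` may thus be named by a different hypertree `ρ`. Two proper orderings of `ρ` differ by
exchanges of consecutive disjoint hyperedges, and `merge_eq_of_disjoint` shows that these exchanges
stay in the Boolean subposet. So all of `ρ.simplex` lies in the sphere of `τ`, which is therefore a
subcomplex.

For the converse, an isometry of a subcomplex with a unit sphere of top dimension yields vectors `V
p` that develop it onto a complete fan (`IsFan`). The span of some chain is the whole space, so this
chain is a full flag. Beyond each of its walls the fan must continue with the mirror image, which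
exchanges two consecutive increments of the flag (`IsFlag.exists_flip`). Adjacent transpositions
generate the symmetric group, so all partial sums of increments occur, and they form a Boolean
lattice of full rank. Its atoms are the edges of a noncrossing tree (`exists_tree_of_boolean`), and
uniqueness of coordinates in the fan shows that nothing else belongs to the subcomplex. Finally,
trees are determined by their simplices, since an interior point of a partition simplex remembers
its chain and hence its name, and by their spheres, since the edges are the vertices of rank one. -/

noncomputable section

open scoped RealInnerProductSpace

namespace NCHT

variable {n : ℕ}

/-! ### Cyclic order -/

/-- Unfolds the wrap-around subtraction into two linear cases, which turns statements about the
cyclic order into goals for `omega`. -/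
theorem sub_val_cases (a b : Fin (n + 1)) :
    (b.val ≤ a.val ∧ (a - b).val + b.val = a.val) ∨
      (a.val < b.val ∧ (a - b).val + b.val = a.val + (n + 1)) := by
  rcases Nat.lt_or_ge a.val b.val with h | h
  · right
    refine ⟨h, ?_⟩
    rw [Fin.val_sub, Nat.mod_eq_of_lt] <;> omega
  · left
    refine ⟨h, ?_⟩
    rw [Fin.val_sub, show n + 1 - b.val + a.val = (a.val - b.val) + (n + 1) by omega,
      Nat.add_mod_right, Nat.mod_eq_of_lt] <;> omega

/-- The vertices `a`, `c` strictly separate `b` from `d` on the circle. -/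
def Cross (a c b d : Fin (n + 1)) : Prop :=
  b ≠ a ∧ d ≠ a ∧ ((b - a < c - a ∧ c - a < d - a) ∨ (d - a < c - a ∧ c - a < b - a))

theorem Cross.swap_right {a c b d : Fin (n + 1)} (h : Cross a c b d) : Cross a c d b :=
  ⟨h.2.1, h.1, h.2.2.symm⟩

theorem Cross.swap {a c b d : Fin (n + 1)} (h : Cross a c b d) : Cross b d a c := by
  obtain ⟨h1, h2, h3⟩ := h
  have e1 := sub_val_cases b a
  have e2 := sub_val_cases c a
  have e3 := sub_val_cases d a
  have e4 := sub_val_cases a b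
  have e5 := sub_val_cases c b
  have e6 := sub_val_cases d b
  simp only [Cross, Fin.lt_def, ne_eq, Fin.ext_iff] at *
  omega

theorem Cross.swap_left {a c b d : Fin (n + 1)} (h : Cross a c b d) : Cross c a b d :=
  h.swap.swap_right.swap

/-- The chord from `a` to `c` leaves two open arcs, and a vertex `y` off the chord lies on exactly
one of them. The outer points `x` and `z` may be ends of the chord, since those are separated from
nothing. -/
theorem Cross.trans_of_not {a c x y z : Fin (n + 1)} (hya : y ≠ a) (hyc : y ≠ c)
    (h1 : ¬ Cross a c x y) (h2 : ¬ Cross a c y z) : ¬ Cross a c x z := by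
  have e : y - a ≠ c - a := fun h => hyc (sub_left_injective h)
  rintro ⟨hx, hz, h3⟩
  rcases lt_or_gt_of_ne e with h | h
  · rcases h3 with ⟨h4, h5⟩ | ⟨h4, h5⟩
    · exact h2 ⟨hya, hz, Or.inl ⟨h, h5⟩⟩
    · exact h1 ⟨hx, hya, Or.inr ⟨h, h5⟩⟩
  · rcases h3 with ⟨h4, h5⟩ | ⟨h4, h5⟩
    · exact h1 ⟨hx, hya, Or.inl ⟨h4, h⟩⟩
    · exact h2 ⟨hya, hz, Or.inr ⟨h4, h⟩⟩

theorem Cross.of_lt {a b c d : Fin (n + 1)} (h1 : a < b) (h2 : b < c) (h3 : c < d) :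
    Cross a c b d := by
  have e1 := sub_val_cases b a
  have e2 := sub_val_cases c a
  have e3 := sub_val_cases d a
  simp only [Cross, Fin.lt_def, ne_eq, Fin.ext_iff] at *
  omega

/-- Cutting the circle at vertex `0` turns a crossing into one of eight linear orders. Four of them
begin on the chord `a c` and four on the chord `b d`. -/
theorem Cross.cases {a c b d : Fin (n + 1)} (h : Cross a c b d) :
    (∃ x y z w, x < y ∧ y < z ∧ z < w ∧ (x = a ∧ z = c ∨ x = c ∧ z = a) ∧
      (y = b ∧ w = d ∨ y = d ∧ w = b)) ∨
    (∃ x y z w, x < y ∧ y < z ∧ z < w ∧ (x = b ∧ z = d ∨ x = d ∧ z = b) ∧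
      (y = a ∧ w = c ∨ y = c ∧ w = a)) := by
  obtain ⟨h1, h2, h3⟩ := h
  have e1 := sub_val_cases b a
  have e2 := sub_val_cases c a
  have e3 := sub_val_cases d a
  have key : (a < b ∧ b < c ∧ c < d) ∨ (a < d ∧ d < c ∧ c < b) ∨ (c < b ∧ b < a ∧ a < d) ∨
      (c < d ∧ d < a ∧ a < b) ∨ (b < a ∧ a < d ∧ d < c) ∨ (b < c ∧ c < d ∧ d < a) ∨
      (d < a ∧ a < b ∧ b < c) ∨ (d < c ∧ c < b ∧ b < a) := by
    simp only [Fin.lt_def, ne_eq, Fin.ext_iff] at *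
    rcases e1 with e1 | e1 <;> rcases e2 with e2 | e2 <;> rcases e3 with e3 | e3 <;>
      rcases h3 with h3 | h3 <;> grind only
  rcases key with h | h | h | h | h | h | h | h
  · exact Or.inl ⟨_, _, _, _, h.1, h.2.1, h.2.2, by simp, by simp⟩
  · exact Or.inl ⟨_, _, _, _, h.1, h.2.1, h.2.2, by simp, by simp⟩
  · exact Or.inl ⟨_, _, _, _, h.1, h.2.1, h.2.2, by simp, by simp⟩
  · exact Or.inl ⟨_, _, _, _, h.1, h.2.1, h.2.2, by simp, by simp⟩
  · exact Or.inr ⟨_, _, _, _, h.1, h.2.1, h.2.2, by simp, by simp⟩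
  · exact Or.inr ⟨_, _, _, _, h.1, h.2.1, h.2.2, by simp, by simp⟩
  · exact Or.inr ⟨_, _, _, _, h.1, h.2.1, h.2.2, by simp, by simp⟩
  · exact Or.inr ⟨_, _, _, _, h.1, h.2.1, h.2.2, by simp, by simp⟩

theorem Cross.interleave {e e' : Finset (Fin (n + 1))} {a c b d : Fin (n + 1)}
    (h : Cross a c b d) (ha : a ∈ e) (hc : c ∈ e) (hb : b ∈ e') (hd : d ∈ e') :
    Interleave e e' ∨ Interleave e' e := by
  rcases h.cases with ⟨x, y, z, w, h1, h2, h3, h4, h5⟩ | ⟨x, y, z, w, h1, h2, h3, h4, h5⟩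
  · refine Or.inl ⟨x, y, z, w, h1, h2, h3, ?_⟩
    rcases h4 with ⟨rfl, rfl⟩ | ⟨rfl, rfl⟩ <;> rcases h5 with ⟨rfl, rfl⟩ | ⟨rfl, rfl⟩ <;>
      exact ⟨by assumption, by assumption, by assumption, by assumption⟩
  · refine Or.inr ⟨x, y, z, w, h1, h2, h3, ?_⟩
    rcases h4 with ⟨rfl, rfl⟩ | ⟨rfl, rfl⟩ <;> rcases h5 with ⟨rfl, rfl⟩ | ⟨rfl, rfl⟩ <;>
      exact ⟨by assumption, by assumption, by assumption, by assumption⟩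

/-- The defining property of noncrossing partitions. -/
def IsNC (s : Setoid (Fin (n + 1))) : Prop :=
  ∀ a b c d, a < b → b < c → c < d → s a c → s b d → s a b

theorem IsNC.of_cross {s : Setoid (Fin (n + 1))} (hs : IsNC s) {a c b d : Fin (n + 1)}
    (h : Cross a c b d) (hac : s a c) (hbd : s b d) : s a b := by
  have hca := s.symm hac
  have hdb := s.symm hbd
  rcases h.cases with ⟨x, y, z, w, h1, h2, h3, h4, h5⟩ | ⟨x, y, z, w, h1, h2, h3, h4, h5⟩
  · have := hs x y z w h1 h2 h3
    rcases h4 with ⟨rfl, rfl⟩ | ⟨rfl, rfl⟩ <;> rcases h5 with ⟨rfl, rfl⟩ | ⟨rfl, rfl⟩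
    · exact this hac hbd
    · exact s.trans (this hac hdb) hdb
    · exact s.trans hac (this hca hbd)
    · exact s.trans hac (s.trans (this hca hdb) hdb)
  · have := hs x y z w h1 h2 h3
    rcases h4 with ⟨rfl, rfl⟩ | ⟨rfl, rfl⟩ <;> rcases h5 with ⟨rfl, rfl⟩ | ⟨rfl, rfl⟩
    · exact s.symm (this hbd hac)
    · exact s.trans hac (s.symm (this hbd hca))
    · exact s.trans (s.symm (this hdb hac)) hdb
    · exact s.trans hac (s.trans (s.symm (this hdb hca)) hdb)

theorem isNC_of_cross {s : Setoid (Fin (n + 1))}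
    (h : ∀ a c b d, Cross a c b d → s a c → s b d → s a b) : IsNC s :=
  fun _ _ _ _ h1 h2 h3 h4 h5 => h _ _ _ _ (Cross.of_lt h1 h2 h3) h4 h5

/-! ### Connected components -/

theorem components_le_iff {F : Finset (Finset (Fin (n + 1)))} {s : Setoid (Fin (n + 1))} :
    components F ≤ s ↔ ∀ e ∈ F, ∀ a ∈ e, ∀ b ∈ e, s a b := by
  constructor
  · intro h e he a ha b hb
    exact h (Relation.EqvGen.rel _ _ ⟨e, he, ha, hb⟩)
  · intro h
    exact Setoid.eqvGen_le fun a b ⟨e, he, ha, hb⟩ => h e he a ha b hb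

theorem components_rel {F : Finset (Finset (Fin (n + 1)))} {e : Finset (Fin (n + 1))}
    (he : e ∈ F) {a b : Fin (n + 1)} (ha : a ∈ e) (hb : b ∈ e) : components F a b :=
  components_le_iff.1 le_rfl e he a ha b hb

theorem components_mono {F G : Finset (Finset (Fin (n + 1)))} (h : F ⊆ G) :
    components F ≤ components G :=
  components_le_iff.2 fun _ he _ ha _ hb => components_rel (h he) ha hb

@[simp] theorem components_empty : components (∅ : Finset (Finset (Fin (n + 1)))) = ⊥ :=
  le_antisymm (components_le_iff.2 (by simp)) bot_le

/-- Induction along connecting paths. -/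
theorem components_induction {F : Finset (Finset (Fin (n + 1)))} {a : Fin (n + 1)}
    {P : Fin (n + 1) → Prop} (h0 : P a)
    (hs : ∀ e ∈ F, ∀ x ∈ e, ∀ y ∈ e, components F a x → P x → P y) {b : Fin (n + 1)}
    (hb : components F a b) : P b := by
  have h : Relation.ReflTransGen (Adj F) a b := by
    have hb' : Relation.EqvGen (Adj F) a b := hb
    clear hb hs h0
    induction hb' with
    | rel x y h => exact Relation.ReflTransGen.single h
    | refl x => exact Relation.ReflTransGen.refl
    | symm x y _ ih =>
      have : Std.Symm (Adj F) := ⟨fun x y ⟨e, he, hx, hy⟩ => ⟨e, he, hy, hx⟩⟩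
      exact Relation.ReflTransGen.stdSymm.symm _ _ ih
    | trans x y z _ _ ih1 ih2 => exact ih1.trans ih2
  have h' : components F a b ∧ P b := by
    clear hb
    induction h with
    | refl => exact ⟨(components F).refl a, h0⟩
    | tail _ hbc ih =>
      obtain ⟨e, he, hx, hy⟩ := hbc
      exact ⟨(components F).trans ih.1 (components_rel he hx hy), hs e he _ hx _ hy ih.1 ih.2⟩
  exact h'.2

/-- The partition obtained from `p` by merging all blocks that meet `e`. -/
def merge (p : Setoid (Fin (n + 1))) (e : Finset (Fin (n + 1))) : Setoid (Fin (n + 1)) where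
  r a b := p a b ∨ (∃ y ∈ e, p a y) ∧ ∃ y ∈ e, p b y
  iseqv := by
    refine ⟨fun a => Or.inl (p.refl a), ?_, ?_⟩
    · rintro a b (h | ⟨h, h'⟩)
      · exact Or.inl (p.symm h)
      · exact Or.inr ⟨h', h⟩
    · rintro a b c (h | ⟨h, h'⟩) (g | ⟨g, g'⟩)
      · exact Or.inl (p.trans h g)
      · obtain ⟨y, hy, hb⟩ := g
        exact Or.inr ⟨⟨y, hy, p.trans h hb⟩, g'⟩
      · obtain ⟨y, hy, hb⟩ := h'
        exact Or.inr ⟨h, ⟨y, hy, p.trans (p.symm g) hb⟩⟩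
      · exact Or.inr ⟨h, g'⟩

theorem le_merge (p : Setoid (Fin (n + 1))) (e : Finset (Fin (n + 1))) : p ≤ merge p e :=
  fun _ _ h => Or.inl h

theorem merge_mem {p : Setoid (Fin (n + 1))} {e : Finset (Fin (n + 1))} {a b : Fin (n + 1)}
    (ha : a ∈ e) (hb : b ∈ e) : merge p e a b :=
  Or.inr ⟨⟨a, ha, p.refl a⟩, ⟨b, hb, p.refl b⟩⟩

theorem merge_le_iff {p s : Setoid (Fin (n + 1))} {e : Finset (Fin (n + 1))} :
    merge p e ≤ s ↔ p ≤ s ∧ ∀ a ∈ e, ∀ b ∈ e, s a b := by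
  constructor
  · intro h
    exact ⟨(le_merge p e).trans h, fun a ha b hb => h (merge_mem ha hb)⟩
  · rintro ⟨h, h'⟩ a b (hab | ⟨⟨y, hy, ha⟩, ⟨z, hz, hb⟩⟩)
    · exact h hab
    · exact s.trans (h ha) (s.trans (h' y hy z hz) (s.symm (h hb)))

theorem components_insert (F : Finset (Finset (Fin (n + 1)))) (e : Finset (Fin (n + 1))) :
    components (insert e F) = merge (components F) e := by
  apply le_antisymm
  · refine components_le_iff.2 fun f hf a ha b hb => ?_
    rcases Finset.mem_insert.1 hf with rfl | hf
    · exact merge_mem ha hb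
    · exact le_merge _ _ (components_rel hf ha hb)
  · refine merge_le_iff.2 ⟨components_mono (Finset.subset_insert _ _), fun a ha b hb => ?_⟩
    exact components_rel (Finset.mem_insert_self _ _) ha hb

/-- Seen from each vertex `y` of `e`, the block of `y` comes before all other vertices of `e`. -/
def Star (p : Setoid (Fin (n + 1))) (e : Finset (Fin (n + 1))) : Prop :=
  ∀ y ∈ e, ∀ y' ∈ e, y' ≠ y → ∀ z, p y z → z - y < y' - y

theorem Star.eq_of_rel {p : Setoid (Fin (n + 1))} {e : Finset (Fin (n + 1))} (h : Star p e)
    {y y' : Fin (n + 1)} (hy : y ∈ e) (hy' : y' ∈ e) (hp : p y y') : y' = y := by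
  by_contra hne
  exact lt_irrefl _ (h y hy y' hy' hne y' hp)

/-- Restricting a connecting path to a side: if no edge of `F` crosses the pair `y, y'`, neither
does a block that avoids `y` and `y'`. -/
theorem not_cross_of_components {F : Finset (Finset (Fin (n + 1)))} {y y' w w' : Fin (n + 1)}
    (hF : ∀ f ∈ F, ∀ a ∈ f, ∀ b ∈ f, components F w a → ¬ Cross y y' a b) (hy : ¬ components F w y)
    (hy' : ¬ components F w y') (h : components F w w') : ¬ Cross y y' w w' := by
  refine components_induction (P := fun x => ¬ Cross y y' w x) ?_ ?_ h
  · rintro ⟨-, -, h | h⟩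
    · exact lt_asymm h.1 h.2
    · exact lt_asymm h.1 h.2
  · intro e he x hx z hz hwx hP
    refine Cross.trans_of_not ?_ ?_ hP (hF e he x hx z hz hwx)
    · rintro rfl; exact hy hwx
    · rintro rfl; exact hy' hwx

/-! ### Hypertrees -/

/-- A shortest chain of adjacencies from `y` to `y'` in `F` repeats neither a vertex nor a
hyperedge, since a repetition would allow a shortcut. As `e` is not in `F`, it closes this chain to
a simple cycle. -/
theorem hasSimpleCycle_of_components {E F : Finset (Finset (Fin (n + 1)))}
    {e : Finset (Fin (n + 1))} (hFE : F ⊆ E) (he : e ∈ E) (heF : e ∉ F) {y y' : Fin (n + 1)}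
    (hy : y ∈ e) (hy' : y' ∈ e) (hne : y ≠ y') (h : components F y y') : HasSimpleCycle E := by
  classical
  have hex : ∃ m : ℕ, ∃ v : ℕ → Fin (n + 1), v 0 = y ∧ v m = y' ∧
      ∀ i < m, Adj F (v i) (v (i + 1)) := by
    refine components_induction (P := fun b => ∃ m : ℕ, ∃ v : ℕ → Fin (n + 1), v 0 = y ∧ v m = b ∧
      ∀ i < m, Adj F (v i) (v (i + 1))) ⟨0, fun _ => y, rfl, rfl, by simp⟩ ?_ h
    rintro f hf x hx z hz - ⟨m, v, h0, hm, hadj⟩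
    refine ⟨m + 1, fun i => if i ≤ m then v i else z, by simpa using h0, by simp, fun i hi => ?_⟩
    rcases Nat.lt_or_ge i m with him | him
    · simpa [him.le, Nat.succ_le_of_lt him] using hadj i him
    · obtain rfl : i = m := by omega
      have hA : Adj F x z := ⟨f, hf, hx, hz⟩
      simpa [hm] using hA
  obtain ⟨v, h0, hm, hadj⟩ := Nat.find_spec hex
  set m := Nat.find hex with hmdef
  -- Minimality of `m`: an adjacency between `v i` and `v j` with `j > i + 1` would save `j - i - 1`
  -- steps.
  have short : ∀ i j, i + 1 < j → j ≤ m → ¬ Adj F (v i) (v j) := by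
    intro i j hij hjm hA
    refine Nat.find_min hex (m := m - (j - i - 1)) (by omega)
      ⟨fun t => if t ≤ i then v t else v (t + (j - i - 1)), by simpa using h0, ?_, ?_⟩
    · have : ¬ (m - (j - i - 1) ≤ i) := by omega
      simp only [this, if_false]
      rw [show m - (j - i - 1) + (j - i - 1) = m by omega, hm]
    · intro t ht
      rcases lt_trichotomy t i with h | h | h
      · simpa [h.le, Nat.succ_le_of_lt h] using hadj t (by omega)
      · subst h
        simpa [show t + 1 + (j - t - 1) = j by omega] using hA
      · have := hadj (t + (j - i - 1)) (by omega)
        simpa [show ¬ t ≤ i by omega, show ¬ t + 1 ≤ i by omega,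
          show t + 1 + (j - i - 1) = t + (j - i - 1) + 1 by omega] using this
  have hm0 : m ≠ 0 := by
    intro h
    rw [h] at hm
    exact hne (h0.symm.trans hm)
  have inj : ∀ i j, i < j → j ≤ m → v i ≠ v j := by
    intro i j hij hjm heq
    rcases Nat.lt_or_ge j m with h | h
    · exact short i (j + 1) (by omega) (by omega) (heq ▸ hadj j h)
    · obtain rfl : j = m := by omega
      rcases Nat.eq_zero_or_pos i with rfl | hi
      · exact hne (h0.symm.trans (heq.trans hm))
      · have := hadj (i - 1) (by omega)
        rw [Nat.sub_add_cancel hi, heq] at this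
        exact short (i - 1) m (by omega) le_rfl this
  choose! f hfF hf hf' using hadj
  have hff : ∀ i j, i < j → j < m → f i ≠ f j := by
    intro i j hij hjm heq
    exact short i (j + 1) (by omega) (by omega) ⟨f i, hfF i (by omega), hf i (by omega),
      heq ▸ hf' j hjm⟩
  refine ⟨m + 1, fun i => v i, fun i => if (i : ℕ) < m then f i else e, by omega, ?_, ?_, ?_⟩
  · intro i j hij
    rcases lt_trichotomy i j with h | h | h
    · exact absurd hij (inj i j h (by omega))
    · exact h
    · exact absurd hij.symm (inj j i h (by omega))
  · intro i j hij
    have hi := i.2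
    have hj := j.2
    dsimp only at hij
    split_ifs at hij with h1 h2 h2
    · rcases lt_trichotomy i j with h | h | h
      · exact absurd hij (hff i j h h2)
      · exact h
      · exact absurd hij.symm (hff j i h h1)
    · exact absurd (hij ▸ hfF i h1) heF
    · exact absurd (hij ▸ hfF j h2) heF
    · ext; omega
  · intro i
    by_cases h : (i : ℕ) < m
    · have hr : ((finRotate (m + 1) i : Fin (m + 1)) : ℕ) = i + 1 := by
        rw [coe_finRotate_of_ne_last]
        intro h'
        rw [h'] at h
        simp at h
      simp only [h, if_true, hr]
      exact ⟨hFE (hfF i h), hf i h, hf' i h⟩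
    · obtain rfl : i = Fin.last m := by ext; simp; omega
      simp only [finRotate_last, h, if_false]
      simp [he, hm, h0, hy, hy']

end NCHT

namespace NCHypertree

open NCHT

variable {n : ℕ} (τ : NCHypertree n)

/-- A connection in `F` between two vertices of `e` would close up with `e` to a simple cycle.
Acyclicity is used in this form only. -/
theorem eq_of_components {F : Finset (Finset (Fin (n + 1)))} {e : Finset (Fin (n + 1))}
    (hF : F ⊆ τ.edges) (he : e ∈ τ.edges) (heF : e ∉ F) {y y' : Fin (n + 1)}
    (hy : y ∈ e) (hy' : y' ∈ e) (h : components F y y') : y = y' := by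
  by_contra hne
  exact τ.acyclic (hasSimpleCycle_of_components hF he heF hy hy' hne h)

theorem exists_ne {e : Finset (Fin (n + 1))} (he : e ∈ τ.edges) (v : Fin (n + 1)) :
    ∃ w ∈ e, w ≠ v :=
  Finset.exists_mem_ne (τ.two_le_card e he) v

theorem not_cross {e f : Finset (Fin (n + 1))} (he : e ∈ τ.edges) (hf : f ∈ τ.edges) (hne : e ≠ f)
    {a c b d : Fin (n + 1)} (ha : a ∈ e) (hc : c ∈ e) (hb : b ∈ f) (hd : d ∈ f) :
    ¬ Cross a c b d := by
  intro h
  have := (τ.noncrossing e he f hf hne).2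
  rcases h.interleave ha hc hb hd with h | h
  · exact this.1 h
  · exact this.2 h

theorem eq_of_mem_mem {e f : Finset (Fin (n + 1))} (he : e ∈ τ.edges) (hf : f ∈ τ.edges)
    (hne : e ≠ f) {v w : Fin (n + 1)} (hv : v ∈ e) (hv' : v ∈ f) (hw : w ∈ e) (hw' : w ∈ f) :
    v = w :=
  Finset.card_le_one.1 (τ.noncrossing e he f hf hne).1 v (by simp [hv, hv']) w (by simp [hw, hw'])

/-- A block of a subforest does not cross another hyperedge. -/
theorem not_cross_components {F : Finset (Finset (Fin (n + 1)))} {e : Finset (Fin (n + 1))}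
    (hF : F ⊆ τ.edges) (he : e ∈ τ.edges) (heF : e ∉ F) {y y' w w' : Fin (n + 1)}
    (hy : y ∈ e) (hy' : y' ∈ e) (hwy : ¬ components F w y) (hwy' : ¬ components F w y')
    (h : components F w w') : ¬ Cross y y' w w' :=
  not_cross_of_components (fun _ hf _ ha _ hb _ =>
    τ.not_cross he (hF hf) (fun h => heF (h ▸ hf)) hy hy' ha hb) hwy hwy' h

/-- If the block of `b, d` crosses the chord `a c`, one of its hyperedges `f` already does. The
block of `a, c` then has points on both sides of `f` without meeting `f`, so one of its hyperedges
would cross `f`. -/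
theorem isNC_components {F : Finset (Finset (Fin (n + 1)))} (hF : F ⊆ τ.edges) :
    IsNC (components F) := by
  refine isNC_of_cross fun a c b d hX hac hbd => ?_
  by_contra hab
  set s := components F with hs
  have hba : ¬ s b a := fun h => hab (s.symm h)
  have hbc : ¬ s b c := fun h => hab (s.trans hac (s.symm h))
  refine not_cross_of_components (fun f hf x hx z hz hbx hc => ?_) hba hbc hbd hX
  have hax : ¬ s a x := fun h => hab (s.trans h (s.symm hbx))
  have haz : ¬ s a z := fun h => hax (s.trans h (components_rel hf hz hx))
  refine not_cross_of_components (fun g hg u hu v hv hau => ?_) hax haz hac hc.swap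
  refine τ.not_cross (hF hf) (hF hg) ?_ hx hz hu hv
  rintro rfl
  exact hax (s.trans hau (components_rel hf hu hx))

/-! ### The hyperedge poset -/

/-- If neither order holds, then seen from `v` the other vertices of `e` and `f` alternate at least
once, as `a', b, a` or as `b, a', b'`. Together with `v` this is a crossing. -/
theorem localLT_or {v : Fin (n + 1)} {e f : Finset (Fin (n + 1))} (he : e ∈ τ.edges)
    (hf : f ∈ τ.edges) (hne : e ≠ f) (hve : v ∈ e) (hvf : v ∈ f) :
    τ.LocalLT v e f ∨ τ.LocalLT v f e := by
  by_contra hcon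
  simp only [LocalLT, not_or, not_and, not_forall] at hcon
  obtain ⟨a, ha, b, hb, hav, hbv, hab⟩ := hcon.1 he hf hne hve hvf
  obtain ⟨b', hb', a', ha', hbv', hav', hab'⟩ := hcon.2 hf he hne.symm hvf hve
  have key : ∀ x ∈ e, ∀ y ∈ f, x ≠ v → y ≠ v → x - v ≠ y - v := by
    intro x hx y hy hxv hyv h
    obtain rfl := sub_left_injective h
    exact hxv (τ.eq_of_mem_mem he hf hne hx hy hve hvf)
  have h1 := lt_of_le_of_ne (not_lt.1 hab) (key a ha b hb hav hbv).symm
  have h2 := lt_of_le_of_ne (not_lt.1 hab') (key a' ha' b' hb' hav' hbv')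
  rcases lt_or_gt_of_ne (key a' ha' b hb hav' hbv) with h | h
  · exact τ.not_cross hf he hne.symm hvf hb ha' ha ⟨hav', hav, Or.inl ⟨h, h1⟩⟩
  · exact τ.not_cross he hf hne hve ha' hb hb' ⟨hbv, hbv', Or.inl ⟨h, h2⟩⟩

theorem LocalLT.edgeLT {τ : NCHypertree n} {v : Fin (n + 1)} {e f : Finset (Fin (n + 1))}
    (h : τ.LocalLT v e f) : τ.EdgeLT e f :=
  Relation.TransGen.single ⟨v, h⟩

/-- In a proper ordering, each hyperedge satisfies the star condition with respect to the
components of the preceding ones. -/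
theorem star_of_not_localLT {F : Finset (Finset (Fin (n + 1)))} {e : Finset (Fin (n + 1))}
    (hF : F ⊆ τ.edges) (he : e ∈ τ.edges) (heF : e ∉ F)
    (h : ∀ f ∈ F, ∀ v, ¬ τ.LocalLT v e f) : Star (components F) e := by
  intro y hy y' hy' hne z hz
  have hpos : (0 : Fin (n + 1)) < y' - y := by
    rw [Fin.pos_iff_ne_zero]
    exact sub_ne_zero.2 hne
  refine components_induction (P := fun z => z - y < y' - y) (by simpa using hpos) ?_ hz
  intro f hf w hw w' hw' hyw hP
  have hfe : e ≠ f := fun h => heF (h ▸ hf)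
  by_cases hwy : w = y
  · subst hwy
    have hl := (τ.localLT_or he (hF hf) hfe hy hw).resolve_left (h f hf w)
    by_cases hw'y : w' = w
    · rw [hw'y]; simpa using hpos
    · exact hl.2.2.2.2.2 w' hw' y' hy' hw'y hne
  -- Here `f` has a vertex before `y'` and one beyond it, neither of them equal to `y`, so it
  -- crosses the chord `y y'` of `e`.
  · by_contra hcon
    have h1 : w' - y ≠ y' - y := by
      intro h
      obtain rfl := sub_left_injective h
      exact hne (τ.eq_of_components hF he heF hy hy'
        ((components F).trans hyw (components_rel hf hw hw'))).symm
    have h2 := lt_of_le_of_ne (not_lt.1 hcon) h1.symm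
    refine τ.not_cross he (hF hf) hfe hy hy' hw hw' ⟨hwy, ?_, Or.inl ⟨hP, h2⟩⟩
    rintro rfl
    rw [sub_self] at h2
    exact absurd h2 (not_lt_of_ge (Fin.zero_le _))

theorem LocalLT.trans {τ : NCHypertree n} {v : Fin (n + 1)} {e f g : Finset (Fin (n + 1))}
    (h : τ.LocalLT v e f) (h' : τ.LocalLT v f g) : τ.LocalLT v e g := by
  obtain ⟨he, hf, hne, hve, hvf, hlt⟩ := h
  obtain ⟨-, hg, hne', -, hvg, hlt'⟩ := h'
  obtain ⟨w, hw, hwv⟩ := τ.exists_ne hf v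
  have hlt2 : ∀ a ∈ e, ∀ b ∈ g, a ≠ v → b ≠ v → a - v < b - v := fun a ha b hb hav hbv =>
    (hlt a ha w hw hav hwv).trans (hlt' w hw b hb hwv hbv)
  refine ⟨he, hg, ?_, hve, hvg, hlt2⟩
  rintro rfl
  obtain ⟨a, ha, hav⟩ := τ.exists_ne he v
  exact lt_irrefl _ (hlt2 a ha a ha hav hav)

theorem exists_rightmost {F : Finset (Finset (Fin (n + 1)))}
    {v : Fin (n + 1)} {e : Finset (Fin (n + 1))} (he : e ∈ F) (hv : v ∈ e) :
    ∃ f ∈ F, v ∈ f ∧ (f = e ∨ τ.LocalLT v e f) ∧ ∀ g ∈ F, ¬ τ.LocalLT v f g := by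
  classical
  let R : Finset (Fin (n + 1)) → Finset (Fin (n + 1)) → Prop := fun a b => τ.LocalLT v b a
  have hwf : ∀ k : ℕ, ∀ e ∈ F, v ∈ e → (F.filter fun g => τ.LocalLT v e g).card = k →
      ∃ f ∈ F, v ∈ f ∧ (f = e ∨ τ.LocalLT v e f) ∧ ∀ g ∈ F, ¬ τ.LocalLT v f g := by
    intro k
    induction k using Nat.strong_induction_on with
    | _ k ih =>
      intro e he hv hk
      by_cases h : ∀ g ∈ F, ¬ τ.LocalLT v e g
      · exact ⟨e, he, hv, Or.inl rfl, h⟩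
      · push Not at h
        obtain ⟨g, hg, hlt⟩ := h
        obtain ⟨f, hf, hvf, hfg, hmax⟩ := ih _ (by
          rw [← hk]
          refine Finset.card_lt_card (Finset.ssubset_iff_of_subset ?_ |>.2 ⟨g, ?_, ?_⟩)
          · intro x hx
            simp only [Finset.mem_filter] at hx ⊢
            exact ⟨hx.1, hlt.trans hx.2⟩
          · simp [hg, hlt]
          · simp only [Finset.mem_filter, not_and]
            exact fun _ h => h.2.2.1 rfl) g hg hlt.2.2.2.2.1 rfl
        refine ⟨f, hf, hvf, Or.inr ?_, hmax⟩
        rcases hfg with rfl | hfg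
        · exact hlt
        · exact hlt.trans hfg
  exact hwf _ e he hv rfl

/-- Every nonempty set of hyperedges has a hyperedge that is rightmost at all of its vertices. -/
theorem exists_maximal {F : Finset (Finset (Fin (n + 1)))} (hF : F ⊆ τ.edges) (hne : F.Nonempty) :
    ∃ e ∈ F, ∀ f ∈ F, ∀ v, ¬ τ.LocalLT v e f := by
  classical
  -- Extremal choice: among the pairs `(v, e)` with `e` rightmost at `v`, take one for which the
  -- component of `v` in `F` without `e` is largest. If `e` is not rightmost at another vertex `v'`,
  -- let `g` be the rightmost hyperedge there. The component of `v'` in `F` without `g` contains the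
  -- old one, and also `v'`, which the old one does not.
  let C : Fin (n + 1) × Finset (Fin (n + 1)) → Finset (Fin (n + 1)) := fun q =>
    Finset.univ.filter fun z => components (F.erase q.2) q.1 z
  let S : Finset (Fin (n + 1) × Finset (Fin (n + 1))) := (Finset.univ ×ˢ F).filter fun q =>
    q.1 ∈ q.2 ∧ ∀ g ∈ F, ¬ τ.LocalLT q.1 q.2 g
  have hS : S.Nonempty := by
    obtain ⟨e, he⟩ := hne
    obtain ⟨v, hv⟩ := Finset.card_pos.1 (lt_of_lt_of_le two_pos (τ.two_le_card e (hF he)))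
    obtain ⟨f, hf, hvf, -, hmax⟩ := τ.exists_rightmost he hv
    exact ⟨(v, f), by simp [S, hf, hvf]; exact hmax⟩
  obtain ⟨⟨v, e⟩, hq, hmax⟩ := Finset.exists_max_image S (fun q => (C q).card) hS
  simp only [S, Finset.mem_filter, Finset.mem_product, Finset.mem_univ, true_and] at hq
  obtain ⟨he, hve, hr⟩ := hq
  refine ⟨e, he, fun f hf v' hlt => ?_⟩
  have hvv' : v' ≠ v := by
    rintro rfl
    exact hr f hf hlt
  obtain ⟨g, hg, hv'g, hor, hrg⟩ := τ.exists_rightmost he hlt.2.2.2.1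
  have heg : τ.LocalLT v' e g := by
    rcases hor with rfl | h
    · exact absurd hlt (hrg f hf)
    · exact h
  have hge : g ≠ e := fun h => heg.2.2.1 h.symm
  have hmem : (v', g) ∈ S := by simp [S, hg, hv'g]; exact hrg
  refine absurd (hmax _ hmem) (not_le.2 (Finset.card_lt_card ?_))
  have hsub : F.erase e ⊆ τ.edges := (Finset.erase_subset _ _).trans hF
  have hnot : ¬ components (F.erase e) v v' := fun h =>
    hvv' (τ.eq_of_components hsub (hF he) (by simp) hve hlt.2.2.2.1 h).symm
  refine (Finset.ssubset_iff_of_subset ?_).2 ⟨v', ?_, ?_⟩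
  · intro z hz
    simp only [C, Finset.mem_filter, Finset.mem_univ, true_and] at hz ⊢
    have hv'v : components (F.erase g) v' v :=
      components_rel (Finset.mem_erase.2 ⟨hge.symm, he⟩) hlt.2.2.2.1 hve
    refine components_induction (P := fun z => components (F.erase g) v' z) hv'v ?_ hz
    intro f' hf' x hx y hy hvx hP
    refine (components (F.erase g)).trans hP
      (components_rel (Finset.mem_erase.2 ⟨?_, Finset.mem_of_mem_erase hf'⟩) hx hy)
    rintro rfl
    exact hnot ((components _).trans hvx (components_rel hf' hx hv'g))
  · simp [C]
  · simp only [C, Finset.mem_filter, Finset.mem_univ, true_and]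
    exact hnot

/-- By `exists_maximal` every nonempty set of hyperedges has one that is to the left of no other, so
the generating relation is well founded to the right and its transitive closure has no loop. -/
theorem edgeLT_irrefl (e : Finset (Fin (n + 1))) : ¬ τ.EdgeLT e e := by
  classical
  have hwf : WellFounded (Function.swap fun e e' => ∃ v, τ.LocalLT v e e') := by
    refine WellFounded.wellFounded_iff_has_min.2 fun s ⟨a, ha⟩ => ?_
    by_cases h : (τ.edges.filter (· ∈ s)).Nonempty
    · obtain ⟨e, he, hmax⟩ := τ.exists_maximal (Finset.filter_subset _ _) h
      refine ⟨e, (Finset.mem_filter.1 he).2, fun x hx ⟨v, hv⟩ => ?_⟩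
      exact hmax x (Finset.mem_filter.2 ⟨hv.2.1, hx⟩) v hv
    · refine ⟨a, ha, fun x hx ⟨v, hv⟩ => h ⟨a, Finset.mem_filter.2 ⟨hv.1, ha⟩⟩⟩
  intro h
  have h' : Relation.TransGen (Function.swap fun e e' => ∃ v, τ.LocalLT v e e') e e :=
    Relation.transGen_swap.2 h
  exact hwf.transGen.irrefl.irrefl e h'

theorem exists_isProperOrdering : ∃ l, τ.IsProperOrdering l := by
  classical
  suffices h : ∀ k : ℕ, ∀ F ⊆ τ.edges, F.card = k → ∃ l : List (Finset (Fin (n + 1))), l.Nodup ∧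
      l.toFinset = F ∧ l.Pairwise fun e e' => ¬ τ.EdgeLT e' e from h _ τ.edges subset_rfl rfl
  intro k
  induction k with
  | zero =>
    intro F _ hc
    exact ⟨[], by simp, by simp [Finset.card_eq_zero.1 hc], by simp⟩
  | succ k ih =>
    intro F hF hc
    have hne : F.Nonempty := Finset.card_pos.1 (by omega)
    let _ : IsTrans (Finset (Fin (n + 1))) τ.EdgeLT := ⟨fun _ _ _ h h' => h.trans h'⟩
    obtain ⟨e, he, hmax⟩ : ∃ e ∈ F, ∀ f ∈ F, ¬ τ.EdgeLT f e := by
      have hwf : WellFounded fun a b : F => τ.EdgeLT a.1 b.1 := by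
        have : IsTrans F fun a b : F => τ.EdgeLT a.1 b.1 := ⟨fun _ _ _ h h' => h.trans h'⟩
        have : Std.Irrefl fun a b : F => τ.EdgeLT a.1 b.1 := ⟨fun a => τ.edgeLT_irrefl a.1⟩
        exact Finite.wellFounded_of_trans_of_irrefl _
      obtain ⟨e, -, h⟩ := hwf.has_min Set.univ ⟨⟨_, hne.choose_spec⟩, trivial⟩
      exact ⟨e.1, e.2, fun f hf => h ⟨f, hf⟩ trivial⟩
    obtain ⟨l, h1, h2, h3⟩ := ih (F.erase e) ((Finset.erase_subset _ _).trans hF)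
      (by rw [Finset.card_erase_of_mem he, hc]; rfl)
    refine ⟨e :: l, List.nodup_cons.2 ⟨?_, h1⟩, ?_, List.pairwise_cons.2 ⟨?_, h3⟩⟩
    · rw [← List.mem_toFinset, h2]; simp
    · rw [List.toFinset_cons, h2, Finset.insert_erase he]
    · intro f hf
      rw [← List.mem_toFinset, h2] at hf
      exact hmax f (Finset.mem_of_mem_erase hf)

/-- The prefix form of `star_of_not_localLT` for proper orderings. -/
theorem IsProperOrdering.star {τ : NCHypertree n} {A B : List (Finset (Fin (n + 1)))}
    {e : Finset (Fin (n + 1))} (h : τ.IsProperOrdering (A ++ e :: B)) :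
    Star (components A.toFinset) e := by
  obtain ⟨h1, h2, h3⟩ := h
  have hA : A.toFinset ⊆ τ.edges := by
    rw [← h2]; intro x; simp; tauto
  have he : e ∈ τ.edges := by rw [← h2]; simp
  rw [List.nodup_append] at h1
  rw [List.pairwise_append] at h3
  refine τ.star_of_not_localLT hA he ?_ fun f hf v hlt => ?_
  · rw [List.mem_toFinset]
    intro h
    exact h1.2.2 e h e (by simp) rfl
  · exact h3.2.2 f (List.mem_toFinset.1 hf) e (by simp) hlt.edgeLT

end NCHypertree

namespace NCHT

variable {n : ℕ}

/-! ### Irreducible permutations -/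

theorem add_one_val_cases (a : Fin (n + 1)) :
    (a + 1).val = a.val + 1 ∧ a.val < n ∨ (a + 1).val = 0 ∧ a.val = n := by
  rcases Nat.lt_or_ge a.val n with h | h
  · exact Or.inl ⟨Fin.val_add_one_of_lt (Fin.lt_def.2 (by simpa using h)), h⟩
  · right
    have : a = Fin.last n := by ext; simp; omega
    rw [this]
    simp

/-- Seen from `y`, everything between `y'` and `y` comes after `y'`. -/
theorem sub_le_sub_of_lt {y y' c : Fin (n + 1)} (h : c - y' < y - y') (hne : y' ≠ y) :
    y' - y ≤ c - y := by
  have e1 := sub_val_cases c y'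
  have e2 := sub_val_cases y y'
  have e3 := sub_val_cases y' y
  have e4 := sub_val_cases c y
  simp only [Fin.lt_def, Fin.le_def, ne_eq, Fin.ext_iff] at *
  omega

theorem edgePerm_of_notMem {e : Finset (Fin (n + 1))} {a : Fin (n + 1)} (h : a ∉ e) :
    edgePerm e a = a :=
  List.formPerm_apply_of_notMem (by simpa using h)

/-- `edgePerm e a` is the first element of `e` after `a` in clockwise order. -/
theorem edgePerm_le {e : Finset (Fin (n + 1))} {a c : Fin (n + 1)} (ha : a ∈ e) (hc : c ∈ e) :
    edgePerm e a - (a + 1) ≤ c - (a + 1) := by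
  have hs : (e.sort (· ≤ ·)).SortedLT := Finset.sortedLT_sort e
  have hnd := hs.nodup
  obtain ⟨i, hi, rfl⟩ := List.getElem_of_mem ((Finset.mem_sort (· ≤ ·)).2 ha)
  obtain ⟨j, hj, rfl⟩ := List.getElem_of_mem ((Finset.mem_sort (· ≤ ·)).2 hc)
  have hmono := hs.strictMono_get
  have hlt : ∀ (i j : ℕ) (hi : i < (e.sort (· ≤ ·)).length) (hj : j < (e.sort (· ≤ ·)).length),
      i < j → ((e.sort (· ≤ ·))[i]).val < ((e.sort (· ≤ ·))[j]).val := fun i j hi hj h =>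
    hmono (a := ⟨i, hi⟩) (b := ⟨j, hj⟩) h
  rw [edgePerm, List.formPerm_apply_getElem _ hnd]
  set l := e.sort (· ≤ ·) with hl
  have e1 := sub_val_cases l[j] (l[i] + 1)
  have e3 := add_one_val_cases l[i]
  rw [Fin.le_def]
  have hij : i < j ∨ j ≤ i := Nat.lt_or_ge i j
  by_cases h : i + 1 < l.length
  · have hm : (i + 1) % l.length = i + 1 := Nat.mod_eq_of_lt h
    simp only [← hl, hm]
    have e2 := sub_val_cases l[i + 1] (l[i] + 1)
    have h1 := hlt i (i + 1) hi h (by omega)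
    rcases hij with hij | hij
    · have h2 : l[i + 1].val ≤ l[j].val := by
        rcases Nat.lt_or_ge (i + 1) j with h3 | h3
        · exact (hlt _ _ h hj h3).le
        · obtain rfl : j = i + 1 := by omega
          exact le_rfl
      omega
    · have h2 : l[j].val ≤ l[i].val := by
        rcases Nat.lt_or_ge j i with h3 | h3
        · exact (hlt _ _ hj hi h3).le
        · obtain rfl : j = i := by omega
          exact le_rfl
      omega
  · have hm : (i + 1) % l.length = 0 := by
      rw [show i + 1 = l.length by omega, Nat.mod_self]
    simp only [← hl, hm]
    have h0 : 0 < l.length := by omega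
    have e2 := sub_val_cases l[0] (l[i] + 1)
    have h2 : l[j].val ≤ l[i].val := by
      rcases Nat.lt_or_ge j i with h3 | h3
      · exact (hlt _ _ hj hi h3).le
      · obtain rfl : j = i := by omega
        exact le_rfl
    have h3 : l[0].val ≤ l[j].val := by
      rcases Nat.eq_zero_or_pos j with rfl | h3
      · exact le_rfl
      · exact (hlt _ _ h0 hj h3).le
    omega

/-- Positions are measured from `a + 1`, which puts `a` itself in last place. The successor of `a`
is then a minimizer without any exception for `a`, also when `e` has a single element. -/
theorem edgePerm_eq {e : Finset (Fin (n + 1))} {a b : Fin (n + 1)} (ha : a ∈ e) (hb : b ∈ e)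
    (h : ∀ c ∈ e, b - (a + 1) ≤ c - (a + 1)) : edgePerm e a = b :=
  sub_left_injective (le_antisymm (edgePerm_le ha hb) (h _ ((edgePerm_mem e a).2 ha)))

/-- Reading a comparison of positions after `a` from another vertex `y`. -/
theorem sub_le_sub_of_from {a b c : Fin (n + 1)} (y : Fin (n + 1)) (h1 : a - y < b - y)
    (h2 : c - y ≤ a - y ∨ b - y ≤ c - y) : b - (a + 1) ≤ c - (a + 1) := by
  have e1 := sub_val_cases a y
  have e2 := sub_val_cases b y
  have e3 := sub_val_cases c y
  have e4 := sub_val_cases b (a + 1)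
  have e5 := sub_val_cases c (a + 1)
  have e6 := add_one_val_cases a
  simp only [Fin.lt_def, Fin.le_def] at *
  omega

theorem from_of_sub_le_sub {a b c y : Fin (n + 1)} (h : b - (a + 1) ≤ c - (a + 1)) :
    (c - y ≤ a - y ∨ b - y ≤ c - y) ∨ b - y ≤ a - y := by
  have e1 := sub_val_cases a y
  have e2 := sub_val_cases b y
  have e3 := sub_val_cases c y
  have e4 := sub_val_cases b (a + 1)
  have e5 := sub_val_cases c (a + 1)
  have e6 := add_one_val_cases a
  simp only [Fin.le_def] at *
  omega

/-- If the successor of `a` within a set is not `y`, the set contains `y` and all of it is read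
from `y`, then the successor comes after `a`. -/
theorem lt_of_sub_le_sub {a b y : Fin (n + 1)} (hb : b ≠ y)
    (h : b - (a + 1) ≤ y - (a + 1)) : a - y < b - y := by
  have e1 := sub_val_cases a y
  have e2 := sub_val_cases b y
  have e4 := sub_val_cases b (a + 1)
  have e5 := sub_val_cases y (a + 1)
  have e6 := add_one_val_cases a
  simp only [Fin.le_def, Fin.lt_def, ne_eq, Fin.ext_iff] at *
  omega

/-- If the successor of `a` within a set is `y`, then `a` is the last element read from `y`. -/
theorem le_of_sub_le_sub {a c y : Fin (n + 1)} (h : y - (a + 1) ≤ c - (a + 1)) :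
    c - y ≤ a - y := by
  have e1 := sub_val_cases a y
  have e2 := sub_val_cases c y
  have e4 := sub_val_cases y (a + 1)
  have e5 := sub_val_cases c (a + 1)
  have e6 := add_one_val_cases a
  simp only [Fin.le_def] at *
  omega

/-- A relation that contains all steps of the cycle of `e` identifies the elements of `e`. -/
theorem rel_of_edgePerm {s : Setoid (Fin (n + 1))} {e : Finset (Fin (n + 1))}
    (h : ∀ a ∈ e, s a (edgePerm e a)) {a b : Fin (n + 1)} (ha : a ∈ e) (hb : b ∈ e) : s a b := by
  have hnd := (Finset.sortedLT_sort e).nodup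
  have key : ∀ (i : ℕ) (hi : i < (e.sort (· ≤ ·)).length),
      s ((e.sort (· ≤ ·))[0]'(by omega)) ((e.sort (· ≤ ·))[i]) := by
    intro i
    induction i with
    | zero => intro _; exact s.refl _
    | succ i ih =>
      intro hi
      have h1 := h _ ((Finset.mem_sort (· ≤ ·)).1 (List.getElem_mem (show i < _ by omega)))
      rw [edgePerm, List.formPerm_apply_lt_getElem _ hnd _ hi] at h1
      exact s.trans (ih (by omega)) h1
  obtain ⟨i, hi, rfl⟩ := List.getElem_of_mem ((Finset.mem_sort (· ≤ ·)).2 ha)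
  obtain ⟨j, hj, rfl⟩ := List.getElem_of_mem ((Finset.mem_sort (· ≤ ·)).2 hb)
  exact s.trans (s.symm (key i hi)) (key j hj)

theorem edgePerm_ne {e : Finset (Fin (n + 1))} (he : 2 ≤ e.card) {a : Fin (n + 1)} (ha : a ∈ e) :
    edgePerm e a ≠ a := by
  intro h
  obtain ⟨b, hb, hne⟩ := Finset.exists_mem_ne he a
  have h1 := edgePerm_le ha hb
  rw [h] at h1
  have h2 := le_of_sub_le_sub h1
  rw [sub_self] at h2
  exact hne (sub_eq_zero.1 (le_antisymm h2 (Fin.zero_le _)))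

/-- A cycle on at least two elements moves exactly these elements. -/
theorem edgePerm_injOn {e f : Finset (Fin (n + 1))} (he : 2 ≤ e.card) (hf : 2 ≤ f.card)
    (h : edgePerm e = edgePerm f) : e = f := by
  ext a
  constructor
  · intro ha
    by_contra hna
    exact edgePerm_ne he ha (h ▸ edgePerm_of_notMem hna)
  · intro ha
    by_contra hna
    exact edgePerm_ne hf ha (h ▸ edgePerm_of_notMem hna)

theorem mem_block {p : NCPart n} {a b : Fin (n + 1)} : b ∈ p.block a ↔ p.1 a b := by
  simp [NCPart.block]

theorem perm_apply (p : NCPart n) (a : Fin (n + 1)) : p.perm a = edgePerm (p.block a) a := rfl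

theorem rel_perm (p : NCPart n) (a : Fin (n + 1)) : p.1 a (p.perm a) :=
  mem_block.1 ((edgePerm_mem _ _).2 (self_mem_block p a))

theorem perm_le {p : NCPart n} {a c : Fin (n + 1)} (h : p.1 a c) :
    p.perm a - (a + 1) ≤ c - (a + 1) :=
  edgePerm_le (self_mem_block p a) (mem_block.2 h)

theorem perm_eq {p : NCPart n} {a b : Fin (n + 1)} (hb : p.1 a b)
    (h : ∀ c, p.1 a c → b - (a + 1) ≤ c - (a + 1)) : p.perm a = b :=
  edgePerm_eq (self_mem_block p a) (mem_block.2 hb) fun c hc => h c (mem_block.1 hc)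

theorem le_of_rel_perm {p : NCPart n} {s : Setoid (Fin (n + 1))} (h : ∀ a, s a (p.perm a)) :
    p.1 ≤ s := by
  intro a b hab
  refine rel_of_edgePerm (e := p.block a) (fun x hx => ?_) (self_mem_block p a) (mem_block.2 hab)
  have := h x
  rwa [perm_apply, block_eq p hx] at this

/-- Merging blocks along `e` multiplies the permutation by the cycle of `e`. -/
theorem perm_merge {p q : NCPart n} {e : Finset (Fin (n + 1))} (hq : q.1 = merge p.1 e)
    (hs : Star p.1 e) : edgePerm e * p.perm = q.perm := by
  ext1 x
  symm
  rw [Equiv.Perm.mul_apply]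
  set u := p.perm x with hu
  have hxu : p.1 x u := rel_perm p x
  -- Read from `u`, the block of `x` ends with `x`, and by the star condition at `u` all of it
  -- precedes `v`. Every other merged block has a vertex `y` of `e` that comes no earlier than `v`,
  -- and by the star condition at `y` the rest of that block comes after `y`. So `v` is the next
  -- vertex after `x`.
  by_cases hue : u ∈ e
  · have hmem := (edgePerm_mem e u).2 hue
    set v := edgePerm e u with hv
    have hxv : q.1 x v := by
      rw [hq]
      exact Or.inr ⟨⟨u, hue, hxu⟩, ⟨v, hmem, p.1.refl v⟩⟩
    have hlast : ∀ c, p.1 x c → c - u ≤ x - u := fun c hc => le_of_sub_le_sub (perm_le hc)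
    refine perm_eq hxv fun c hc => ?_
    -- This happens only if `u` is the only element of `e`, where merging changes nothing.
    by_cases hvu : v = u
    · rw [hvu]
      have hsing : ∀ y ∈ e, y = u := by
        intro y hy
        by_contra hne
        have h1 := edgePerm_le hue hy
        rw [← hv, hvu] at h1
        have h2 := le_of_sub_le_sub h1
        rw [sub_self] at h2
        exact hne (sub_eq_zero.1 (le_antisymm h2 (Fin.zero_le _)))
      rw [hq] at hc
      rcases hc with hc | ⟨-, y, hy, hc⟩
      · exact perm_le hc
      · rw [hsing y hy] at hc
        exact perm_le (p.1.trans hxu (p.1.symm hc))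
    · have hxlt : x - u < v - u := hs u hue v hmem hvu x (p.1.symm hxu)
      refine sub_le_sub_of_from u hxlt ?_
      rw [hq] at hc
      by_cases hpc : p.1 x c
      · exact Or.inl (hlast c hpc)
      · rcases hc with hc | ⟨-, y, hy, hc⟩
        · exact absurd hc hpc
        · right
          have hyu : y ≠ u := by
            rintro rfl
            exact hpc (p.1.trans hxu (p.1.symm hc))
          have h1 := edgePerm_le hue hy
          have h2 : v - u ≤ y - u := by
            rcases from_of_sub_le_sub (y := u) h1 with (h | h) | h
            · rw [sub_self] at h
              exact absurd (sub_eq_zero.1 (le_antisymm h (Fin.zero_le _))) hyu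
            · exact h
            · rw [sub_self] at h
              exact absurd (sub_eq_zero.1 (le_antisymm h (Fin.zero_le _))) hvu
          exact h2.trans (sub_le_sub_of_lt (hs y hy u hue hyu.symm c (p.1.symm hc)) hyu)
  -- The successor `u` has to stay the same. If `y` is the vertex of `e` in the block of `x` and `c`
  -- lies in the block of another vertex `y'` of `e`, then the order read from `y` is `x`, `u`,
  -- `y'`, `c`.
  · rw [edgePerm_of_notMem hue]
    refine perm_eq (by rw [hq]; exact Or.inl hxu) fun c hc => ?_
    rw [hq] at hc
    by_cases hpc : p.1 x c
    · exact perm_le hpc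
    · rcases hc with hc | ⟨⟨y, hy, hxy⟩, y', hy', hc⟩
      · exact absurd hc hpc
      · have huy : u ≠ y := by
          rintro rfl
          exact hue hy
        have hyy' : y ≠ y' := by
          rintro rfl
          exact hpc (p.1.trans hxy (p.1.symm hc))
        refine sub_le_sub_of_from y (lt_of_sub_le_sub huy (perm_le hxy)) (Or.inr ?_)
        have h1 := hs y hy y' hy' hyy'.symm u (p.1.trans (p.1.symm hxy) hxu)
        exact h1.le.trans (sub_le_sub_of_lt (hs y' hy' y hy hyy' c (p.1.symm hc)) hyy'.symm)

/-- A step of `q` is a step of `p` followed by a step of the cycle of `e`, so it stays inside the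
merged partition. A step of the cycle of `e` is a step of `p` backwards followed by a step of `q`,
so `e` lies in one block of `q`. -/
theorem eq_merge_of_perm {p q : NCPart n} {e : Finset (Fin (n + 1))} (hpq : p ≤ q)
    (h : edgePerm e * p.perm = q.perm) : q.1 = merge p.1 e := by
  have hval : ∀ a, q.perm a = edgePerm e (p.perm a) := fun a => by
    rw [← h, Equiv.Perm.mul_apply]
  apply le_antisymm
  · refine le_of_rel_perm fun a => ?_
    rw [hval]
    refine (merge p.1 e).trans (le_merge _ _ (rel_perm p a)) ?_
    by_cases hm : p.perm a ∈ e
    · exact merge_mem hm ((edgePerm_mem _ _).2 hm)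
    · rw [edgePerm_of_notMem hm]
  · refine merge_le_iff.2 ⟨hpq, fun a ha b hb => rel_of_edgePerm (fun x _ => ?_) ha hb⟩
    obtain ⟨y, rfl⟩ := p.perm.surjective x
    rw [← hval]
    exact q.1.trans (q.1.symm (hpq (rel_perm p y))) (rel_perm q y)

/-- A chain with a standard name consists of the components of the initial segments. -/
theorem HasStandardName.eq_components {l : List (Finset (Fin (n + 1)))}
    {c : Fin (l.length + 1) → NCPart n} (h : HasStandardName l c) (i : Fin (l.length + 1)) :
    (c i).1 = components (l.take i).toFinset := by
  induction i using Fin.induction with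
  | zero => simp [h.2.1]; rfl
  | succ i ih =>
    rw [eq_merge_of_perm (h.1 i.castSucc_lt_succ).le (h.2.2.2 i), ih, ← components_insert]
    congr 1
    simp only [Fin.val_castSucc, Fin.val_succ, List.get_eq_getElem]
    rw [List.take_add_one, List.toFinset_append]
    simp

/-! ### Rank -/

/-- The number of vertices minus the number of blocks. -/
def srank (s : Setoid (Fin (n + 1))) : ℕ := n + 1 - Nat.card (Quotient s)

theorem rank_eq_srank (p : NCPart n) : p.rank = srank p.1 := rfl

theorem card_quotient_le (s : Setoid (Fin (n + 1))) : Nat.card (Quotient s) ≤ n + 1 := by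
  simpa using Nat.card_le_card_of_surjective (Quotient.mk s) Quotient.mk_surjective

theorem card_quotient_pos (s : Setoid (Fin (n + 1))) : 0 < Nat.card (Quotient s) :=
  Nat.card_pos

/-- The `e.card` blocks that meet `e` become one. The set `T` keeps the block of `y₀` to represent
it, together with all blocks that miss `e`. -/
theorem card_quotient_merge {p : Setoid (Fin (n + 1))} {e : Finset (Fin (n + 1))}
    (h : ∀ y ∈ e, ∀ y' ∈ e, p y y' → y = y') (he : e.Nonempty) :
    Nat.card (Quotient (merge p e)) + e.card = Nat.card (Quotient p) + 1 := by
  classical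
  obtain ⟨y₀, hy₀⟩ := he
  let S : Finset (Quotient p) := e.image (Quotient.mk p)
  have hS : S.card = e.card := Finset.card_image_of_injOn fun a ha b hb hab =>
    h a ha b hb (Quotient.exact hab)
  let T : Finset (Quotient p) := insert ⟦y₀⟧ Sᶜ
  have hT : T.card + e.card = Nat.card (Quotient p) + 1 := by
    rw [Finset.card_insert_of_notMem, ← hS, Nat.card_eq_fintype_card,
      ← Finset.card_compl_add_card S]
    · ring
    · simp only [S, Finset.mem_compl, not_not]
      exact Finset.mem_image_of_mem _ hy₀
  have hbij : Nat.card T = Nat.card (Quotient (merge p e)) := by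
    refine Nat.card_eq_of_bijective
      (fun c : T => Quotient.map' (s₁ := p) (s₂ := merge p e) id (fun _ _ h => Or.inl h) c.1) ⟨?_, ?_⟩
    · rintro ⟨a, ha⟩ ⟨b, hb⟩ hab
      induction a using Quotient.inductionOn with | _ a => ?_
      induction b using Quotient.inductionOn with | _ b => ?_
      have hmem : ∀ a : Fin (n + 1), (⟦a⟧ : Quotient p) ∈ T → (∃ y ∈ e, p a y) → p a y₀ := by
        rintro a ha ⟨y, hy, hay⟩
        rcases Finset.mem_insert.1 ha with ha | ha
        · exact Quotient.exact ha
        · refine absurd (Finset.mem_image.2 ⟨y, hy, ?_⟩) (Finset.mem_compl.1 ha)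
          exact Quotient.sound (p.symm hay)
      have hab' : merge p e a b := Quotient.exact hab
      refine Subtype.ext (Quotient.sound (s := p) ?_)
      rcases hab' with h | ⟨h1, h2⟩
      · exact h
      · exact p.trans (hmem a ha h1) (p.symm (hmem b hb h2))
    · intro c
      induction c using Quotient.inductionOn with | _ a => ?_
      by_cases ha : ∃ y ∈ e, p a y
      · refine ⟨⟨⟦y₀⟧, Finset.mem_insert_self _ _⟩, Quotient.sound (s := merge p e) ?_⟩
        exact Or.inr ⟨⟨y₀, hy₀, p.refl y₀⟩, ha⟩
      · refine ⟨⟨⟦a⟧, Finset.mem_insert_of_mem ?_⟩, rfl⟩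
        simp only [S, Finset.mem_compl, Finset.mem_image, not_exists, not_and]
        exact fun y hy hya => ha ⟨y, hy, p.symm (Quotient.exact hya)⟩
  rw [← hbij, Nat.card_eq_fintype_card, Fintype.card_coe, hT]

theorem srank_merge {p : Setoid (Fin (n + 1))} {e : Finset (Fin (n + 1))}
    (h : ∀ y ∈ e, ∀ y' ∈ e, p y y' → y = y') (he : e.Nonempty) :
    srank (merge p e) = srank p + (e.card - 1) := by
  have h1 := card_quotient_merge h he
  have h2 := card_quotient_le p
  have h3 := card_quotient_pos (merge p e)
  have h4 := he.card_pos
  unfold srank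
  omega

theorem srank_lt {p q : Setoid (Fin (n + 1))} (h : p < q) : srank p < srank q := by
  have hsurj : Function.Surjective
      (Quotient.map' (s₁ := p) (s₂ := q) id fun _ _ hab => h.le hab) := by
    intro c
    induction c using Quotient.inductionOn with | _ a => exact ⟨⟦a⟧, rfl⟩
  have h1 := card_quotient_le p
  have h2 : Nat.card (Quotient q) < Nat.card (Quotient p) := by
    by_contra hcon
    have hb := hsurj.bijective_of_nat_card_le (not_lt.1 hcon)
    refine h.not_ge fun a b hab => ?_
    exact Quotient.exact (hb.1 (Quotient.sound hab : (⟦a⟧ : Quotient q) = ⟦b⟧))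
  unfold srank
  omega

theorem srank_mono {p q : Setoid (Fin (n + 1))} (h : p ≤ q) : srank p ≤ srank q := by
  rcases h.lt_or_eq with h | rfl
  · exact (srank_lt h).le
  · exact le_rfl

theorem eq_of_srank_le {p q : Setoid (Fin (n + 1))} (h : p ≤ q) (h' : srank q ≤ srank p) :
    p = q := by
  rcases h.lt_or_eq with h | h
  · exact absurd (srank_lt h) (not_lt.2 h')
  · exact h

@[simp] theorem srank_bot : srank (⊥ : Setoid (Fin (n + 1))) = 0 := by
  have : Nat.card (Quotient (⊥ : Setoid (Fin (n + 1)))) = n + 1 := by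
    rw [Nat.card_congr (Setoid.quotientBotEquiv (α := Fin (n + 1)))]
    simp
  simp [srank, this]

@[simp] theorem srank_top : srank (⊤ : Setoid (Fin (n + 1))) = n := by
  have : Nat.card (Quotient (⊤ : Setoid (Fin (n + 1)))) = 1 := by
    rw [Nat.card_eq_one_iff_unique]
    refine ⟨⟨fun a b => ?_⟩, ⟨⟦0⟧⟩⟩
    induction a using Quotient.inductionOn with | _ a => ?_
    induction b using Quotient.inductionOn with | _ b => ?_
    exact Quotient.sound trivial
  simp [srank]

end NCHT

namespace NCPart

open NCHT

variable {n : ℕ}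

theorem rank_lt {p q : NCPart n} (h : p < q) : p.rank < q.rank := srank_lt h

theorem rank_mono {p q : NCPart n} (h : p ≤ q) : p.rank ≤ q.rank := srank_mono h

theorem eq_of_rank_le {p q : NCPart n} (h : p ≤ q) (h' : q.rank ≤ p.rank) : p = q :=
  Subtype.ext (eq_of_srank_le h h')

@[simp] theorem rank_bot : (⊥ : NCPart n).rank = 0 := srank_bot

@[simp] theorem rank_top : (⊤ : NCPart n).rank = n := srank_top

theorem rank_pos {p : NCPart n} (h : p ≠ ⊥) : 0 < p.rank := by
  simpa using rank_lt (bot_lt_iff_ne_bot.2 h)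

theorem rank_lt_top {p : NCPart n} (h : p ≠ ⊤) : p.rank < n := by
  simpa using rank_lt (lt_top_iff_ne_top.2 h)

theorem rank_le (p : NCPart n) : p.rank ≤ n := by
  simpa using rank_mono (le_top : p ≤ ⊤)

end NCPart

/-! ### Ranks of the partitions into components of subforests. -/

namespace NCHypertree

open NCHT

variable {n : ℕ} (τ : NCHypertree n)

theorem components_edges : components τ.edges = ⊤ :=
  top_unique fun a b _ => τ.connected a b

/-- By acyclicity a new hyperedge `e` meets `|e|` different components of the previous ones, so it
lowers the number of blocks by `|e| - 1`. -/
theorem srank_components {F : Finset (Finset (Fin (n + 1)))} (hF : F ⊆ τ.edges) :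
    srank (components F) = ∑ e ∈ F, (e.card - 1) := by
  classical
  induction F using Finset.induction_on with
  | empty => simp
  | insert e F he ih =>
    have hF' := (Finset.subset_insert e F).trans hF
    have hee := hF (Finset.mem_insert_self e F)
    rw [components_insert, srank_merge, ih hF', Finset.sum_insert he, add_comm]
    · exact fun y hy y' hy' h => τ.eq_of_components hF' hee he hy hy' h
    · exact Finset.card_pos.1 (lt_of_lt_of_le two_pos (τ.two_le_card e hee))

theorem sum_card_sub_one : ∑ e ∈ τ.edges, (e.card - 1) = n := by
  rw [← τ.srank_components subset_rfl, τ.components_edges, srank_top]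

/-- The numbers `|e| - 1` are at least one and add up to `n`, so there are `n` of them exactly when
all are one. -/
theorem isTree_iff_card : τ.IsTree ↔ τ.edges.card = n := by
  have hs := τ.sum_card_sub_one
  constructor
  · intro h
    rw [Finset.sum_congr rfl fun e he => by rw [h e he]] at hs
    simpa using hs
  · intro h e he
    have h2 := τ.two_le_card
    have : ∀ e ∈ τ.edges, 1 = e.card - 1 := by
      refine (Finset.sum_eq_sum_iff_of_le fun e he => ?_).1 ?_
      · have := h2 e he
        omega
      · rw [hs]; simpa using h
    have h3 := this e he
    have := h2 e he
    omega

/-- A hyperedge outside `G` meets each component of `G` at most once, so it cannot lie inside one.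
This makes the special Boolean subposet a Boolean lattice. -/
theorem subset_of_components_le {F G : Finset (Finset (Fin (n + 1)))} (hF : F ⊆ τ.edges)
    (hG : G ⊆ τ.edges) (h : components F ≤ components G) : F ⊆ G := by
  intro e he
  by_contra hne
  obtain ⟨a, ha⟩ := Finset.card_pos.1 (lt_of_lt_of_le two_pos (τ.two_le_card e (hF he)))
  obtain ⟨b, hb, hba⟩ := τ.exists_ne (hF he) a
  exact hba (τ.eq_of_components hG (hF he) hne hb ha (h (components_rel he hb ha)))

/-- The noncrossing partition into the components of a subforest. -/
def part (F : Finset (Finset (Fin (n + 1)))) (hF : F ⊆ τ.edges) : NCPart n :=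
  ⟨components F, τ.isNC_components hF⟩

theorem edges_nonempty (hn : 1 ≤ n) : τ.edges.Nonempty := by
  rw [Finset.nonempty_iff_ne_empty]
  intro h
  have := τ.sum_card_sub_one
  simp [h] at this
  omega

end NCHypertree

namespace NCHT

variable {n : ℕ}

/-! ### Chains and factorizations -/

theorem list_eq_take_cons_drop {α : Type*} (l : List α) (i : ℕ) (hi : i < l.length) :
    l = l.take i ++ l[i] :: l.drop (i + 1) := by
  rw [← List.drop_eq_getElem_cons, List.take_append_drop]

/-- In a crossing, the noncrossing merged partition would join the block of `e` to `f`, so that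
block contains some `y ∈ f`. Read from `y`, the star condition puts `b` and `d` before all other
vertices of `f`, and no chord of `f` can separate them. -/
theorem Star.not_cross {p : Setoid (Fin (n + 1))} {e f : Finset (Fin (n + 1))}
    (hs : Star p f) (hnc : IsNC (merge p f)) (he : ∀ a ∈ e, ∀ b ∈ e, p a b)
    {a c b d : Fin (n + 1)} (ha : a ∈ f) (hc : c ∈ f) (hb : b ∈ e) (hd : d ∈ e) :
    ¬ Cross a c b d := by
  intro hX
  have hbd := he b hb d hd
  have hm := hnc.of_cross hX (merge_mem ha hc) (le_merge _ _ hbd)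
  obtain ⟨y, hy, hyb⟩ : ∃ y ∈ f, p b y := by
    rcases hm with h | h
    · exact ⟨a, ha, p.symm h⟩
    · exact h.2
  have hb' := fun y' hy' hne => hs y hy y' hy' hne b (p.symm hyb)
  have hd' := fun y' hy' hne => hs y hy y' hy' hne d (p.trans (p.symm hyb) hbd)
  have hac : ∀ {a c : Fin (n + 1)}, Cross a c b d → c ≠ a := by
    rintro a c ⟨-, -, h | h⟩ rfl
    · rw [sub_self] at h
      exact absurd h.1 (not_lt_of_ge (Fin.zero_le _))
    · rw [sub_self] at h
      exact absurd h.1 (not_lt_of_ge (Fin.zero_le _))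
  by_cases hya : y = a
  · subst hya
    have h1 := hb' c hc (hac hX)
    have h2 := hd' c hc (hac hX)
    rcases hX.2.2 with h | h
    · exact lt_asymm h.2 h2
    · exact lt_asymm h.2 h1
  by_cases hyc : y = c
  · subst hyc
    have h1 := hb' a ha (hac hX.swap_left)
    have h2 := hd' a ha (hac hX.swap_left)
    rcases hX.swap_left.2.2 with h | h
    · exact lt_asymm h.2 h2
    · exact lt_asymm h.2 h1
  have h1 := hb' a ha (Ne.symm hya)
  have h2 := hd' a ha (Ne.symm hya)
  have h3 := hb' c hc (Ne.symm hyc)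
  have h4 := hd' c hc (Ne.symm hyc)
  obtain ⟨hba, hda, h5⟩ := hX
  clear hb' hd' hac hm hyb hbd he hnc hs
  have e1 := sub_val_cases b a
  have e2 := sub_val_cases c a
  have e3 := sub_val_cases d a
  have e4 := sub_val_cases b y
  have e5 := sub_val_cases c y
  have e6 := sub_val_cases d y
  have e7 := sub_val_cases a y
  simp only [Fin.lt_def, ne_eq, Fin.ext_iff] at *
  omega

open scoped Fin.NatCast Fin.CommRing in
/-- Walking once around a cycle, except for one step. -/
theorem rel_of_cycle {m : ℕ} {s : Setoid (Fin (n + 1))} {v : Fin (m + 1) → Fin (n + 1)}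
    {i : Fin (m + 1)} (hstep : ∀ t, t ≠ i → s (v t) (v (t + 1))) : s (v (i + 1)) (v i) := by
  have hwalk : ∀ t : ℕ, t ≤ m → s (v (i + 1)) (v (i + 1 + (t : Fin (m + 1)))) := by
    intro t
    induction t with
    | zero => intro _; simp
    | succ t ih =>
      intro ht
      refine s.trans (ih (by omega)) ?_
      have := hstep (i + 1 + (t : Fin (m + 1))) ?_
      · simpa [add_assoc] using this
      · intro heq
        have h0 : (((t + 1 : ℕ)) : Fin (m + 1)) = 0 := by
          have h1 : i + (((t + 1 : ℕ)) : Fin (m + 1)) = i + 0 := by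
            rw [add_zero]
            conv_rhs => rw [← heq]
            push_cast
            ring
          exact add_left_cancel h1
        rw [Fin.natCast_eq_zero] at h0
        exact absurd (Nat.le_of_dvd (by omega) h0) (by omega)
  have hlast : i + 1 + ((m : ℕ) : Fin (m + 1)) = i := by
    have : ((m : ℕ) : Fin (m + 1)) + 1 = 0 := by simp
    rw [add_assoc, add_comm 1, this, add_zero]
  have hfin := hwalk m le_rfl
  rwa [hlast] at hfin

/-- A factorization of the full cycle along a chain of noncrossing partitions is a proper ordering
of a noncrossing hypertree. -/
theorem exists_hypertree_of_star {l : List (Finset (Fin (n + 1)))} (hcard : ∀ e ∈ l, 2 ≤ e.card)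
    (hstar : ∀ i (hi : i < l.length), Star (components (l.take i).toFinset) l[i])
    (hnc : ∀ i, IsNC (components (l.take i).toFinset))
    (htop : components l.toFinset = ⊤) : ∃ ρ : NCHypertree n, ρ.IsProperOrdering l := by
  classical
  have hmem : ∀ i j (hi : i < l.length) (hj : j < l.length), i < j →
      l[i] ∈ (l.take j).toFinset := by
    intro i j hi hj hij
    rw [List.mem_toFinset, List.mem_take_iff_getElem]
    exact ⟨i, by omega, rfl⟩
  have hrel : ∀ i j (hi : i < l.length) (hj : j < l.length), i < j →
      ∀ a ∈ l[i], ∀ b ∈ l[i], components (l.take j).toFinset a b :=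
    fun i j hi hj hij a ha b hb => components_rel (hmem i j hi hj hij) ha hb
  have hne : ∀ i j (hi : i < l.length) (hj : j < l.length), i < j → l[i] ≠ l[j] := by
    intro i j hi hj hij heq
    have h2 := hcard _ (List.getElem_mem hj)
    obtain ⟨a, ha⟩ := Finset.card_pos.1 (lt_of_lt_of_le two_pos h2)
    obtain ⟨b, hb, hba⟩ := Finset.exists_mem_ne h2 a
    exact hba ((hstar j hj).eq_of_rel ha hb (hrel i j hi hj hij a (heq ▸ ha) b (heq ▸ hb)))
  have hnodup : l.Nodup := by
    rw [List.Nodup, List.pairwise_iff_getElem]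
    exact hne
  have hnc' : ∀ j (hj : j < l.length), IsNC (merge (components (l.take j).toFinset) l[j]) := by
    intro j hj
    have h := hnc (j + 1)
    rw [List.take_add_one, List.toFinset_append] at h
    simp only [List.getElem?_eq_getElem hj, Option.toList_some, List.toFinset_cons,
      List.toFinset_nil, insert_empty_eq, Finset.union_comm _ {l[j]}, ← Finset.insert_eq,
      components_insert] at h
    exact h
  have hX : ∀ i j (hi : i < l.length) (hj : j < l.length), i < j →
      ∀ a ∈ l[j], ∀ c ∈ l[j], ∀ b ∈ l[i], ∀ d ∈ l[i], ¬ Cross a c b d :=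
    fun i j hi hj hij a ha c hc b hb d hd =>
      (hstar j hj).not_cross (hnc' j hj) (hrel i j hi hj hij) ha hc hb hd
  have hcap : ∀ i j (hi : i < l.length) (hj : j < l.length), i < j → (l[i] ∩ l[j]).card ≤ 1 := by
    intro i j hi hj hij
    refine Finset.card_le_one.2 fun a ha b hb => ?_
    rw [Finset.mem_inter] at ha hb
    exact (hstar j hj).eq_of_rel hb.2 ha.2 (hrel i j hi hj hij b hb.1 a ha.1)
  let ρ : NCHypertree n :=
    { edges := l.toFinset
      two_le_card := fun e he => hcard e (List.mem_toFinset.1 he)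
      connected := fun a b => by rw [htop]; trivial
      acyclic := by
        rintro ⟨k, v, e, hk, hv, he, h⟩
        obtain ⟨m, rfl⟩ : ∃ m, k = m + 1 := ⟨k - 1, by omega⟩
        -- Take the hyperedge of the cycle that occurs last in `l`. All others precede it and
        -- connect its two cycle vertices, which contradicts the star condition for it.
        obtain ⟨i, -, hmax⟩ := Finset.exists_max_image Finset.univ (fun i => l.idxOf (e i))
          ⟨0, Finset.mem_univ _⟩
        have hel : ∀ i, e i ∈ l := fun i => List.mem_toFinset.1 (h i).1
        have hi := List.idxOf_lt_length_of_mem (hel i)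
        have hget : ∀ i, l[l.idxOf (e i)]'(List.idxOf_lt_length_of_mem (hel i)) = e i :=
          fun i => List.getElem_idxOf _
        set j := l.idxOf (e i) with hj
        set p := components (l.take j).toFinset with hp
        have hstep : ∀ t, t ≠ i → p (v t) (v (t + 1)) := by
          intro t ht
          have hlt : l.idxOf (e t) < j := by
            refine lt_of_le_of_ne (hmax t (Finset.mem_univ _)) fun heq => ht (he ?_)
            rw [← hget t, ← hget i]
            congr 1
          have := hrel _ j (List.idxOf_lt_length_of_mem (hel t)) hi hlt
          rw [hget t] at this
          refine this _ (h t).2.1 _ ?_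
          have h3 := (h t).2.2
          rwa [finRotate_apply] at h3
        have hfin := rel_of_cycle hstep
        have h3 := (h i).2.2
        rw [finRotate_apply] at h3
        have hst := hstar j hi
        rw [hget i] at hst
        have := hst.eq_of_rel h3 (h i).2.1 hfin
        have h4 := hv this
        have h5 : (1 : Fin (m + 1)) = 0 := by
          have : i + 1 = i + 0 := by rw [add_zero]; exact h4.symm
          exact add_left_cancel this
        rw [Fin.one_eq_zero_iff] at h5
        omega
      noncrossing := by
        have key : ∀ i j (hi : i < l.length) (hj : j < l.length), i < j →
            WeaklyNoncrossing l[i] l[j] ∧ WeaklyNoncrossing l[j] l[i] := by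
          intro i j hi hj hij
          have h1 : ¬ Interleave l[i] l[j] := by
            rintro ⟨a, b, c, d, hab, hbc, hcd, ha, hc, hb, hd⟩
            exact hX i j hi hj hij b hb d hd a ha c hc (Cross.of_lt hab hbc hcd).swap
          have h2 : ¬ Interleave l[j] l[i] := by
            rintro ⟨a, b, c, d, hab, hbc, hcd, ha, hc, hb, hd⟩
            exact hX i j hi hj hij a ha c hc b hb d hd (Cross.of_lt hab hbc hcd)
          exact ⟨⟨hcap i j hi hj hij, h1, h2⟩,
            ⟨by rw [Finset.inter_comm]; exact hcap i j hi hj hij, h2, h1⟩⟩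
        intro e he f hf hne'
        obtain ⟨i, hi, rfl⟩ := List.getElem_of_mem (List.mem_toFinset.1 he)
        obtain ⟨j, hj, rfl⟩ := List.getElem_of_mem (List.mem_toFinset.1 hf)
        rcases lt_trichotomy i j with hij | rfl | hij
        · exact (key i j hi hj hij).1
        · exact absurd rfl hne'
        · exact (key j i hj hi hij).2 }
  have hidx : ∀ e f, ρ.EdgeLT e f → l.idxOf e < l.idxOf f := by
    have hone : ∀ e f, (∃ v, ρ.LocalLT v e f) → l.idxOf e < l.idxOf f := by
      rintro e f ⟨v, he, hf, hne', hve, hvf, hlt⟩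
      have he' : e ∈ l := List.mem_toFinset.1 he
      have hf' : f ∈ l := List.mem_toFinset.1 hf
      have hi := List.idxOf_lt_length_of_mem he'
      have hj := List.idxOf_lt_length_of_mem hf'
      have ge : l[l.idxOf e] = e := List.getElem_idxOf _
      have gf : l[l.idxOf f] = f := List.getElem_idxOf _
      rcases lt_trichotomy (l.idxOf e) (l.idxOf f) with h | h | h
      · exact h
      · refine absurd ?_ hne'
        rw [← ge, ← gf]
        congr 1
      -- If `f` came before `e`, it would lie in the block of `v` when `e` is added, and the star
      -- condition at `v` would put `f` to the left of `e`.
      · exfalso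
        have hr := hrel _ _ hj hi h
        have hs := hstar _ hi
        rw [gf] at hr
        rw [ge] at hs
        obtain ⟨a, ha, hav⟩ := ρ.exists_ne he v
        obtain ⟨b, hb, hbv⟩ := ρ.exists_ne hf v
        exact lt_asymm (hs v hve a ha hav b (hr v hvf b hb)) (hlt a ha b hb hav hbv)
    intro e f h
    induction h with
    | single h => exact hone _ _ h
    | tail _ h ih => exact ih.trans (hone _ _ h)
  refine ⟨ρ, hnodup, rfl, ?_⟩
  rw [List.pairwise_iff_getElem]
  intro i j hi hj hij h
  have := hidx _ _ h
  rw [List.Nodup.idxOf_getElem hnodup, List.Nodup.idxOf_getElem hnodup] at this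
  omega

/-- The first element `y` of a block after a vertex `w`, and a vertex `u` in the same gap. -/
theorem lt_of_not_cross {y z w u : Fin (n + 1)} (h : ¬ Cross y z w u) (hle : y - w ≤ z - w)
    (hzy : z ≠ y) (hwy : w ≠ y) (huy : u ≠ y) (huz : u ≠ z) (hwz : w ≠ z) :
    z - y < u - y := by
  have e1 := sub_val_cases y w
  have e2 := sub_val_cases z w
  have e3 := sub_val_cases z y
  have e4 := sub_val_cases w y
  have e5 := sub_val_cases u y
  simp only [Cross, Fin.lt_def, Fin.le_def, ne_eq, Fin.ext_iff] at *
  omega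

/-- A set of vertices that meets each block at most once and does not cross any block can be
moved within the blocks to satisfy the star condition. -/
theorem exists_star {p : Setoid (Fin (n + 1))} {e : Finset (Fin (n + 1))} (hp : IsNC p)
    (he : 2 ≤ e.card) (ht : ∀ y ∈ e, ∀ y' ∈ e, p y y' → y = y')
    (hX : ∀ y ∈ e, ∀ y' ∈ e, ∀ z z', p z z' → ¬ p z y → ¬ p z y' → ¬ Cross y y' z z') :
    ∃ e' : Finset (Fin (n + 1)), 2 ≤ e'.card ∧ Star p e' ∧ merge p e' = merge p e := by
  classical
  have h1 : ∀ x, ∃ w ∈ e, w ≠ x := Finset.exists_mem_ne he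
  choose w hwe hwx using h1
  -- The vertex `x` is moved to the first vertex `g x` of its block as seen from another vertex `w
  -- x` of `e`. All other vertices of `e`, and their moved copies, lie in the same gap of this block
  -- as `w x`, so seen from `g x` the whole block comes before them.
  have h2 : ∀ x, ∃ g, p x g ∧ ∀ z, p x z → g - w x ≤ z - w x := by
    intro x
    obtain ⟨g, hg, hmin⟩ := Finset.exists_min_image (Finset.univ.filter fun z => p x z)
      (fun z => z - w x) ⟨x, by simp⟩
    exact ⟨g, (Finset.mem_filter.1 hg).2, fun z hz => hmin z (by simp [hz])⟩
  choose g hg hmin using h2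
  refine ⟨e.image g, ?_, ?_, ?_⟩
  · rw [Finset.card_image_of_injOn]
    · exact he
    · intro a ha b hb hab
      refine ht a ha b hb (p.trans (hg a) (p.symm ?_))
      rw [show g a = g b from hab]
      exact hg b
  · intro y hy y' hy' hne z hz
    obtain ⟨x1, hx1, rfl⟩ := Finset.mem_image.1 hy
    obtain ⟨x2, hx2, rfl⟩ := Finset.mem_image.1 hy'
    have hx12 : ¬ p x1 x2 := by
      intro h
      obtain rfl := ht x1 hx1 x2 hx2 h
      exact hne rfl
    have hx1w : ¬ p x1 (w x1) := fun h => hwx x1 (ht x1 hx1 _ (hwe x1) h).symm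
    have hx1z : p x1 z := p.trans (hg x1) hz
    by_cases hzy : z = g x1
    · rw [hzy, sub_self, Fin.pos_iff_ne_zero]
      exact sub_ne_zero.2 hne
    have n1 : ¬ Cross (g x1) z (w x1) x2 := fun h =>
      hX (w x1) (hwe x1) x2 hx2 (g x1) z hz (fun h => hx1w (p.trans (hg x1) h))
        (fun h => hx12 (p.trans (hg x1) h)) h.swap
    have n2 : ¬ Cross (g x1) z x2 (g x2) := fun h =>
      hx12 (p.trans (hg x1) (hp.of_cross h hz (hg x2)))
    have b1 : ∀ u, ¬ p x1 u → u ≠ g x1 ∧ u ≠ z := by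
      intro u hu
      constructor
      · rintro rfl; exact hu (hg x1)
      · rintro rfl; exact hu hx1z
    have hg2 : ¬ p x1 (g x2) := fun h => hx12 (p.trans h (p.symm (hg x2)))
    exact lt_of_not_cross (Cross.trans_of_not (b1 _ hx12).1 (b1 _ hx12).2 n1 n2)
      (hmin x1 z hx1z) hzy (b1 _ hx1w).1 (b1 _ hg2).1 (b1 _ hg2).2 (b1 _ hx1w).2
  · apply le_antisymm
    · refine merge_le_iff.2 ⟨le_merge _ _, fun a ha b hb => ?_⟩
      obtain ⟨x1, hx1, rfl⟩ := Finset.mem_image.1 ha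
      obtain ⟨x2, hx2, rfl⟩ := Finset.mem_image.1 hb
      exact Or.inr ⟨⟨x1, hx1, p.symm (hg x1)⟩, ⟨x2, hx2, p.symm (hg x2)⟩⟩
    · refine merge_le_iff.2 ⟨le_merge _ _, fun a ha b hb => ?_⟩
      exact Or.inr ⟨⟨_, Finset.mem_image_of_mem g ha, hg a⟩, ⟨_, Finset.mem_image_of_mem g hb, hg b⟩⟩

theorem sub_lt_sub_of_cyclic {a y x b : Fin (n + 1)} (h1 : y - a < x - a) (h2 : b - x < a - x)
    (hya : y ≠ a) : b - y < a - y := by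
  have e1 := sub_val_cases y a
  have e2 := sub_val_cases x a
  have e3 := sub_val_cases b x
  have e4 := sub_val_cases a x
  have e5 := sub_val_cases b y
  have e6 := sub_val_cases a y
  simp only [Fin.lt_def, ne_eq, Fin.ext_iff] at *
  omega

/-- Exchanging two disjoint consecutive factors: `x` and `y` are the factors of
`p < merge p x < merge (merge p x) y`, and `f` merges the same blocks of `merge p x` as `y`. -/
theorem merge_eq_of_disjoint {p : Setoid (Fin (n + 1))} {x y f : Finset (Fin (n + 1))}
    (hx : Star p x) (hy : Star (merge p x) y) (hxy : Disjoint x y) (hy2 : 2 ≤ y.card)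
    (hf2 : 2 ≤ f.card) (hf : ∀ b ∈ f, ∀ b' ∈ f, merge p x b b' → b = b')
    (heq : merge (merge p x) y = merge (merge p x) f) (hnc : IsNC (merge p f)) :
    merge p y = merge p f := by
  set q := merge p x with hq
  have hyt : ∀ b ∈ y, ∀ b' ∈ y, q b b' → b = b' := fun b hb b' hb' h =>
    (hy.eq_of_rel hb hb' h).symm
  have hfy : ∀ b ∈ f, ∃ c ∈ y, q b c := by
    intro b hb
    obtain ⟨b2, hb2, hne⟩ := Finset.exists_mem_ne hf2 b
    have h : merge q y b b2 := by rw [heq]; exact merge_mem hb hb2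
    rcases h with h | h
    · exact absurd (hf b hb b2 hb2 h).symm hne
    · exact h.1
  have hyf : ∀ c ∈ y, ∃ b ∈ f, q c b := by
    intro b hb
    obtain ⟨b2, hb2, hne⟩ := Finset.exists_mem_ne hy2 b
    have h : merge q f b b2 := by rw [← heq]; exact merge_mem hb hb2
    rcases h with h | h
    · exact absurd (hyt b hb b2 hb2 h).symm hne
    · exact h.1
  -- Suppose that `b` and `c` become related only through `x`, at vertices `xb` and `xc`. The star
  -- conditions, together with `c ≠ xc` from disjointness, give the cyclic order `c, b, xc, c2`,
  -- where `c2` is another vertex of `y` in the `p`-block of some `b2 ∈ f`. Then `b c2` crosses `c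
  -- xc`, and since `merge p f` is noncrossing, `c` is in the `p`-block of a vertex of `f`. That
  -- vertex must be `b`.
  have core : ∀ b ∈ f, ∀ c ∈ y, q b c → p b c := by
    intro b hb c hc hbc
    by_contra hnp
    obtain ⟨⟨xb, hxb, hbxb⟩, ⟨xc, hxc, hcxc⟩⟩ := Or.resolve_left hbc hnp
    have hne : xb ≠ xc := by
      rintro rfl
      exact hnp (p.trans hbxb (p.symm hcxc))
    have hcx : c ≠ xc := fun h => Finset.disjoint_left.1 hxy hxc (h ▸ hc)
    obtain ⟨b2, hb2, hb2b⟩ := Finset.exists_mem_ne hf2 b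
    obtain ⟨c2, hc2, hbc2⟩ := hfy b2 hb2
    have hc2c : c2 ≠ c := by
      rintro rfl
      exact hb2b (hf b2 hb2 b hb (q.trans hbc2 (q.symm hbc)))
    have hp2 : p b2 c2 := by
      rcases hbc2 with h | ⟨h, -⟩
      · exact h
      · exact absurd (hf b2 hb2 b hb (Or.inr ⟨h, ⟨xb, hxb, hbxb⟩⟩)) hb2b
    have s1 := hy c hc c2 hc2 hc2c xc (Or.inl hcxc)
    have s2 := hx xc hxc xb hxb hne c (p.symm hcxc)
    have s3 := hx xb hxb xc hxc hne.symm b (p.symm hbxb)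
    have s4 := sub_lt_sub_of_cyclic s2 s3 hcx
    have hbc' : b ≠ c := by
      rintro rfl
      exact hnp (p.refl _)
    have hX : Cross c xc b c2 := ⟨hbc', hc2c, Or.inl ⟨s4, s1⟩⟩
    have hm := hnc.of_cross hX (Or.inl hcxc)
      ((merge p f).trans (merge_mem hb hb2) (Or.inl hp2))
    rcases hm with h | ⟨⟨b3, hb3, hcb3⟩, -⟩
    · exact hnp (p.symm h)
    · have : b = b3 := hf b hb b3 hb3 (q.trans hbc (Or.inl hcb3))
      subst this
      exact hnp (p.symm hcb3)
  apply le_antisymm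
  · refine merge_le_iff.2 ⟨le_merge _ _, fun a ha b hb => ?_⟩
    obtain ⟨a', ha', haa⟩ := hyf a ha
    obtain ⟨b', hb', hbb⟩ := hyf b hb
    exact Or.inr ⟨⟨a', ha', p.symm (core a' ha' a ha (q.symm haa))⟩,
      ⟨b', hb', p.symm (core b' hb' b hb (q.symm hbb))⟩⟩
  · refine merge_le_iff.2 ⟨le_merge _ _, fun a ha b hb => ?_⟩
    obtain ⟨a', ha', haa⟩ := hfy a ha
    obtain ⟨b', hb', hbb⟩ := hfy b hb
    exact Or.inr ⟨⟨a', ha', core a ha a' ha' haa⟩, ⟨b', hb', core b hb b' hb' hbb⟩⟩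

/-! ### Linear extensions -/

/-- A property of lists that survives exchanging two consecutive unrelated elements of a linear
extension passes from one linear extension to any other. -/
theorem linearExtension_induction {α : Type*} {R : α → α → Prop} {P : List α → Prop}
    (hswap : ∀ Q x y B, (Q ++ x :: y :: B).Pairwise (fun a b => ¬ R b a) →
      (Q ++ y :: x :: B).Pairwise (fun a b => ¬ R b a) →
      P (Q ++ x :: y :: B) → P (Q ++ y :: x :: B)) {l m : List α} (hlm : l.Perm m)
    (hl : l.Pairwise fun a b => ¬ R b a) (hm : m.Pairwise fun a b => ¬ R b a) (h : P l) : P m := by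
  -- Bubble sort: `x` moves to the front of `A` by exchanges with unrelated neighbours. It is
  -- applied to the first element of the target list `m`, which no element standing before it in the
  -- current list is related to.
  have hmove : ∀ (A : List α) (Q B : List α) (x : α), (∀ a ∈ A, ¬ R x a) → (∀ a ∈ A, ¬ R a x) →
      (Q ++ (A ++ x :: B)).Pairwise (fun a b => ¬ R b a) → P (Q ++ (A ++ x :: B)) →
      (Q ++ x :: (A ++ B)).Pairwise (fun a b => ¬ R b a) ∧ P (Q ++ x :: (A ++ B)) := by
    intro A
    induction A using List.reverseRecOn with
    | nil => intro Q B x _ _ hp h; exact ⟨hp, h⟩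
    | append_singleton A a ih =>
      intro Q B x h1 h2 hp h
      have e1 : Q ++ (A ++ [a] ++ x :: B) = (Q ++ A) ++ a :: x :: B := by simp
      have e2 : (Q ++ A) ++ x :: a :: B = Q ++ (A ++ x :: (a :: B)) := by simp
      have e3 : Q ++ x :: (A ++ [a] ++ B) = Q ++ x :: (A ++ a :: B) := by simp
      rw [e1] at hp h
      have hp' : (Q ++ A ++ x :: a :: B).Pairwise (fun a b => ¬ R b a) := by
        have h2a := h2 a (by simp)
        simp only [List.pairwise_append, List.pairwise_cons, List.mem_cons] at hp ⊢
        refine ⟨hp.1, ⟨?_, ?_, hp.2.1.2.2⟩, ?_⟩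
        · rintro b (rfl | hb)
          · exact h2a
          · exact hp.2.1.2.1 b hb
        · exact fun b hb => hp.2.1.1 b (Or.inr hb)
        · intro c hc b hb
          exact hp.2.2 c hc b (by tauto)
      have h' := hswap _ _ _ _ hp hp' h
      rw [e2] at hp' h'
      rw [e3]
      exact ih Q (a :: B) x (fun b hb => h1 b (by simp [hb])) (fun b hb => h2 b (by simp [hb])) hp' h'
  suffices key : ∀ (m Q l : List α), l.Perm m → (Q ++ l).Pairwise (fun a b => ¬ R b a) →
      m.Pairwise (fun a b => ¬ R b a) → P (Q ++ l) → P (Q ++ m) from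
    key m [] l hlm (by simpa using hl) hm h
  intro m
  induction m with
  | nil => intro Q l hp _ _ h; rwa [hp.eq_nil] at h
  | cons x m ih =>
    intro Q l hp hl hm h
    obtain ⟨A, B, rfl⟩ := List.append_of_mem (hp.mem_iff.2 (List.mem_cons_self (a := x) (l := m)))
    have hAB : (A ++ B).Perm m := by
      have := List.perm_middle.symm.trans hp
      exact (List.perm_cons x).1 this
    have h1 : ∀ a ∈ A, ¬ R x a := fun a ha => by
      have := (List.pairwise_append.1 hl).2.1
      exact (List.pairwise_append.1 this).2.2 a ha x (by simp)
    have h2 : ∀ a ∈ A, ¬ R a x := fun a ha =>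
      (List.pairwise_cons.1 hm).1 a (hAB.mem_iff.1 (by simp [ha]))
    obtain ⟨hl', h'⟩ := hmove A Q B x h1 h2 hl h
    have := ih (Q ++ [x]) (A ++ B) hAB (by simpa using hl') (List.pairwise_cons.1 hm).2 (by simpa using h')
    simpa using this

/-- A chain of subsets of `U` consists of initial segments of an enumeration of `U`. -/
theorem exists_list_of_isChain {α : Type*} [DecidableEq α] (U : Finset α) (𝒜 : Finset (Finset α))
    (hA : ∀ A ∈ 𝒜, A ⊆ U) (hc : IsChain (· ⊆ ·) (𝒜 : Set (Finset α))) :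
    ∃ l : List α, l.Nodup ∧ l.toFinset = U ∧ ∀ A ∈ 𝒜, ∃ i ≤ l.length, (l.take i).toFinset = A := by
  induction hk : U.card generalizing U 𝒜 with
  | zero =>
    rw [Finset.card_eq_zero] at hk
    subst hk
    exact ⟨[], by simp, by simp, fun A h => ⟨0, le_rfl, by simp [Finset.subset_empty.1 (hA A h)]⟩⟩
  | succ k ih =>
    -- The last element of the enumeration is taken outside the largest proper member of the chain,
    -- so it belongs to no member except possibly `U`.
    obtain ⟨u, hu, huA⟩ : ∃ u ∈ U, ∀ A ∈ 𝒜, A ≠ U → u ∉ A := by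
      by_cases hne : (𝒜.erase U).Nonempty
      · obtain ⟨M, hM, hmax⟩ := Finset.exists_max_image (𝒜.erase U) Finset.card hne
        rw [Finset.mem_erase] at hM
        obtain ⟨u, hu, huM⟩ := Finset.exists_of_ssubset (lt_of_le_of_ne (hA M hM.2) hM.1)
        refine ⟨u, hu, fun A hA' hAU huA => huM ?_⟩
        rcases hc.total hA' hM.2 with h | h
        · exact h huA
        · rwa [Finset.eq_of_subset_of_card_le h (hmax A (Finset.mem_erase.2 ⟨hAU, hA'⟩))]
      · obtain ⟨u, hu⟩ := Finset.card_pos.1 (show 0 < U.card by omega)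
        refine ⟨u, hu, fun A hA' hAU => absurd ⟨A, Finset.mem_erase.2 ⟨hAU, hA'⟩⟩ hne⟩
    obtain ⟨l, h1, h2, h3⟩ := ih (U.erase u) (𝒜.erase U)
      (fun A hA' => by
        rw [Finset.mem_erase] at hA'
        exact Finset.subset_erase.2 ⟨hA A hA'.2, huA A hA'.2 hA'.1⟩)
      (hc.mono (by simp)) (by rw [Finset.card_erase_of_mem hu, hk]; rfl)
    have hul : u ∉ l := by rw [← List.mem_toFinset, h2]; simp
    have hlU : (l ++ [u]).toFinset = U := by
      ext a
      rw [List.toFinset_append, h2]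
      by_cases h : a = u <;> simp [h, hu]
    refine ⟨l ++ [u], ?_, hlU, fun A hA' => ?_⟩
    · rw [List.nodup_append]
      refine ⟨h1, by simp, ?_⟩
      rintro a ha b hb rfl
      simp only [List.mem_singleton] at hb
      exact hul (hb ▸ ha)
    · by_cases hAU : A = U
      · exact ⟨l.length + 1, by simp, by rw [List.take_of_length_le (by simp), hlU, hAU]⟩
      · obtain ⟨i, hi, hiA⟩ := h3 A (Finset.mem_erase.2 ⟨hAU, hA'⟩)
        exact ⟨i, by simp; omega, by rw [List.take_append_of_le_length hi, hiA]⟩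

theorem components_take_succ {l : List (Finset (Fin (n + 1)))} {i : ℕ} (hi : i < l.length) :
    components (l.take (i + 1)).toFinset = merge (components (l.take i).toFinset) l[i] := by
  rw [List.take_add_one, List.toFinset_append]
  simp only [List.getElem?_eq_getElem hi, Option.toList_some, List.toFinset_cons,
    List.toFinset_nil, insert_empty_eq, Finset.union_comm _ {l[i]}, ← Finset.insert_eq,
    components_insert]

theorem closedSimplex_mono {c d : Set (NCPart n)} (h : ∀ p ∈ c, p ≠ ⊥ → p ≠ ⊤ → p ∈ d) :
    closedSimplex c ⊆ closedSimplex d := by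
  intro x hx p hp
  refine h p (hx p hp) ?_ ?_
  · rintro rfl; exact hp x.2.2.1
  · rintro rfl; exact hp x.2.2.2.1

end NCHT

/-! ### Chains of proper orderings and the face relation. -/

namespace NCHypertree

open NCHT

variable {n : ℕ} {τ : NCHypertree n}

/-- The star conditions provide the permutation identities through `perm_merge`. They also make the
chain strict, since two vertices of `l[i]` are never in one block of the preceding components. -/
theorem exists_hasStandardName {l : List (Finset (Fin (n + 1)))}
    (hcard : ∀ e ∈ l, 2 ≤ e.card)
    (hstar : ∀ i (hi : i < l.length), Star (components (l.take i).toFinset) l[i])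
    (hnc : ∀ i, IsNC (components (l.take i).toFinset))
    (htop : components l.toFinset = ⊤) :
    ∃ c : Fin (l.length + 1) → NCPart n, HasStandardName l c ∧
      ∀ i, (c i).1 = components (l.take i).toFinset := by
  refine ⟨fun i => ⟨components (l.take i).toFinset, hnc i⟩, ⟨?_, ?_, ?_, ?_⟩, fun i => rfl⟩
  · refine Fin.strictMono_iff_lt_succ.2 fun i => ?_
    refine lt_of_le_of_ne ?_ ?_
    · show components _ ≤ components _
      refine components_mono fun e he => ?_
      rw [List.mem_toFinset] at he ⊢
      exact (List.take_sublist_take_left (by simp)).subset he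
    · intro h
      have h' : components (l.take i).toFinset = components (l.take (i + 1)).toFinset :=
        congrArg Subtype.val h
      rw [components_take_succ i.2] at h'
      have h2 := hcard _ (List.getElem_mem i.2)
      obtain ⟨a, ha⟩ := Finset.card_pos.1 (lt_of_lt_of_le two_pos h2)
      obtain ⟨b, hb, hba⟩ := Finset.exists_mem_ne h2 a
      refine hba ((hstar i i.2).eq_of_rel ha hb ?_)
      rw [h']
      exact merge_mem ha hb
  · apply Subtype.ext
    simp
    rfl
  · apply Subtype.ext
    simp [htop]
    rfl
  · intro i
    refine perm_merge ?_ (hstar i i.2)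
    exact components_take_succ i.2

theorem IsProperOrdering.take_subset {l : List (Finset (Fin (n + 1)))}
    (h : τ.IsProperOrdering l) (i : ℕ) : (l.take i).toFinset ⊆ τ.edges := by
  intro e he
  rw [← h.2.1, List.mem_toFinset]
  exact List.mem_of_mem_take (List.mem_toFinset.1 he)

theorem IsProperOrdering.star_take {l : List (Finset (Fin (n + 1)))}
    (h : τ.IsProperOrdering l) (i : ℕ) (hi : i < l.length) :
    Star (components (l.take i).toFinset) l[i] := by
  rw [list_eq_take_cons_drop l i hi] at h
  exact h.star

theorem IsProperOrdering.exists_hasStandardName {l : List (Finset (Fin (n + 1)))}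
    (h : τ.IsProperOrdering l) : ∃ c : Fin (l.length + 1) → NCPart n, HasStandardName l c ∧
      ∀ i, (c i).1 = components (l.take i).toFinset := by
  refine NCHypertree.exists_hasStandardName (fun e he => ?_) h.star_take
    (fun i => τ.isNC_components (h.take_subset i)) ?_
  · exact τ.two_le_card e (h.2.1 ▸ List.mem_toFinset.2 he)
  · rw [h.2.1, τ.components_edges]

theorem simplex_subset_sphere (τ : NCHypertree n) : τ.simplex ⊆ τ.sphere := by
  rintro x ⟨l, hl, c, hc, hx⟩ p hp
  obtain ⟨i, rfl⟩ := hx p hp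
  exact ⟨_, hl.take_subset i, hc.eq_components i⟩

/-- Inside a hyperedge `f` of a coarser hypertree `σ`, the hyperedges of `ρ` connect `f`. -/
theorem components_filter_subset {ρ σ : NCHypertree n} (h : ρ ≤ σ) {f : Finset (Fin (n + 1))}
    (hf : f ∈ σ.edges) {a b : Fin (n + 1)} (ha : a ∈ f) (hb : b ∈ f) :
    components (ρ.edges.filter (· ⊆ f)) a b := by
  classical
  set G := ρ.edges.filter (· ⊆ f) with hG
  have hsub : σ.edges.erase f ⊆ σ.edges := Finset.erase_subset _ _
  have hback : ∀ w ∈ f, ∀ z ∈ f, components (σ.edges.erase f) w z → w = z := fun w hw z hz hwz =>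
    σ.eq_of_components hsub hf (by simp) hw hz hwz
  -- Each vertex `z` of a walk in `ρ` is projected to the vertex `w` of `f` at which `z` is attached
  -- to `f` by hyperedges of `σ` other than `f`. Steps inside `f` move the projection along
  -- hyperedges of `ρ` contained in `f`, and all other steps leave it fixed.
  obtain ⟨w, hw, haw, hwb⟩ : ∃ w ∈ f, components G a w ∧ components (σ.edges.erase f) w b := by
    refine components_induction (F := ρ.edges)
      (P := fun z => ∃ w ∈ f, components G a w ∧ components (σ.edges.erase f) w z)
      ⟨a, ha, Setoid.refl' _ a, Setoid.refl' _ a⟩ ?_ (ρ.connected a b)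
    rintro e he x hx y hy - ⟨w, hw, haw, hwx⟩
    by_cases hef : e ⊆ f
    · obtain rfl := hback w hw x (hef hx) hwx
      refine ⟨y, hef hy, ?_, Setoid.refl' _ y⟩
      exact Setoid.trans' _ haw (components_rel (Finset.mem_filter.2 ⟨he, hef⟩) hx hy)
    · obtain ⟨f', hf', hef'⟩ := h e he
      have hne : f' ≠ f := by
        rintro rfl
        exact hef hef'
      exact ⟨w, hw, haw, Setoid.trans' _ hwx
        (components_rel (Finset.mem_erase.2 ⟨hne, hf'⟩) (hef' hx) (hef' hy))⟩
  rwa [← hback w hw b hb hwb]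

/-- Two different hyperedges of `σ` that share `v` are comparable at `v`, and the hyperedges of `ρ`
inside them decide the direction. Equality occurs when both lie in the same hyperedge of `σ`. -/
theorem edgeLT_of_le {ρ σ : NCHypertree n} (h : ρ ≤ σ) {e e' : Finset (Fin (n + 1))}
    (hlt : ρ.EdgeLT e e') : ∀ f ∈ σ.edges, ∀ f' ∈ σ.edges, e ⊆ f → e' ⊆ f' →
      f = f' ∨ σ.EdgeLT f f' := by
  have hone : ∀ e e' v, ρ.LocalLT v e e' → ∀ f ∈ σ.edges, ∀ f' ∈ σ.edges, e ⊆ f → e' ⊆ f' →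
      f = f' ∨ σ.EdgeLT f f' := by
    intro e e' v hl f hf f' hf' hef hef'
    by_cases hne : f = f'
    · exact Or.inl hne
    · right
      rcases σ.localLT_or hf hf' hne (hef hl.2.2.2.1) (hef' hl.2.2.2.2.1) with hlt | hlt
      · exact hlt.edgeLT
      · exfalso
        obtain ⟨a, ha, hav⟩ := ρ.exists_ne hl.1 v
        obtain ⟨b, hb, hbv⟩ := ρ.exists_ne hl.2.1 v
        exact lt_asymm (hl.2.2.2.2.2 a ha b hb hav hbv)
          (hlt.2.2.2.2.2 b (hef' hb) a (hef ha) hbv hav)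
  induction hlt with
  | single h => exact hone _ _ _ h.choose_spec
  | tail _ hl ih =>
    intro f hf f' hf' hef hef'
    obtain ⟨v, hl⟩ := hl
    obtain ⟨g, hg, hbg⟩ := h _ hl.1
    rcases ih f hf g hg hef hbg with rfl | h1
    · exact hone _ _ v hl f hf f' hf' hbg hef'
    · rcases hone _ _ v hl g hg f' hf' hbg hef' with rfl | h2
      · exact Or.inr h1
      · exact Or.inr (h1.trans h2)

/-- If `ρ ≤ σ`, the simplex of `σ` is a face of the simplex of `ρ`. -/
theorem simplex_subset_of_le {ρ σ : NCHypertree n} (h : ρ ≤ σ) : σ.simplex ⊆ ρ.simplex := by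
  classical
  rintro x ⟨l, hl, c, hc, hx⟩
  obtain ⟨l₀, h₀⟩ := ρ.exists_isProperOrdering
  -- Each hyperedge `f` in a proper ordering of `σ` is replaced by the hyperedges of `ρ` inside `f`,
  -- in the order of a fixed proper ordering of `ρ`. The prefix of `m` that comes from the first `i`
  -- hyperedges of `σ` has the same components as these, so the chain of `σ` is part of the chain of
  -- `m`.
  let m := l.flatMap fun f => l₀.filter (· ⊆ f)
  have hmem₀ : ∀ e, e ∈ l₀ ↔ e ∈ ρ.edges := fun e => by rw [← h₀.2.1, List.mem_toFinset]
  have hmem : ∀ f, f ∈ l ↔ f ∈ σ.edges := fun e => by rw [← hl.2.1, List.mem_toFinset]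
  have huniq : ∀ e ∈ ρ.edges, ∀ f ∈ σ.edges, ∀ f' ∈ σ.edges, e ⊆ f → e ⊆ f' → f = f' := by
    intro e he f hf f' hf' hef hef'
    by_contra hne
    obtain ⟨a, ha⟩ := Finset.card_pos.1 (lt_of_lt_of_le two_pos (ρ.two_le_card e he))
    obtain ⟨b, hb, hba⟩ := ρ.exists_ne he a
    exact hba (σ.eq_of_mem_mem hf hf' hne (hef hb) (hef' hb) (hef ha) (hef' ha))
  have hpw : l.Pairwise fun f f' => f ≠ f' := hl.1
  have hm : ρ.IsProperOrdering m := by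
    refine ⟨?_, ?_, ?_⟩
    · rw [List.nodup_flatMap]
      refine ⟨fun f _ => h₀.1.filter _, ?_⟩
      refine hpw.imp_of_mem fun {f f'} hf hf' hne => ?_
      intro e he he'
      simp only [List.mem_filter, decide_eq_true_eq] at he he'
      exact hne (huniq e ((hmem₀ e).1 he.1) f ((hmem f).1 hf) f' ((hmem f').1 hf') he.2 he'.2)
    · ext e
      simp only [m, List.mem_toFinset, List.mem_flatMap, List.mem_filter, decide_eq_true_eq, hmem₀]
      constructor
      · rintro ⟨f, -, he, -⟩
        exact he
      · intro he
        obtain ⟨f, hf, hef⟩ := h e he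
        exact ⟨f, (hmem f).2 hf, he, hef⟩
    · rw [List.pairwise_flatMap]
      refine ⟨fun f _ => h₀.2.2.filter _, ?_⟩
      refine (hpw.and hl.2.2).imp_of_mem fun {f f'} hf hf' ⟨hne, hnlt⟩ a ha b hb hlt => ?_
      simp only [List.mem_filter, decide_eq_true_eq] at ha hb
      rcases edgeLT_of_le h hlt f' ((hmem _).1 hf') f ((hmem _).1 hf) hb.2 ha.2 with h1 | h1
      · exact hne h1.symm
      · exact hnlt h1
  obtain ⟨d, hd, hdc⟩ := hm.exists_hasStandardName
  refine ⟨m, hm, d, hd, fun p hp => ?_⟩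
  obtain ⟨i, rfl⟩ := hx p hp
  have hpre : (l.take i).flatMap (fun f => l₀.filter (· ⊆ f)) <+: m := by
    refine ⟨(l.drop i).flatMap fun f => l₀.filter (· ⊆ f), ?_⟩
    rw [← List.flatMap_append, List.take_append_drop]
  obtain ⟨B, hB⟩ := hpre
  set A := (l.take i).flatMap (fun f => l₀.filter (· ⊆ f)) with hA
  have hlen : A.length < m.length + 1 := by
    rw [← hB, List.length_append]; omega
  refine ⟨⟨A.length, hlen⟩, Subtype.ext ?_⟩
  rw [hdc, hc.eq_components]
  simp only
  rw [← hB, List.take_left]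
  apply le_antisymm
  · refine components_le_iff.2 fun e he a ha b hb => ?_
    simp only [hA, List.mem_toFinset, List.mem_flatMap, List.mem_filter, decide_eq_true_eq] at he
    obtain ⟨f, hf, -, hef⟩ := he
    exact components_rel (List.mem_toFinset.2 hf) (hef ha) (hef hb)
  · refine components_le_iff.2 fun f hf a ha b hb => ?_
    have hfl := List.mem_toFinset.1 hf
    have hfσ := (hmem f).1 (List.mem_of_mem_take hfl)
    refine components_mono ?_ (components_filter_subset h hfσ ha hb)
    intro e he
    rw [Finset.mem_filter] at he
    simp only [hA, List.mem_toFinset, List.mem_flatMap, List.mem_filter, decide_eq_true_eq]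
    exact ⟨f, hfl, (hmem₀ e).2 he.1, he.2⟩

end NCHypertree

/-! ### The sphere of a hypertree as a subcomplex. -/

namespace NCHypertree

open NCHT

variable {n : ℕ} {τ : NCHypertree n}

/-- The list `l` has the same components of initial segments as an enumeration of the hyperedges
of `τ`. -/
def IsRenaming (τ : NCHypertree n) (m : List (Finset (Fin (n + 1)))) : Prop :=
  ∃ l : List (Finset (Fin (n + 1))), l.Nodup ∧ l.toFinset = τ.edges ∧ l.length = m.length ∧
    ∀ i, components (l.take i).toFinset = components (m.take i).toFinset

theorem take_toFinset_subset {l : List (Finset (Fin (n + 1)))}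
    (h : l.toFinset = τ.edges) (i : ℕ) : (l.take i).toFinset ⊆ τ.edges := by
  intro e he
  rw [← h, List.mem_toFinset]
  exact List.mem_of_mem_take (List.mem_toFinset.1 he)

theorem notMem_take {l : List (Finset (Fin (n + 1)))} (h : l.Nodup) {i j : ℕ} (hj : j < l.length)
    (hij : i ≤ j) : l[j] ∉ (l.take i).toFinset := by
  rw [List.mem_toFinset, List.mem_take_iff_getElem]
  rintro ⟨k, hk, heq⟩
  have := (h.getElem_inj_iff).1 heq
  omega

/-- Enumerations of the hyperedges of `τ` can be replaced by factorizations. -/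
theorem exists_star_list {l : List (Finset (Fin (n + 1)))} (hnd : l.Nodup)
    (hl : l.toFinset ⊆ τ.edges) : ∃ m : List (Finset (Fin (n + 1))), m.length = l.length ∧
      (∀ e ∈ m, 2 ≤ e.card) ∧
      (∀ i (hi : i < m.length), Star (components (m.take i).toFinset) m[i]) ∧
      ∀ i, components (m.take i).toFinset = components (l.take i).toFinset := by
  induction l using List.reverseRecOn with
  | nil => exact ⟨[], by simp⟩
  | append_singleton A e ih =>
    have hA : A.toFinset ⊆ τ.edges := by
      rw [List.toFinset_append] at hl
      exact Finset.subset_union_left.trans hl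
    have he : e ∈ τ.edges := hl (by simp)
    have heA : e ∉ A.toFinset := by
      rw [List.nodup_append] at hnd
      rw [List.mem_toFinset]
      exact fun h => hnd.2.2 e h e (by simp) rfl
    obtain ⟨m, hlen, hcard, hstar, hcomp⟩ := ih (List.nodup_append.1 hnd).1 hA
    obtain ⟨e', h1, h2, h3⟩ := exists_star (τ.isNC_components hA) (τ.two_le_card e he)
      (fun y hy y' hy' h => τ.eq_of_components hA he heA hy hy' h)
      (fun y hy y' hy' z z' hz hzy hzy' => τ.not_cross_components hA he heA hy hy' hzy hzy' hz)
    have hmA : components m.toFinset = components A.toFinset := by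
      have := hcomp A.length
      rwa [List.take_length, ← hlen, List.take_length] at this
    refine ⟨m ++ [e'], by simp [hlen], ?_, ?_, ?_⟩
    · intro f hf
      rcases List.mem_append.1 hf with hf | hf
      · exact hcard f hf
      · rw [List.mem_singleton.1 hf]; exact h1
    · intro i hi
      rw [List.length_append, List.length_singleton] at hi
      rcases Nat.lt_or_ge i m.length with him | him
      · rw [List.take_append_of_le_length him.le, List.getElem_append_left him]
        exact hstar i him
      · obtain rfl : i = m.length := by omega
        rw [List.take_left, List.getElem_append_right le_rfl, hmA]
        simpa using h2
    · intro i
      rcases Nat.lt_or_ge m.length i with him | him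
      · rw [List.take_of_length_le (by simp; omega), List.take_of_length_le (by simp; omega)]
        have hS : ∀ (B : List (Finset (Fin (n + 1)))) (f : Finset (Fin (n + 1))),
            (B ++ [f]).toFinset = insert f B.toFinset := by
          intro B f; ext; simp
        rw [hS, hS, components_insert, components_insert, hmA, h3]
      · rw [List.take_append_of_le_length him, List.take_append_of_le_length (hlen ▸ him), hcomp]

/-- Since `x` and `y` may stand in either order they share no vertex, as a common vertex would make
them comparable. Hence `merge_eq_of_disjoint` shows that exchanging them changes the chain in the
same way as exchanging the corresponding hyperedges of `τ`. -/
theorem isRenaming_swap {ρ : NCHypertree n} {Q B : List (Finset (Fin (n + 1)))}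
    {x y : Finset (Fin (n + 1))} (h1 : ρ.IsProperOrdering (Q ++ x :: y :: B))
    (h2 : ¬ ρ.EdgeLT x y) (h : τ.IsRenaming (Q ++ x :: y :: B)) :
    τ.IsRenaming (Q ++ y :: x :: B) := by
  obtain ⟨l, hnd, hl, hlen, hcomp⟩ := h
  set q := Q.length with hq
  have hq1 : q < l.length := by rw [hlen]; simp [hq]
  have hq2 : q + 1 < l.length := by rw [hlen]; simp [hq]
  have hsplit : l = l.take q ++ l[q] :: l[q + 1] :: l.drop (q + 2) := by
    rw [← List.drop_eq_getElem_cons hq2, ← List.drop_eq_getElem_cons hq1, List.take_append_drop]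
  have hQ : components (l.take q).toFinset = components Q.toFinset := by
    rw [hcomp q, List.take_left]
  have hQe : merge (components (l.take q).toFinset) l[q] = merge (components Q.toFinset) x := by
    rw [← components_take_succ hq1, hcomp, components_take_succ (by simp [hq])]
    simp [hq]
  have hQf : merge (merge (components (l.take q).toFinset) l[q]) l[q + 1] =
      merge (merge (components Q.toFinset) x) y := by
    rw [← components_take_succ hq1, ← components_take_succ hq2, hcomp,
      components_take_succ (by simp [hq]), components_take_succ (by simp [hq])]
    simp [hq]
  have hstarx : Star (components Q.toFinset) x := h1.star
  have hstary : Star (merge (components Q.toFinset) x) y := by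
    have e1 : Q ++ x :: y :: B = (Q ++ [x]) ++ y :: B := by simp
    rw [e1] at h1
    have := h1.star
    rwa [show (Q ++ [x]).toFinset = insert x Q.toFinset by ext; simp,
      components_insert] at this
  have hxρ : x ∈ ρ.edges := by rw [← h1.2.1]; simp
  have hyρ : y ∈ ρ.edges := by rw [← h1.2.1]; simp
  have hxy : Disjoint x y := by
    rw [Finset.disjoint_left]
    intro v hvx hvy
    have hpw := (List.pairwise_cons.1 (List.pairwise_append.1 h1.2.2).2.1).1 y (by simp)
    have hne : x ≠ y := (List.pairwise_cons.1 (List.nodup_append.1 h1.1).2.1).1 y (by simp)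
    rcases ρ.localLT_or hxρ hyρ hne hvx hvy with h | h
    · exact h2 h.edgeLT
    · exact hpw h.edgeLT
  have hmem : ∀ i (hi : i < l.length), l[i] ∈ τ.edges := fun i hi => by
    rw [← hl, List.mem_toFinset]; exact List.getElem_mem hi
  have hsubf : insert l[q + 1] (l.take q).toFinset ⊆ τ.edges :=
    Finset.insert_subset (hmem _ hq2) (take_toFinset_subset hl q)
  have hkey : merge (components Q.toFinset) y = merge (components Q.toFinset) l[q + 1] := by
    refine merge_eq_of_disjoint hstarx hstary hxy (ρ.two_le_card y hyρ)
      (τ.two_le_card _ (hmem _ hq2)) ?_ ?_ ?_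
    · intro b hb b' hb' hbb
      rw [← hQe, ← components_take_succ hq1] at hbb
      exact τ.eq_of_components (take_toFinset_subset hl (q + 1)) (hmem _ hq2)
        (notMem_take hnd hq2 le_rfl) hb hb' hbb
    · rw [← hQf, hQe]
    · rw [← hQ, ← components_insert]
      exact τ.isNC_components hsubf
  refine ⟨l.take q ++ l[q + 1] :: l[q] :: l.drop (q + 2), ?_, ?_, ?_, ?_⟩
  · have hp : (l.take q ++ l[q + 1] :: l[q] :: l.drop (q + 2)).Perm l := by
      conv_rhs => rw [hsplit]
      exact List.Perm.append_left _ (List.Perm.swap _ _ _)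
    exact hp.nodup_iff.2 hnd
  · rw [← hl]
    conv_rhs => rw [hsplit]
    ext
    simp only [List.mem_toFinset, List.mem_append, List.mem_cons]
    tauto
  · have := congrArg List.length hsplit
    simp only [List.length_append, List.length_cons] at this hlen ⊢
    omega
  · intro i
    have hlq : (l.take q).length = q := by simp; omega
    rcases lt_trichotomy i (q + 1) with hi | rfl | hi
    · rw [List.take_append_of_le_length (by omega), List.take_append_of_le_length (by omega)]
      have := hcomp i
      rwa [List.take_append_of_le_length (by omega), hsplit,
        List.take_append_of_le_length (by omega)] at this
    · have hS : ∀ (A C : List (Finset (Fin (n + 1)))) (u : Finset (Fin (n + 1))), A.length = q →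
          components ((A ++ u :: C).take (q + 1)).toFinset = merge (components A.toFinset) u := by
        intro A C u hAq
        rw [← hAq, components_take_succ (by simp)]
        simp
      rw [hS _ _ _ hlq, hS Q _ _ rfl, hQ, hkey]
    · have hA : ∀ (A C : List (Finset (Fin (n + 1)))) (u v : Finset (Fin (n + 1))), A.length = q →
          ((A ++ u :: v :: C).take i).toFinset = ((A ++ v :: u :: C).take i).toFinset := by
        intro A C u v hAq
        obtain ⟨j, rfl⟩ : ∃ j, i = A.length + (j + 2) := ⟨i - q - 2, by omega⟩
        rw [List.take_length_add_append, List.take_length_add_append]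
        ext
        simp only [List.take_succ_cons, List.mem_toFinset, List.mem_append, List.mem_cons]
        tauto
      rw [hA _ _ _ _ hlq, hA Q _ _ _ rfl, ← hsplit, hcomp]

/-- Every point of the sphere of `τ` lies in a simplex that is contained in the sphere. -/
theorem exists_simplex_of_mem_sphere {x : NCLink n} (hx : x ∈ τ.sphere) :
    ∃ ρ : NCHypertree n, x ∈ ρ.simplex ∧ ρ.simplex ⊆ τ.sphere := by
  classical
  -- The support of `x`, written as sets of hyperedges of `τ`, is a chain of sets and so consists of
  -- initial segments of an enumeration `l`. The factorization `m` with the same prefix components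
  -- is a proper ordering of the required `ρ`.
  let 𝒜 : Finset (Finset (Finset (Fin (n + 1)))) :=
    τ.edges.powerset.filter fun F => ∃ p, x.1 p ≠ 0 ∧ p.1 = components F
  have h𝒜 : ∀ F ∈ 𝒜, F ⊆ τ.edges := fun F hF =>
    Finset.mem_powerset.1 (Finset.mem_filter.1 hF).1
  have hch : IsChain (· ⊆ ·) (𝒜 : Set (Finset (Finset (Fin (n + 1))))) := by
    intro F hF G hG _
    obtain ⟨p, hp, hpF⟩ := (Finset.mem_filter.1 hF).2
    obtain ⟨q, hq, hqG⟩ := (Finset.mem_filter.1 hG).2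
    rcases x.2.2.2.2.1.total hp hq with h | h
    · exact Or.inl (τ.subset_of_components_le (h𝒜 F hF) (h𝒜 G hG)
        (by rw [← hpF, ← hqG]; exact h))
    · exact Or.inr (τ.subset_of_components_le (h𝒜 G hG) (h𝒜 F hF)
        (by rw [← hpF, ← hqG]; exact h))
  obtain ⟨l, hnd, hl, hpre⟩ := exists_list_of_isChain τ.edges 𝒜 h𝒜 hch
  obtain ⟨m, hlen, hcard, hstar, hcomp⟩ := exists_star_list (τ := τ) hnd hl.le
  have hnc : ∀ i, IsNC (components (m.take i).toFinset) := fun i => by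
    rw [hcomp]; exact τ.isNC_components (take_toFinset_subset hl i)
  have htop : components m.toFinset = ⊤ := by
    have := hcomp m.length
    rwa [List.take_length, hlen, List.take_length, hl, τ.components_edges] at this
  obtain ⟨ρ, hρ⟩ := exists_hypertree_of_star hcard hstar hnc htop
  have hren : τ.IsRenaming m := ⟨l, hnd, hl, hlen.symm, fun i => (hcomp i).symm⟩
  refine ⟨ρ, ?_, ?_⟩
  · obtain ⟨c, hc, hcc⟩ := hρ.exists_hasStandardName
    refine ⟨m, hρ, c, hc, fun p hp => ?_⟩
    obtain ⟨F, hF, hpF⟩ := hx p hp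
    obtain ⟨i, hi, hiF⟩ := hpre F (Finset.mem_filter.2 ⟨Finset.mem_powerset.2 hF, p, hp, hpF⟩)
    exact ⟨⟨i, by omega⟩, Subtype.ext (by rw [hcc, hcomp, hiF, hpF])⟩
  · rintro y ⟨m', hm', c, hc, hy⟩ p hp
    -- Every proper ordering of `ρ` arises from `m` by exchanging unrelated neighbours, and each
    -- exchange keeps the chain inside the Boolean subposet of `τ`.
    have hren' : τ.IsRenaming m' := by
      refine linearExtension_induction (R := ρ.EdgeLT)
        (P := fun l => l.Perm m ∧ τ.IsRenaming l) (l := m) (m := m') ?_ ?_ hρ.2.2 hm'.2.2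
        ⟨List.Perm.refl _, hren⟩ |>.2
      · rintro Q x y B h1 h2 ⟨hp, h⟩
        refine ⟨(List.Perm.append_left _ (List.Perm.swap _ _ _)).trans hp, ?_⟩
        refine isRenaming_swap (ρ := ρ) ⟨hp.nodup_iff.2 hρ.1, ?_, h1⟩ ?_ h
        · rw [← hρ.2.1]; exact List.toFinset_eq_of_perm _ _ hp
        · exact (List.pairwise_cons.1 (List.pairwise_append.1 h2).2.1).1 x (by simp)
      · rw [List.perm_ext_iff_of_nodup hρ.1 hm'.1]
        intro a
        rw [← List.mem_toFinset, ← List.mem_toFinset, hρ.2.1, hm'.2.1]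
    obtain ⟨l', hnd', hl', hlen', hcomp'⟩ := hren'
    obtain ⟨i, rfl⟩ := hy p hp
    exact ⟨_, take_toFinset_subset hl' i, by rw [hc.eq_components, hcomp']⟩

/-- The largest candidate works: all hypertrees whose simplex lies in the sphere. They are closed
under passing to faces by `simplex_subset_of_le`, and they cover the sphere by
`exists_simplex_of_mem_sphere`. -/
theorem exists_upperSet_sphere (τ : NCHypertree n) :
    ∃ 𝒦 : UpperSet (NCHypertree n), τ ∈ 𝒦 ∧ space 𝒦 = τ.sphere := by
  refine ⟨⟨{ρ | ρ.simplex ⊆ τ.sphere}, fun ρ σ h hρ => (simplex_subset_of_le h).trans hρ⟩,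
    τ.simplex_subset_sphere, ?_⟩
  apply Set.Subset.antisymm
  · exact Set.iUnion₂_subset fun ρ hρ => hρ
  · intro x hx
    obtain ⟨ρ, h1, h2⟩ := exists_simplex_of_mem_sphere hx
    exact Set.mem_iUnion₂.2 ⟨ρ, h2, h1⟩

end NCHypertree

namespace NCHT

variable {n : ℕ}

/-! ### Orthoscheme vectors and points of the link -/

/-- The inner products of the projected orthoscheme vertices. -/
def gram (n r s : ℕ) : ℝ := (min r s : ℕ) - (r : ℝ) * s / n

theorem gram_comm (n r s : ℕ) : gram n r s = gram n s r := by
  rw [gram, gram, min_comm, mul_comm]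

/-- For `r ≤ s` the value is `r (1 - s / n)`. Positivity means that no cancellation occurs in
nonnegative combinations, which bounds their coefficients by their norm. -/
theorem gram_pos {r s : ℕ} (hr : 0 < r) (hs : 0 < s) (hrn : r < n) (hsn : s < n) :
    0 < gram n r s := by
  wlog h : r ≤ s generalizing r s
  · rw [gram_comm]
    exact this hs hr hsn hrn (le_of_not_ge h)
  rw [gram, min_eq_left h, sub_pos, div_lt_iff₀ (by exact_mod_cast hr.trans hrn)]
  have h1 : (0 : ℝ) < r := by exact_mod_cast hr
  have h2 : (s : ℝ) < n := by exact_mod_cast hsn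
  exact mul_lt_mul_of_pos_left h2 h1

theorem sum_ite_val_lt {r : ℕ} (hr : r ≤ n) :
    ∑ i : Fin n, (if (i : ℕ) < r then (1 : ℝ) else 0) = r := by
  rw [Finset.sum_boole, Fin.card_filter_val_lt, min_eq_right hr]

theorem inner_orthoVec {r s : ℕ} (hr : r ≤ n) (hs : s ≤ n) :
    ⟪orthoVec n r, orthoVec n s⟫ = gram n r s := by
  rcases Nat.eq_zero_or_pos n with rfl | hn
  · obtain rfl : r = 0 := by omega
    simp [gram, PiLp.inner_apply]
  have hn' : (n : ℝ) ≠ 0 := by exact_mod_cast hn.ne'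
  have key : ∀ i : Fin n, ⟪orthoVec n r i, orthoVec n s i⟫ =
      (if (i : ℕ) < min r s then (1 : ℝ) else 0) - (s : ℝ) / n * (if (i : ℕ) < r then (1 : ℝ) else 0)
        - (r : ℝ) / n * (if (i : ℕ) < s then (1 : ℝ) else 0) + (r : ℝ) / n * (s / n) := by
    intro i
    simp only [orthoVec, RCLike.inner_apply, conj_trivial, lt_min_iff]
    by_cases h1 : (i : ℕ) < r <;> by_cases h2 : (i : ℕ) < s <;> simp [h1, h2] <;> ring
  rw [PiLp.inner_apply, Finset.sum_congr rfl fun i _ => key i, Finset.sum_add_distrib,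
    Finset.sum_sub_distrib, Finset.sum_sub_distrib, ← Finset.mul_sum, ← Finset.mul_sum,
    sum_ite_val_lt hr, sum_ite_val_lt hs, sum_ite_val_lt (min_le_of_left_le hr)]
  simp only [Finset.sum_const, Finset.card_univ, Fintype.card_fin, nsmul_eq_mul, gram]
  field_simp
  ring

/-- Linear combinations with the same inner products between the relevant vectors have the same
inner products. -/
theorem inner_sum_smul_congr {P E F : Type*} [Fintype P] [NormedAddCommGroup E]
    [InnerProductSpace ℝ E] [NormedAddCommGroup F] [InnerProductSpace ℝ F] {a a' : P → E}
    {b b' : P → F} {t s : P → ℝ} (h : ∀ p q, t p ≠ 0 → s q ≠ 0 → ⟪a p, a' q⟫ = ⟪b p, b' q⟫) :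
    ⟪∑ p, t p • a p, ∑ q, s q • a' q⟫ = ⟪∑ p, t p • b p, ∑ q, s q • b' q⟫ := by
  simp only [sum_inner]
  simp only [inner_sum, real_inner_smul_left, real_inner_smul_right]
  refine Finset.sum_congr rfl fun p _ => Finset.sum_congr rfl fun q _ => ?_
  by_cases hp : t p = 0
  · simp [hp]
  by_cases hq : s q = 0
  · simp [hq]
  rw [h p q hp hq]

/-- If `V` has the Gram matrix of the orthoscheme on the relevant partitions, then it develops
the link isometrically. -/
theorem inner_develop {E : Type*} [NormedAddCommGroup E] [InnerProductSpace ℝ E] {V : NCPart n → E}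
    {t s : NCPart n → ℝ}
    (h : ∀ p q, t p ≠ 0 → s q ≠ 0 → ⟪V p, V q⟫ = gram n p.rank q.rank) :
    ⟪∑ p, t p • V p, ∑ q, s q • V q⟫ = ⟪develop t, develop s⟫ :=
  inner_sum_smul_congr fun p q hp hq => by
    rw [h p q hp hq, inner_orthoVec p.rank_le q.rank_le]

theorem gram_pos_of_proper {p q : NCPart n} (hp : p ≠ ⊥) (hp' : p ≠ ⊤) (hq : q ≠ ⊥) (hq' : q ≠ ⊤) :
    0 < gram n p.rank q.rank :=
  gram_pos (NCPart.rank_pos hp) (NCPart.rank_pos hq) (NCPart.rank_lt_top hp')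
    (NCPart.rank_lt_top hq')

theorem inner_develop_eq_sum (t s : NCPart n → ℝ) :
    ⟪develop t, develop s⟫ = ∑ p, ∑ q, t p * (s q * gram n p.rank q.rank) := by
  simp only [develop, sum_inner]
  simp only [inner_sum, real_inner_smul_left, real_inner_smul_right]
  refine Finset.sum_congr rfl fun p _ => Finset.sum_congr rfl fun q _ => ?_
  rw [inner_orthoVec p.rank_le q.rank_le]
  ring

/-- The coefficients of a nonnegative combination of proper elements are bounded by its norm. -/
theorem coeff_sq_le {t : NCPart n → ℝ} (h0 : ∀ p, 0 ≤ t p) (hb : t ⊥ = 0) (ht : t ⊤ = 0)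
    (p : NCPart n) : t p ^ 2 * gram n p.rank p.rank ≤ ‖develop t‖ ^ 2 := by
  rw [← real_inner_self_eq_norm_sq, inner_develop_eq_sum]
  have hnn : ∀ p q, 0 ≤ t p * (t q * gram n p.rank q.rank) := by
    intro p q
    by_cases hp : t p = 0
    · simp [hp]
    by_cases hq : t q = 0
    · simp [hq]
    have h1 := gram_pos_of_proper (p := p) (q := q) (by rintro rfl; exact hp hb)
      (by rintro rfl; exact hp ht) (by rintro rfl; exact hq hb) (by rintro rfl; exact hq ht)
    exact mul_nonneg (h0 p) (mul_nonneg (h0 q) h1.le)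
  calc t p ^ 2 * gram n p.rank p.rank = t p * (t p * gram n p.rank p.rank) := by ring
    _ ≤ ∑ q, t p * (t q * gram n p.rank q.rank) :=
        Finset.single_le_sum (f := fun q => t p * (t q * gram n p.rank q.rank))
          (fun q _ => hnn p q) (Finset.mem_univ p)
    _ ≤ _ := Finset.single_le_sum (f := fun p => ∑ q, t p * (t q * gram n p.rank q.rank))
          (fun p _ => Finset.sum_nonneg fun q _ => hnn p q) (Finset.mem_univ p)

theorem eq_zero_of_develop_eq_zero {t : NCPart n → ℝ} (h0 : ∀ p, 0 ≤ t p) (hb : t ⊥ = 0)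
    (ht : t ⊤ = 0) (h : develop t = 0) : t = 0 := by
  funext p
  by_contra hp
  have h1 := coeff_sq_le h0 hb ht p
  have h2 := gram_pos_of_proper (p := p) (q := p) (by rintro rfl; exact hp hb)
    (by rintro rfl; exact hp ht) (by rintro rfl; exact hp hb) (by rintro rfl; exact hp ht)
  have h3 : 0 < t p ^ 2 := by
    have : t p ≠ 0 := hp
    positivity
  rw [h, norm_zero] at h1
  nlinarith [mul_pos h3 h2]

theorem develop_smul (a : ℝ) (t : NCPart n → ℝ) : develop (fun p => a * t p) = a • develop t := by
  simp only [develop, Finset.smul_sum, smul_smul]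

/-- The point of the link in the direction of a nonnegative combination. -/
theorem exists_point {t : NCPart n → ℝ} (h0 : ∀ p, 0 ≤ t p) (hb : t ⊥ = 0) (ht : t ⊤ = 0)
    (hc : IsChain (· ≤ ·) {p | t p ≠ 0}) (hne : t ≠ 0) :
    0 < ‖develop t‖ ∧ ∃ x : NCLink n, ∀ p, x.1 p = ‖develop t‖⁻¹ * t p := by
  have hpos : 0 < ‖develop t‖ :=
    norm_pos_iff.2 fun h => hne (eq_zero_of_develop_eq_zero h0 hb ht h)
  refine ⟨hpos, ⟨⟨fun p => ‖develop t‖⁻¹ * t p, fun p => ?_, ?_, ?_, ?_, ?_⟩, fun p => rfl⟩⟩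
  · exact mul_nonneg (inv_nonneg.2 hpos.le) (h0 p)
  · simp [hb]
  · simp [ht]
  · exact hc.mono fun p hp => right_ne_zero_of_mul hp
  · rw [develop_smul, norm_smul, norm_inv, norm_norm, inv_mul_cancel₀ hpos.ne']

theorem NCLink.norm_develop (x : NCLink n) : ‖develop x.1‖ = 1 := x.2.2.2.2.2

theorem NCLink.develop_ne_zero (x : NCLink n) : develop x.1 ≠ 0 := by
  intro h
  have := NCLink.norm_develop x
  rw [h, norm_zero] at this
  exact zero_ne_one this

theorem angle_congr {E F : Type*} [NormedAddCommGroup E] [InnerProductSpace ℝ E]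
    [NormedAddCommGroup F] [InnerProductSpace ℝ F] {x y : E} {x' y' : F}
    (h : ⟪x, y⟫ = ⟪x', y'⟫) (hx : ‖x‖ = ‖x'‖) (hy : ‖y‖ = ‖y'‖) :
    InnerProductGeometry.angle x y = InnerProductGeometry.angle x' y' := by
  rw [InnerProductGeometry.angle, InnerProductGeometry.angle, h, hx, hy]

/-! ### Strings and the intrinsic metric -/

/-- There is a string in `K` of length `ℓ` from `x` to `y`. -/
def HasString (K : Set (NCLink n)) (x y : NCLink n) (ℓ : ℝ) : Prop :=
  ∃ (m : ℕ) (z : Fin (m + 1) → NCLink n), IsString K m z ∧ z 0 = x ∧ z (Fin.last m) = y ∧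
    ℓ = ∑ i : Fin m, simplexDist (z i.castSucc) (z i.succ)

theorem HasString.nonneg {K : Set (NCLink n)} {x y : NCLink n} {ℓ : ℝ} (h : HasString K x y ℓ) :
    0 ≤ ℓ := by
  obtain ⟨m, z, -, -, -, rfl⟩ := h
  exact Finset.sum_nonneg fun i _ => InnerProductGeometry.angle_nonneg _ _

theorem HasString.refl (K : Set (NCLink n)) (x : NCLink n) : HasString K x x 0 :=
  ⟨0, fun _ => x, fun i => i.elim0, rfl, rfl, by simp⟩

theorem HasString.cons {K : Set (NCLink n)} {x y w : NCLink n} {ℓ : ℝ} {c : Set (NCPart n)}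
    (hc : IsChain (· ≤ ·) c) (hcK : closedSimplex c ⊆ K) (hx : x ∈ closedSimplex c)
    (hy : y ∈ closedSimplex c) (h : HasString K y w ℓ) :
    HasString K x w (simplexDist x y + ℓ) := by
  obtain ⟨m, z, hz, h0, hl, rfl⟩ := h
  refine ⟨m + 1, Fin.cons x z, ?_, by simp, ?_, ?_⟩
  · intro i
    refine Fin.cases ?_ (fun i => ?_) i
    · exact ⟨c, hc, hcK, by simpa using hx, by simpa [h0] using hy⟩
    · obtain ⟨d, h1, h2, h3, h4⟩ := hz i
      refine ⟨d, h1, h2, ?_, ?_⟩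
      · rw [← Fin.succ_castSucc, Fin.cons_succ]; exact h3
      · rw [Fin.cons_succ]; exact h4
  · rw [← Fin.succ_last, Fin.cons_succ, hl]
  · rw [Fin.sum_univ_succ]
    simp only [Fin.castSucc_zero, Fin.cons_zero, Fin.cons_succ, ← Fin.succ_castSucc, h0]

theorem HasString.single {K : Set (NCLink n)} {x y : NCLink n} {c : Set (NCPart n)}
    (hc : IsChain (· ≤ ·) c) (hcK : closedSimplex c ⊆ K) (hx : x ∈ closedSimplex c)
    (hy : y ∈ closedSimplex c) : HasString K x y (simplexDist x y) := by
  simpa using HasString.cons hc hcK hx hy (HasString.refl K y)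

theorem HasString.trans {K : Set (NCLink n)} {x y w : NCLink n} {ℓ ℓ' : ℝ}
    (h : HasString K x y ℓ) (h' : HasString K y w ℓ') : HasString K x w (ℓ + ℓ') := by
  obtain ⟨m, z, hz, h0, hl, rfl⟩ := h
  induction m generalizing x with
  | zero =>
    have : x = y := by rw [← h0, ← hl]; rfl
    subst this
    simpa using h'
  | succ m ih =>
    obtain ⟨c, h1, h2, h3, h4⟩ := hz 0
    have := ih (x := z 1) (fun i => z i.succ) (fun i => by
      have := hz i.succ
      rwa [← Fin.succ_castSucc] at this) (by simp) (by simpa using hl)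
    rw [Fin.sum_univ_succ, add_assoc, ← h0]
    simp only [Fin.succ_castSucc] at this
    exact HasString.cons h1 h2 h3 h4 this

theorem bddBelow_strings (K : Set (NCLink n)) (x y : NCLink n) :
    BddBelow ({Real.pi} ∪ {ℓ : ℝ | HasString K x y ℓ}) := by
  refine ⟨0, ?_⟩
  rintro ℓ (h | h)
  · rw [Set.mem_singleton_iff.1 h]
    exact Real.pi_pos.le
  · exact HasString.nonneg h

theorem intrinsicDist_le {K : Set (NCLink n)} {x y : NCLink n} {ℓ : ℝ} (h : HasString K x y ℓ) :
    intrinsicDist K x y ≤ ℓ :=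
  csInf_le (bddBelow_strings K x y) (Or.inr h)

theorem intrinsicDist_le_pi (K : Set (NCLink n)) (x y : NCLink n) :
    intrinsicDist K x y ≤ Real.pi :=
  csInf_le (bddBelow_strings K x y) (Or.inl rfl)

/-- A map that is isometric on simplices does not increase distances. -/
theorem angle_le_intrinsicDist {E : Type*} [NormedAddCommGroup E] [InnerProductSpace ℝ E]
    {K : Set (NCLink n)} {f : NCLink n → E}
    (hf : ∀ c : Set (NCPart n), IsChain (· ≤ ·) c → closedSimplex c ⊆ K → ∀ x ∈ closedSimplex c,
      ∀ y ∈ closedSimplex c, simplexDist x y = InnerProductGeometry.angle (f x) (f y))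
    {x y : NCLink n} (hx : f x ≠ 0) :
    InnerProductGeometry.angle (f x) (f y) ≤ intrinsicDist K x y := by
  refine le_csInf ⟨_, Or.inl rfl⟩ ?_
  rintro ℓ (h | h)
  · rw [Set.mem_singleton_iff.1 h]
    exact InnerProductGeometry.angle_le_pi _ _
  · obtain ⟨m, z, hz, rfl, rfl, rfl⟩ := h
    induction m with
    | zero => simp [InnerProductGeometry.angle_self hx]
    | succ m ih =>
      rw [Fin.sum_univ_castSucc]
      have := ih (fun i => z i.castSucc) (fun i => by
        have := hz i.castSucc
        rwa [← Fin.castSucc_succ] at this) hx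
      refine (InnerProductGeometry.angle_le_angle_add_angle _ (f (z (Fin.last m).castSucc)) _).trans ?_
      obtain ⟨c, h1, h2, h3, h4⟩ := hz (Fin.last m)
      rw [hf c h1 h2 _ h3 _ h4]
      refine add_le_add ?_ (le_of_eq (by simp))
      simpa using this

/-- No detour is shorter, because `develop` maps the whole link to one vector space and preserves
angles on every simplex. -/
theorem intrinsicDist_eq_simplexDist {K : Set (NCLink n)} {c : Set (NCPart n)} {x y : NCLink n}
    (hc : IsChain (· ≤ ·) c) (hcK : closedSimplex c ⊆ K) (hx : x ∈ closedSimplex c)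
    (hy : y ∈ closedSimplex c) : intrinsicDist K x y = simplexDist x y :=
  le_antisymm (intrinsicDist_le (HasString.single hc hcK hx hy))
    (angle_le_intrinsicDist (f := fun x => develop x.1) (fun _ _ _ _ _ _ _ => rfl)
      (NCLink.develop_ne_zero x))

/-! ### Layer cake decompositions -/

/-- The sets that are strictly above their complement form a chain. -/
theorem isChain_superlevel {ι : Type*} (u : ι → ℝ) :
    IsChain (· ⊆ ·) {A : Finset ι | ∀ i ∈ A, ∀ j ∉ A, u j < u i} := by
  intro A hA B hB _
  by_contra h
  rw [not_or] at h
  obtain ⟨i, hi, hi'⟩ := Finset.not_subset.1 h.1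
  obtain ⟨j, hj, hj'⟩ := Finset.not_subset.1 h.2
  exact lt_asymm (hA i hi j hj') (hB j hj i hi')

section LayerCake

variable {ι : Type*} [Fintype ι] [DecidableEq ι]

/-- Nonnegative coefficients supported on a chain of proper nonempty subsets. -/
structure IsLayer (t : Finset ι → ℝ) : Prop where
  nonneg : ∀ A, 0 ≤ t A
  empty : t ∅ = 0
  univ : t Finset.univ = 0
  chain : IsChain (· ⊆ ·) {A | t A ≠ 0}

/-- The combination of the indicator functions of the subsets. -/
def layer (t : Finset ι → ℝ) (i : ι) : ℝ := ∑ A, t A * (if i ∈ A then 1 else 0)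

/-- The set `A` contributes to `i` and not to `j`, and by the chain condition no set in the support
contains `j` without `i`. So the sets in the support are superlevel sets of `layer t`. -/
theorem IsLayer.lt {t : Finset ι → ℝ} (ht : IsLayer t) {A : Finset ι} (hA : t A ≠ 0) {i j : ι}
    (hi : i ∈ A) (hj : j ∉ A) : layer t j < layer t i := by
  refine Finset.sum_lt_sum (fun B _ => ?_) ⟨A, Finset.mem_univ _, ?_⟩
  · by_cases hB : t B = 0
    · simp [hB]
    refine mul_le_mul_of_nonneg_left ?_ (ht.nonneg B)
    by_cases hjB : j ∈ B
    · rcases ht.chain.total hA hB with h | h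
      · simp [hjB, h hi]
      · exact absurd (h hjB) hj
    · rw [if_neg hjB]
      split_ifs <;> norm_num
  · simp only [hi, hj, if_true, if_false, mul_one, mul_zero]
    exact lt_of_le_of_ne (ht.nonneg A) (Ne.symm hA)

/-- Cut `u` down to its second largest value and decompose the result by induction. The set `F`
where `u` is maximal lies in every set of that decomposition, so it can be added with the height of
the cut as coefficient. -/
theorem exists_isLayer (u : ι → ℝ) : ∃ t c, IsLayer t ∧ ∀ i, u i = c + layer t i := by
  induction hk : (Finset.univ.image u).card using Nat.strong_induction_on generalizing u with
  | _ k ih =>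
    by_cases hconst : ∃ c, ∀ i, u i = c
    · obtain ⟨c, hc⟩ := hconst
      refine ⟨fun _ => 0, c, ⟨fun _ => le_rfl, rfl, rfl, ?_⟩, fun i => ?_⟩
      · intro A hA; exact absurd rfl hA
      · rw [hc i]; simp [layer]
    push Not at hconst
    have hne : Nonempty ι := (hconst 0).nonempty
    obtain ⟨i₀, -, hmax⟩ := Finset.exists_max_image Finset.univ u Finset.univ_nonempty
    obtain ⟨j₀, hj₀⟩ := hconst (u i₀)
    let F : Finset ι := Finset.univ.filter fun i => u i = u i₀
    have hFc : (Fᶜ).Nonempty := ⟨j₀, by simp [F, hj₀]⟩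
    obtain ⟨j, hj, hjmax⟩ := Finset.exists_max_image Fᶜ u hFc
    have hjF : u j ≠ u i₀ := by simpa [F] using hj
    have hji : u j < u i₀ := lt_of_le_of_ne (hmax j (Finset.mem_univ _)) hjF
    obtain ⟨t, c, ht, hu⟩ := ih ((Finset.univ.image fun i => min (u i) (u j)).card) (by
      rw [← hk]
      refine Finset.card_lt_card ((Finset.ssubset_iff_of_subset ?_).2 ⟨u i₀, by simp, ?_⟩)
      · intro a ha
        obtain ⟨i, -, rfl⟩ := Finset.mem_image.1 ha
        rcases min_choice (u i) (u j) with h | h <;> rw [h] <;> simp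
      · simp only [Finset.mem_image, Finset.mem_univ, true_and, not_exists]
        intro i h
        have := min_le_right (u i) (u j)
        linarith) (fun i => min (u i) (u j)) rfl
    have hFA : ∀ A, t A ≠ 0 → F ⊆ A := by
      intro A hA i hi
      by_contra hiA
      have hAne : A.Nonempty := by
        rw [Finset.nonempty_iff_ne_empty]
        rintro rfl
        exact hA ht.empty
      obtain ⟨a, ha⟩ := hAne
      have h1 := ht.lt hA ha hiA
      have h2 := hu a
      have h3 := hu i
      have h4 := min_le_right (u a) (u j)
      have h5 : u i = u i₀ := by simpa [F] using hi
      rw [h5, min_eq_right hji.le] at h3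
      linarith
    have hd : 0 < u i₀ - u j := sub_pos.2 hji
    refine ⟨fun A => t A + if A = F then u i₀ - u j else 0, c, ⟨?_, ?_, ?_, ?_⟩, ?_⟩
    · intro A
      have := ht.nonneg A
      split_ifs <;> linarith
    · have : (∅ : Finset ι) ≠ F := by
        intro h
        have : i₀ ∈ F := by simp [F]
        rw [← h] at this
        simp at this
      simp [ht.empty, this]
    · have : (Finset.univ : Finset ι) ≠ F := by
        intro h
        have : j ∈ F := by rw [← h]; simp
        simp only [F, Finset.mem_filter] at this
        exact hjF this.2
      simp [ht.univ, this]
    · have hsub : {A | (t A + if A = F then u i₀ - u j else 0) ≠ 0} ⊆ insert F {A | t A ≠ 0} := by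
        intro A hA
        by_cases h : A = F
        · exact Or.inl h
        · right
          simpa [h] using hA
      exact (ht.chain.insert fun A hA _ => Or.inl (hFA A hA)).mono hsub
    · intro i
      have hl : layer (fun A => t A + if A = F then u i₀ - u j else 0) i =
          layer t i + (u i₀ - u j) * (if i ∈ F then 1 else 0) := by
        simp only [layer, add_mul, Finset.sum_add_distrib, ite_mul, zero_mul]
        rw [Finset.sum_ite_eq' Finset.univ F]
        simp
      rw [hl]
      have h1 := hu i
      by_cases hi : i ∈ F
      · have h5 : u i = u i₀ := by simpa [F] using hi
        rw [h5, min_eq_right hji.le] at h1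
        rw [if_pos hi, h5]
        linarith
      · rw [min_eq_left (hjmax i (by simpa using hi))] at h1
        rw [if_neg hi]
        linarith

/-- Both supports consist of superlevel sets of one function, so the difference `t - t'` is
supported on a chain. Evaluation outside its largest member `F` gives `c = 0`, and evaluation at a
point of `F` in no smaller member shows that the coefficient of `F` vanishes. -/
theorem IsLayer.unique {t t' : Finset ι → ℝ} (ht : IsLayer t) (ht' : IsLayer t') {c : ℝ}
    (h : ∀ i, layer t i = c + layer t' i) : t = t' := by
  by_contra hne
  let S : Finset (Finset ι) := Finset.univ.filter fun A => t A - t' A ≠ 0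
  have hS : S.Nonempty := by
    by_contra hS
    refine hne (funext fun A => ?_)
    by_contra hA
    exact hS ⟨A, by simp [S, sub_ne_zero, hA]⟩
  have hch : IsChain (· ⊆ ·) (S : Set (Finset ι)) := by
    refine (isChain_superlevel (layer t)).mono ?_
    intro A hA i hi j hj
    have hA' : t A - t' A ≠ 0 := (Finset.mem_filter.1 hA).2
    by_cases htA : t A = 0
    · have h1 := ht'.lt (A := A) (fun h => hA' (by rw [htA, h, sub_zero])) hi hj
      rw [h i, h j]
      linarith
    · exact ht.lt htA hi hj
  have hsum : ∀ i, ∑ A ∈ S, (t A - t' A) * (if i ∈ A then 1 else 0) = c := by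
    intro i
    rw [Finset.sum_filter_of_ne (fun A _ hA => left_ne_zero_of_mul hA)]
    have := h i
    simp only [layer] at this
    simp only [sub_mul, Finset.sum_sub_distrib]
    linarith
  obtain ⟨F, hF, hmax⟩ := Finset.exists_max_image S Finset.card hS
  have hF0 : t F - t' F ≠ 0 := (Finset.mem_filter.1 hF).2
  have hle : ∀ A ∈ S, A ⊆ F := by
    intro A hA
    rcases hch.total hA hF with h | h
    · exact h
    · rw [Finset.eq_of_subset_of_card_le h (hmax A hA)]
  have hFu : F ≠ Finset.univ := by
    rintro rfl
    exact hF0 (by rw [ht.univ, ht'.univ, sub_zero])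
  have hFe : F.Nonempty := by
    rw [Finset.nonempty_iff_ne_empty]
    rintro rfl
    exact hF0 (by rw [ht.empty, ht'.empty, sub_zero])
  obtain ⟨j, hj⟩ : ∃ j, j ∉ F := by
    by_contra hcon
    push Not at hcon
    exact hFu (Finset.eq_univ_iff_forall.2 hcon)
  have hc : c = 0 := by
    rw [← hsum j]
    refine Finset.sum_eq_zero fun A hA => ?_
    rw [if_neg fun h => hj (hle A hA h), mul_zero]
  obtain ⟨i, hiF, hi⟩ : ∃ i ∈ F, ∀ A ∈ S, A ≠ F → i ∉ A := by
    by_cases hG : (S.erase F).Nonempty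
    · obtain ⟨G, hG, hGmax⟩ := Finset.exists_max_image (S.erase F) Finset.card hG
      rw [Finset.mem_erase] at hG
      obtain ⟨i, hiF, hiG⟩ := Finset.exists_of_ssubset (lt_of_le_of_ne (hle G hG.2) hG.1)
      refine ⟨i, hiF, fun A hA hAF hiA => hiG ?_⟩
      rcases hch.total hA hG.2 with h | h
      · exact h hiA
      · rwa [Finset.eq_of_subset_of_card_le h (hGmax A (Finset.mem_erase.2 ⟨hAF, hA⟩))]
    · obtain ⟨i, hi⟩ := hFe
      exact ⟨i, hi, fun A hA hAF => absurd ⟨A, Finset.mem_erase.2 ⟨hAF, hA⟩⟩ hG⟩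
  refine hF0 ?_
  rw [← hc, ← hsum i, Finset.sum_eq_single_of_mem F hF]
  · simp [hiF]
  · intro A hA hAF
    rw [if_neg (hi A hA hAF), mul_zero]

end LayerCake

end NCHT

namespace NCHT

/-! ### Weighted simplex frames -/

/-- Vectors that span the space and have the Gram matrix of the projections of orthogonal vectors
of squared lengths `w i` to the hyperplane perpendicular to their sum. -/
structure IsFrame {ι E : Type*} [Fintype ι] [DecidableEq ι] [NormedAddCommGroup E]
    [InnerProductSpace ℝ E] (w : ι → ℝ) (u : ι → E) : Prop where
  pos : ∀ i, 0 < w i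
  inner : ∀ i j, ⟪u i, u j⟫ = (if i = j then w i else 0) - w i * w j / ∑ k, w k
  span : ∀ y, ∃ c : ι → ℝ, y = ∑ i, c i • u i

section Frame

variable {ι : Type*} [Fintype ι] [DecidableEq ι]

/-- Scale the coordinate vectors by `√(w i)` and project them to the hyperplane perpendicular to
their sum `s`. -/
theorem exists_isFrame [Nonempty ι] {w : ι → ℝ} (hw : ∀ i, 0 < w i) :
    ∃ u : ι → EuclideanSpace ℝ (Fin (Fintype.card ι - 1)), IsFrame w u := by
  set N := ∑ k, w k with hN
  have hNpos : 0 < N := Finset.sum_pos (fun i _ => hw i) Finset.univ_nonempty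
  let s : EuclideanSpace ℝ ι := WithLp.toLp 2 fun i => Real.sqrt (w i)
  have hs : ∀ i, s i = Real.sqrt (w i) := fun i => rfl
  have hsq : ∀ i, Real.sqrt (w i) * Real.sqrt (w i) = w i := fun i => Real.mul_self_sqrt (hw i).le
  have hspos : ∀ i, 0 < Real.sqrt (w i) := fun i => Real.sqrt_pos.2 (hw i)
  have hinner : ∀ y : EuclideanSpace ℝ ι, ⟪s, y⟫ = ∑ i, Real.sqrt (w i) * y i := by
    intro y
    rw [PiLp.inner_apply]
    refine Finset.sum_congr rfl fun i _ => ?_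
    simp [hs, mul_comm]
  have hss : ⟪s, s⟫ = N := by
    rw [hinner, hN]
    exact Finset.sum_congr rfl fun i _ => hsq i
  have hs0 : s ≠ 0 := by
    intro h
    rw [h, inner_zero_left] at hss
    exact hNpos.ne hss
  let H := (ℝ ∙ s)ᗮ
  have hfin : Module.finrank ℝ H = Fintype.card ι - 1 := by
    obtain ⟨m, hm⟩ : ∃ m, Fintype.card ι = m + 1 := ⟨Fintype.card ι - 1, by
      have := Fintype.card_pos (α := ι)
      omega⟩
    have : Fact (Module.finrank ℝ (EuclideanSpace ℝ ι) = m + 1) := ⟨by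
      rw [finrank_euclideanSpace, hm]⟩
    have h := Submodule.finrank_orthogonal_span_singleton (𝕜 := ℝ) (n := m) hs0
    rw [h, hm]
    rfl
  let L : H ≃ₗᵢ[ℝ] EuclideanSpace ℝ (Fin (Fintype.card ι - 1)) :=
    (stdOrthonormalBasis ℝ H).repr.trans
      (LinearIsometryEquiv.piLpCongrLeft 2 ℝ ℝ (finCongr hfin))
  have hsi : ∀ i, ⟪s, EuclideanSpace.single i (1 : ℝ)⟫ = Real.sqrt (w i) := by
    intro i
    rw [hinner]
    simp
  let v : ι → EuclideanSpace ℝ ι := fun i =>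
    Real.sqrt (w i) • EuclideanSpace.single i (1 : ℝ) - (w i / N) • s
  have hvH : ∀ i, v i ∈ H := by
    intro i
    rw [Submodule.mem_orthogonal_singleton_iff_inner_right]
    rw [inner_sub_right, real_inner_smul_right, real_inner_smul_right, hss, hsi, hsq]
    field_simp
    ring
  refine ⟨fun i => L ⟨v i, hvH i⟩, hw, fun i j => ?_, fun y => ?_⟩
  · rw [LinearIsometryEquiv.inner_map_map]
    show ⟪v i, v j⟫ = _
    have hjs : ⟪EuclideanSpace.single i (1 : ℝ), s⟫ = Real.sqrt (w i) := by
      rw [real_inner_comm, hsi]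
    have hij : ⟪EuclideanSpace.single i (1 : ℝ), EuclideanSpace.single j (1 : ℝ)⟫ =
        if i = j then (1 : ℝ) else 0 := by
      simp [EuclideanSpace.inner_single_left]
    simp only [v, inner_sub_left, inner_sub_right, real_inner_smul_left, real_inner_smul_right,
      hss, hsi, hjs, hij]
    have h1 := hsq i
    have h2 := hsq j
    by_cases h : i = j
    · subst h
      simp only [if_true, mul_one, ← hN]
      rw [h1]
      field_simp
      rw [pow_two (√(w i)), h1]
      ring
    · simp only [h, if_false, mul_zero, ← hN]
      field_simp
      rw [pow_two, pow_two, h1, h2]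
      ring
  · refine ⟨fun i => (L.symm y).1 i / Real.sqrt (w i), ?_⟩
    have hy0 : ⟪s, (L.symm y).1⟫ = 0 :=
      (Submodule.mem_orthogonal_singleton_iff_inner_right).1 (L.symm y).2
    apply L.symm.injective
    rw [map_sum]
    simp only [map_smul, LinearIsometryEquiv.symm_apply_apply]
    apply Subtype.ext
    rw [Submodule.coe_sum]
    simp only [Submodule.coe_smul, v, smul_sub, Finset.sum_sub_distrib, smul_smul]
    rw [← Finset.sum_smul]
    have h0 : ∑ i, (L.symm y).1 i / Real.sqrt (w i) * (w i / N) = 0 := by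
      rw [hinner] at hy0
      rw [← zero_div N, ← hy0, Finset.sum_div]
      refine Finset.sum_congr rfl fun i _ => ?_
      have := (hspos i).ne'
      have h2 := hsq i
      field_simp
      rw [pow_two, h2]
    rw [h0, zero_smul, sub_zero]
    ext j
    have : ∀ i, ((L.symm y).1 i / Real.sqrt (w i) * Real.sqrt (w i)) = (L.symm y).1 i :=
      fun i => div_mul_cancel₀ _ (hspos i).ne'
    simp [this, WithLp.ofLp_sum, Pi.single_apply]

namespace IsFrame

variable {E : Type*} [NormedAddCommGroup E] [InnerProductSpace ℝ E] {w : ι → ℝ} {u : ι → E}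

theorem sum_pos [Nonempty ι] (h : IsFrame w u) : 0 < ∑ k, w k :=
  Finset.sum_pos (fun i _ => h.pos i) Finset.univ_nonempty

theorem inner_sum [Nonempty ι] (h : IsFrame w u) (c : ι → ℝ) (j : ι) :
    ⟪∑ i, c i • u i, u j⟫ = w j * (c j - (∑ i, c i * w i) / ∑ k, w k) := by
  rw [_root_.sum_inner]
  simp only [real_inner_smul_left, h.inner, mul_sub, mul_ite, mul_zero, Finset.sum_sub_distrib]
  rw [Finset.sum_ite_eq' Finset.univ j]
  simp only [Finset.mem_univ, if_true]
  rw [mul_comm (c j), Finset.sum_div, Finset.mul_sum]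
  congr 1
  exact Finset.sum_congr rfl fun i _ => by ring

/-- Coefficients with respect to a frame are unique up to a constant. -/
theorem coeff_eq [Nonempty ι] (h : IsFrame w u) {c d : ι → ℝ}
    (heq : ∑ i, c i • u i = ∑ i, d i • u i) : ∃ a, ∀ i, c i = a + d i := by
  refine ⟨(∑ i, c i * w i) / (∑ k, w k) - (∑ i, d i * w i) / ∑ k, w k, fun j => ?_⟩
  have h1 := h.inner_sum c j
  rw [heq, h.inner_sum d j] at h1
  have := mul_left_cancel₀ (h.pos j).ne' h1
  linarith

theorem sum_eq_zero [Nonempty ι] (h : IsFrame w u) : ∑ i, u i = 0 := by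
  rw [← inner_self_eq_zero (𝕜 := ℝ)]
  nth_rw 2 [show ∑ i, u i = ∑ i, (1 : ℝ) • u i by simp]
  rw [_root_.inner_sum]
  refine Finset.sum_eq_zero fun j _ => ?_
  have := h.inner_sum (fun _ => 1) j
  simp only [one_smul, one_mul] at this
  rw [one_smul, this, div_self h.sum_pos.ne', sub_self, mul_zero]

theorem inner_sum_sum (h : IsFrame w u) {A B : Finset ι} (hAB : A ⊆ B) :
    ⟪∑ i ∈ A, u i, ∑ j ∈ B, u j⟫ = ∑ i ∈ A, w i - (∑ i ∈ A, w i) * (∑ j ∈ B, w j) / ∑ k, w k := by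
  simp only [_root_.sum_inner]
  simp only [_root_.inner_sum, h.inner, Finset.sum_sub_distrib]
  rw [Finset.sum_mul_sum, Finset.sum_div]
  congr 1
  · refine Finset.sum_congr rfl fun i hi => ?_
    rw [Finset.sum_ite_eq B i, if_pos (hAB hi)]
  · exact Finset.sum_congr rfl fun i _ => by rw [Finset.sum_div]

theorem sum_layer (t : Finset ι → ℝ) :
    ∑ A, t A • ∑ i ∈ A, u i = ∑ i, layer t i • u i := by
  simp only [layer, Finset.sum_smul]
  rw [Finset.sum_comm]
  refine Finset.sum_congr rfl fun A _ => ?_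
  simp only [mul_ite, mul_one, mul_zero, ite_smul, zero_smul, Finset.smul_sum]
  rw [Finset.sum_ite_mem, Finset.univ_inter]

end IsFrame

end Frame

end NCHT

namespace NCHypertree

open NCHT

variable {n : ℕ} (τ : NCHypertree n)

/-! ### The sphere of a hypertree -/

theorem map_val_subset (A : Finset τ.edges) : A.map (Function.Embedding.subtype _) ⊆ τ.edges := by
  intro e he
  obtain ⟨e', -, rfl⟩ := Finset.mem_map.1 he
  exact e'.2

/-- The element of the special Boolean subposet given by a set of hyperedges. -/
def partOf (A : Finset τ.edges) : NCPart n :=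
  τ.part (A.map (Function.Embedding.subtype _)) (τ.map_val_subset A)

theorem partOf_le_iff {A B : Finset τ.edges} : τ.partOf A ≤ τ.partOf B ↔ A ⊆ B := by
  constructor
  · intro h
    have := τ.subset_of_components_le (τ.map_val_subset A) (τ.map_val_subset B) h
    exact Finset.map_subset_map.1 this
  · intro h
    exact components_mono (Finset.map_subset_map.2 h)

theorem partOf_injective : Function.Injective τ.partOf := fun _ _ h =>
  Finset.Subset.antisymm (τ.partOf_le_iff.1 h.le) (τ.partOf_le_iff.1 h.ge)

theorem mem_boolean_iff {p : NCPart n} : p ∈ τ.boolean ↔ ∃ A, τ.partOf A = p := by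
  classical
  constructor
  · rintro ⟨F, hF, hp⟩
    refine ⟨τ.edges.attach.filter fun e => e.1 ∈ F, Subtype.ext ?_⟩
    rw [hp]
    show components _ = components _
    congr 1
    ext e
    simp only [Finset.mem_map, Finset.mem_filter, Finset.mem_attach, true_and,
      Function.Embedding.subtype_apply, Subtype.exists, exists_and_left, exists_prop]
    exact ⟨by rintro ⟨e', h1, -, rfl⟩; exact h1, fun h => ⟨e, h, hF h, rfl⟩⟩
  · rintro ⟨A, rfl⟩
    exact ⟨_, τ.map_val_subset A, rfl⟩

theorem partOf_mem_boolean (A : Finset τ.edges) : τ.partOf A ∈ τ.boolean :=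
  τ.mem_boolean_iff.2 ⟨A, rfl⟩

theorem partOf_empty : τ.partOf ∅ = ⊥ := by
  apply Subtype.ext
  show components _ = ⊥
  simp

theorem partOf_univ : τ.partOf Finset.univ = ⊤ := by
  apply Subtype.ext
  show components _ = ⊤
  rw [← τ.components_edges]
  congr 1
  ext e
  simp

/-- The weight of a hyperedge. -/
def weight (e : τ.edges) : ℝ := ((e.1.card - 1 : ℕ) : ℝ)

theorem weight_pos (e : τ.edges) : 0 < τ.weight e := by
  have := τ.two_le_card e.1 e.2
  unfold weight
  exact_mod_cast (show 0 < e.1.card - 1 by omega)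

theorem rank_partOf (A : Finset τ.edges) : ((τ.partOf A).rank : ℝ) = ∑ e ∈ A, τ.weight e := by
  rw [rank_eq_srank]
  show (srank (components _) : ℝ) = _
  rw [τ.srank_components (τ.map_val_subset A), Finset.sum_map]
  push_cast
  rfl

theorem sum_weight : ∑ e, τ.weight e = n := by
  rw [← τ.rank_partOf, τ.partOf_univ, NCPart.rank_top]

/-- The layer coefficients of a point. -/
def coeff (x : NCPart n → ℝ) (A : Finset τ.edges) : ℝ := x (τ.partOf A)

theorem isLayer_coeff (x : NCLink n) : IsLayer (τ.coeff x.1) where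
  nonneg A := x.2.1 _
  empty := by rw [coeff, partOf_empty]; exact x.2.2.1
  univ := by rw [coeff, partOf_univ]; exact x.2.2.2.1
  chain := by
    intro A hA B hB hne
    have h := x.2.2.2.2.1.total hA hB
    rw [τ.partOf_le_iff, τ.partOf_le_iff] at h
    exact h

theorem eq_of_coeff_eq {x y : NCLink n} (hx : x ∈ τ.sphere) (hy : y ∈ τ.sphere)
    (h : τ.coeff x.1 = τ.coeff y.1) : x = y := by
  refine Subtype.ext (funext fun p => ?_)
  by_cases hp : p ∈ τ.boolean
  · obtain ⟨A, rfl⟩ := τ.mem_boolean_iff.1 hp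
    exact congrFun h A
  · have h1 : x.1 p = 0 := by_contra fun h => hp (hx p h)
    have h2 : y.1 p = 0 := by_contra fun h => hp (hy p h)
    rw [h1, h2]

section Frame

variable {E : Type*} [NormedAddCommGroup E] (u : τ.edges → E)

open Classical in
/-- The vectors that develop the sphere of `τ`. -/
def vec (p : NCPart n) : E :=
  if h : ∃ A, τ.partOf A = p then ∑ e ∈ h.choose, u e else 0

theorem vec_partOf (A : Finset τ.edges) : τ.vec u (τ.partOf A) = ∑ e ∈ A, u e := by
  have h : ∃ B, τ.partOf B = τ.partOf A := ⟨A, rfl⟩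
  rw [vec, dif_pos h, τ.partOf_injective h.choose_spec]

variable [InnerProductSpace ℝ E]

theorem sum_vec {s : NCPart n → ℝ} (hs : ∀ p, s p ≠ 0 → p ∈ τ.boolean) :
    ∑ p, s p • τ.vec u p = ∑ e, layer (τ.coeff s) e • u e := by
  classical
  rw [← IsFrame.sum_layer]
  symm
  refine Fintype.sum_of_injective τ.partOf τ.partOf_injective _ _ (fun p hp => ?_) fun A => ?_
  · have : s p = 0 := by_contra fun h => hp (τ.mem_boolean_iff.1 (hs p h))
    rw [this, zero_smul]
  · rw [vec_partOf, coeff]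

variable {u}

/-- With weights `|e| - 1`, the weight of a set of hyperedges is the rank of its partition and the
total weight is `n`. On comparable pairs the frame thus has the inner products of the orthoscheme.
-/
theorem inner_vec (hu : IsFrame τ.weight u) {p q : NCPart n}
    (hp : p ∈ τ.boolean) (hq : q ∈ τ.boolean)
    (hpq : p ≤ q ∨ q ≤ p) : ⟪τ.vec u p, τ.vec u q⟫ = gram n p.rank q.rank := by
  wlog h : p ≤ q generalizing p q
  · rw [real_inner_comm, gram_comm]
    exact this hq hp hpq.symm (hpq.resolve_left h)
  obtain ⟨A, rfl⟩ := τ.mem_boolean_iff.1 hp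
  obtain ⟨B, rfl⟩ := τ.mem_boolean_iff.1 hq
  rw [vec_partOf, vec_partOf, hu.inner_sum_sum (τ.partOf_le_iff.1 h), τ.sum_weight,
    ← τ.rank_partOf, ← τ.rank_partOf, gram, min_eq_left (NCPart.rank_mono h)]

/-- The developing map of the sphere of `τ`. -/
def devel (u : τ.edges → E) (x : NCLink n) : E := ∑ p, x.1 p • τ.vec u p

theorem inner_devel (hu : IsFrame τ.weight u) {x y : NCLink n}
    {c : Set (NCPart n)} (hc : IsChain (· ≤ ·) c) (hx : x ∈ closedSimplex c)
    (hy : y ∈ closedSimplex c) (hx' : x ∈ τ.sphere) (hy' : y ∈ τ.sphere) :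
    ⟪τ.devel u x, τ.devel u y⟫ = ⟪develop x.1, develop y.1⟫ :=
  inner_develop fun p q hp hq =>
    τ.inner_vec hu (hx' p hp) (hy' q hq) (hc.total (hx p hp) (hy q hq))

theorem norm_devel (hu : IsFrame τ.weight u) {x : NCLink n}
    (hx : x ∈ τ.sphere) : ‖τ.devel u x‖ = 1 := by
  have h := τ.inner_devel hu x.2.2.2.2.1 (x := x) (y := x) (fun p hp => hp) (fun p hp => hp) hx hx
  rw [real_inner_self_eq_norm_sq, real_inner_self_eq_norm_sq, NCLink.norm_develop] at h
  have h0 := norm_nonneg (τ.devel u x)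
  nlinarith

theorem devel_eq {x : NCLink n} (hx : x ∈ τ.sphere) :
    τ.devel u x = ∑ e, layer (τ.coeff x.1) e • u e :=
  τ.sum_vec u hx

theorem simplexDist_eq (hu : IsFrame τ.weight u) {x y : NCLink n}
    {c : Set (NCPart n)} (hc : IsChain (· ≤ ·) c) (hx : x ∈ closedSimplex c)
    (hy : y ∈ closedSimplex c) (hx' : x ∈ τ.sphere) (hy' : y ∈ τ.sphere) :
    simplexDist x y = InnerProductGeometry.angle (τ.devel u x) (τ.devel u y) :=
  angle_congr (τ.inner_devel hu hc hx hy hx' hy').symm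
    (by rw [τ.norm_devel hu hx', NCLink.norm_develop])
    (by rw [τ.norm_devel hu hy', NCLink.norm_develop])

theorem devel_injOn [Nonempty τ.edges] (hu : IsFrame τ.weight u) :
    Set.InjOn (τ.devel u) τ.sphere := by
  intro x hx y hy h
  rw [τ.devel_eq hx, τ.devel_eq hy] at h
  obtain ⟨a, ha⟩ := hu.coeff_eq h
  exact τ.eq_of_coeff_eq hx hy ((τ.isLayer_coeff x).unique (τ.isLayer_coeff y) ha)

/-- The coordinates of `y` in the frame are decomposed into layers. The constant drops out because
the frame vectors add up to zero. -/
theorem devel_surjOn [Nonempty τ.edges] (hu : IsFrame τ.weight u) {y : E}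
    (hy : ‖y‖ = 1) : ∃ x ∈ τ.sphere, τ.devel u x = y := by
  classical
  obtain ⟨c, hc⟩ := hu.span y
  obtain ⟨t, a, ht, hta⟩ := exists_isLayer c
  let s : NCPart n → ℝ := fun p => if h : ∃ A, τ.partOf A = p then t h.choose else 0
  have hs : ∀ A, s (τ.partOf A) = t A := by
    intro A
    have h : ∃ B, τ.partOf B = τ.partOf A := ⟨A, rfl⟩
    simp only [s]
    rw [dif_pos h, τ.partOf_injective h.choose_spec]
  have hsb : ∀ p, s p ≠ 0 → p ∈ τ.boolean := by
    intro p hp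
    by_contra h
    rw [τ.mem_boolean_iff] at h
    exact hp (dif_neg h)
  have hchain : IsChain (· ≤ ·) {p | s p ≠ 0} := by
    intro p hp q hq _
    obtain ⟨A, rfl⟩ := τ.mem_boolean_iff.1 (hsb p hp)
    obtain ⟨B, rfl⟩ := τ.mem_boolean_iff.1 (hsb q hq)
    simp only [Set.mem_ofPred_eq, hs] at hp hq
    have := ht.chain.total hp hq
    rwa [← τ.partOf_le_iff, ← τ.partOf_le_iff] at this
  have hsum : ∑ p, s p • τ.vec u p = y := by
    rw [τ.sum_vec u hsb, hc]
    have : τ.coeff s = t := funext hs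
    rw [this]
    simp only [hta, add_smul, Finset.sum_add_distrib]
    rw [← Finset.smul_sum, hu.sum_eq_zero, smul_zero, zero_add]
  have hnorm : ‖develop s‖ = 1 := by
    have h := inner_develop (V := τ.vec u) (t := s) (s := s) fun p q hp hq =>
      τ.inner_vec hu (hsb p hp) (hsb q hq) (hchain.total hp hq)
    rw [hsum, real_inner_self_eq_norm_sq, real_inner_self_eq_norm_sq, hy] at h
    have h0 := norm_nonneg (develop s)
    nlinarith
  refine ⟨⟨s, fun p => ?_, ?_, ?_, hchain, hnorm⟩, hsb, hsum⟩
  · simp only [s]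
    split_ifs
    · exact ht.nonneg _
    · exact le_rfl
  · rw [← τ.partOf_empty, hs, ht.empty]
  · rw [← τ.partOf_univ, hs, ht.univ]

/-- The pairs of hyperedges that are ordered in opposite ways. -/
def inversions (a b : τ.edges → ℝ) : Finset (τ.edges × τ.edges) :=
  Finset.univ.filter fun q => a q.1 < a q.2 ∧ b q.2 < b q.1

/-- Induction on the number of pairs of hyperedges that the coordinates of `x` and `y` order
oppositely. For such a pair, the arc from `x` to `y` is cut where the two coordinates agree; both
pieces have fewer inversions and their lengths add up. Without inversions both points lie in one
simplex. -/
theorem hasString_angle [Nonempty τ.edges] (hu : IsFrame τ.weight u) :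
    ∀ (k : ℕ) (x y : NCLink n), x ∈ τ.sphere → y ∈ τ.sphere →
      InnerProductGeometry.angle (τ.devel u x) (τ.devel u y) < Real.pi →
      (τ.inversions (layer (τ.coeff x.1)) (layer (τ.coeff y.1))).card = k →
      HasString τ.sphere x y (InnerProductGeometry.angle (τ.devel u x) (τ.devel u y)) := by
  intro k
  induction k using Nat.strong_induction_on with
  | _ k ih =>
    intro x y hx hy hpi hk
    set lx := layer (τ.coeff x.1) with hlx
    set ly := layer (τ.coeff y.1) with hly
    by_cases hinv : (τ.inversions lx ly).Nonempty
    · obtain ⟨⟨e, f⟩, hef⟩ := hinv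
      simp only [inversions, Finset.mem_filter, Finset.mem_univ, true_and] at hef
      obtain ⟨h1, h2⟩ := hef
      set a := lx f - lx e with ha
      set b := ly e - ly f with hb
      have hapos : 0 < a := sub_pos.2 h1
      have hbpos : 0 < b := sub_pos.2 h2
      -- The weights `b` and `a` are chosen so that the coordinates of `w` at `e` and `f` agree, the
      -- differences being `b * a` and `-(a * b)`.
      set w := b • τ.devel u x + a • τ.devel u y with hw
      have hx1 := τ.norm_devel hu hx
      have hy1 := τ.norm_devel hu hy
      have hy0 : a • τ.devel u y ≠ 0 := by
        rw [← norm_ne_zero_iff, norm_smul, hy1, mul_one, norm_ne_zero_iff]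
        exact hapos.ne'
      have hx0 : τ.devel u x ≠ 0 := by
        rw [← norm_ne_zero_iff, hx1]; exact one_ne_zero
      have hadd := InnerProductGeometry.angle_eq_angle_add_add_angle_add (b • τ.devel u x) hy0
      rw [InnerProductGeometry.angle_smul_left_of_pos _ _ hbpos,
        InnerProductGeometry.angle_smul_right_of_pos _ _ hapos,
        InnerProductGeometry.angle_smul_left_of_pos _ _ hbpos,
        InnerProductGeometry.angle_smul_left_of_pos _ _ hapos, ← hw] at hadd
      -- A vanishing `w` would make the two points antipodal, which the bound on the angle excludes.
      have hw0 : w ≠ 0 := by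
        intro h
        have h' : τ.devel u y = (-(b / a)) • τ.devel u x := by
          have : a • τ.devel u y = -(b • τ.devel u x) := by
            rw [eq_neg_iff_add_eq_zero, add_comm, ← hw, h]
          rw [neg_smul, div_eq_inv_mul, mul_smul, ← smul_neg, ← this, smul_smul,
            inv_mul_cancel₀ hapos.ne', one_smul]
        refine hpi.ne (InnerProductGeometry.angle_eq_pi_iff.2 ⟨hx0, _, ?_, h'⟩)
        have := div_pos hbpos hapos
        linarith
      have hwpos : 0 < ‖w‖ := norm_pos_iff.2 hw0
      obtain ⟨z, hz, hzw⟩ := τ.devel_surjOn hu (y := ‖w‖⁻¹ • w) (by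
        rw [norm_smul, norm_inv, norm_norm, inv_mul_cancel₀ hwpos.ne'])
      set lz := layer (τ.coeff z.1) with hlz
      have hcoef : ∃ d, ∀ g, lz g = d + ‖w‖⁻¹ * (b * lx g + a * ly g) := by
        refine hu.coeff_eq ?_
        have hws : w = ∑ g, (b * lx g + a * ly g) • u g := by
          rw [hw, τ.devel_eq hx, τ.devel_eq hy]
          simp only [Finset.smul_sum, smul_smul, ← Finset.sum_add_distrib, ← add_smul]
          rfl
        rw [← τ.devel_eq hz, hzw]
        nth_rw 2 [hws]
        rw [Finset.smul_sum]
        simp only [smul_smul]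
      obtain ⟨d, hd⟩ := hcoef
      have hlt : ∀ g h, lz g < lz h ↔ b * lx g + a * ly g < b * lx h + a * ly h := by
        intro g h
        rw [hd, hd, add_lt_add_iff_left, mul_lt_mul_iff_right₀ (inv_pos.2 hwpos)]
      have heq : ¬ lz f < lz e := by
        rw [hlt, ha, hb]
        intro h
        nlinarith
      have heq' : ¬ lz e < lz f := by
        rw [hlt, ha, hb]
        intro h
        nlinarith
      have hxz : InnerProductGeometry.angle (τ.devel u x) (τ.devel u z) =
          InnerProductGeometry.angle (τ.devel u x) w := by
        rw [hzw, InnerProductGeometry.angle_smul_right_of_pos _ _ (inv_pos.2 hwpos)]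
      have hzy : InnerProductGeometry.angle (τ.devel u z) (τ.devel u y) =
          InnerProductGeometry.angle (τ.devel u y) w := by
        rw [hzw, InnerProductGeometry.angle_smul_left_of_pos _ _ (inv_pos.2 hwpos),
          InnerProductGeometry.angle_comm]
      have hn1 := InnerProductGeometry.angle_nonneg (τ.devel u x) w
      have hn2 := InnerProductGeometry.angle_nonneg (τ.devel u y) w
      have hmem : (e, f) ∈ τ.inversions lx ly := by
        simp only [inversions, Finset.mem_filter, Finset.mem_univ, true_and]
        exact ⟨h1, h2⟩
      have s1 := ih _ (by
        rw [← hk]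
        refine Finset.card_lt_card ((Finset.ssubset_iff_of_subset ?_).2 ⟨(e, f), hmem, ?_⟩)
        · rintro ⟨g, h⟩ hgh
          simp only [inversions, Finset.mem_filter, Finset.mem_univ, true_and] at hgh ⊢
          refine ⟨hgh.1, ?_⟩
          have h3 := (hlt _ _).1 hgh.2
          have h4 := mul_lt_mul_of_pos_left hgh.1 hbpos
          exact lt_of_mul_lt_mul_left (by linarith) hapos.le
        · simp only [inversions, Finset.mem_filter, Finset.mem_univ, true_and]
          exact fun h => heq h.2) x z hx hz (by rw [hxz]; linarith) rfl
      have s2 := ih _ (by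
        rw [← hk]
        refine Finset.card_lt_card ((Finset.ssubset_iff_of_subset ?_).2 ⟨(e, f), hmem, ?_⟩)
        · rintro ⟨g, h⟩ hgh
          simp only [inversions, Finset.mem_filter, Finset.mem_univ, true_and] at hgh ⊢
          refine ⟨?_, hgh.2⟩
          have h3 := (hlt _ _).1 hgh.1
          have h4 := mul_lt_mul_of_pos_left hgh.2 hapos
          exact lt_of_mul_lt_mul_left (by linarith) hbpos.le
        · simp only [inversions, Finset.mem_filter, Finset.mem_univ, true_and]
          exact fun h => heq' h.1) z y hz hy (by rw [hzy]; linarith) rfl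
      rw [hadd, ← hxz, ← hzy]
      exact s1.trans s2
    · have hno : ∀ e f, lx e < lx f → ¬ ly f < ly e := fun e f h1 h2 =>
        hinv ⟨(e, f), by simp only [inversions, Finset.mem_filter, Finset.mem_univ, true_and]; exact ⟨h1, h2⟩⟩
      -- In the absence of inversions, the superlevel sets of both coordinate functions form a
      -- single chain, which spans a simplex containing both points.
      let S : Set (Finset τ.edges) := {A | ∀ i ∈ A, ∀ j ∉ A, lx j < lx i} ∪
        {A | ∀ i ∈ A, ∀ j ∉ A, ly j < ly i}
      have hS : ∀ A ∈ S, ∀ B ∈ S, A ⊆ B ∨ B ⊆ A := by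
        have hmix : ∀ A B : Finset τ.edges, (∀ i ∈ A, ∀ j ∉ A, lx j < lx i) →
            (∀ i ∈ B, ∀ j ∉ B, ly j < ly i) → A ⊆ B ∨ B ⊆ A := by
          intro A B hA hB
          by_contra h
          rw [not_or] at h
          obtain ⟨i, hi, hi'⟩ := Finset.not_subset.1 h.1
          obtain ⟨j, hj, hj'⟩ := Finset.not_subset.1 h.2
          exact hno j i (hA i hi j hj') (hB j hj i hi')
        rintro A (hA | hA) B (hB | hB)
        · exact (isChain_superlevel lx).total hA hB
        · exact hmix A B hA hB
        · exact (hmix B A hB hA).symm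
        · exact (isChain_superlevel ly).total hA hB
      have hc : IsChain (· ≤ ·) (τ.partOf '' S) := by
        rintro _ ⟨A, hA, rfl⟩ _ ⟨B, hB, rfl⟩ _
        exact (hS A hA B hB).imp τ.partOf_le_iff.2 τ.partOf_le_iff.2
      have hcs : closedSimplex (τ.partOf '' S) ⊆ τ.sphere := by
        intro z hz p hp
        obtain ⟨A, -, rfl⟩ := hz p hp
        exact τ.partOf_mem_boolean A
      have hxc : x ∈ closedSimplex (τ.partOf '' S) := by
        intro p hp
        obtain ⟨A, rfl⟩ := τ.mem_boolean_iff.1 (hx p hp)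
        exact ⟨A, Or.inl fun i hi j hj => (τ.isLayer_coeff x).lt hp hi hj, rfl⟩
      have hyc : y ∈ closedSimplex (τ.partOf '' S) := by
        intro p hp
        obtain ⟨A, rfl⟩ := τ.mem_boolean_iff.1 (hy p hp)
        exact ⟨A, Or.inr fun i hi j hj => (τ.isLayer_coeff y).lt hp hi hj, rfl⟩
      rw [← τ.simplexDist_eq hu hc hxc hyc hx hy]
      exact HasString.single hc hcs hxc hyc

/-- A string is only needed for angles below `π`. The truncation of the metric covers antipodal
points, including the case of a zero-dimensional sphere where no string joins them. -/
theorem intrinsicDist_sphere [Nonempty τ.edges] (hu : IsFrame τ.weight u)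
    {x y : NCLink n} (hx : x ∈ τ.sphere) (hy : y ∈ τ.sphere) :
    intrinsicDist τ.sphere x y = InnerProductGeometry.angle (τ.devel u x) (τ.devel u y) := by
  apply le_antisymm
  · rcases (InnerProductGeometry.angle_le_pi (τ.devel u x) (τ.devel u y)).lt_or_eq with h | h
    · exact intrinsicDist_le (τ.hasString_angle hu _ x y hx hy h rfl)
    · rw [h]
      exact intrinsicDist_le_pi _ _ _
  · refine angle_le_intrinsicDist (fun c hc hcs a ha b hb => ?_) ?_
    · exact τ.simplexDist_eq hu hc ha hb (hcs ha) (hcs hb)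
    · rw [← norm_ne_zero_iff, τ.norm_devel hu hx]
      exact one_ne_zero

end Frame

theorem isUnitSphere_sphere (hn : 1 ≤ n) : IsUnitSphere (τ.edges.card - 1) τ.sphere := by
  have : Nonempty τ.edges := (τ.edges_nonempty hn).to_subtype
  obtain ⟨u, hu⟩ := exists_isFrame τ.weight_pos
  rw [← Fintype.card_coe τ.edges]
  let φ : τ.sphere → Metric.sphere (0 : EuclideanSpace ℝ (Fin (Fintype.card τ.edges - 1))) 1 :=
    fun x => ⟨τ.devel u x.1, by simpa using τ.norm_devel hu x.2⟩
  have hφ : Function.Bijective φ := by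
    constructor
    · intro x y h
      exact Subtype.ext (τ.devel_injOn hu x.2 y.2 (congrArg Subtype.val h))
    · rintro ⟨y, hy⟩
      obtain ⟨x, hx, hxy⟩ := τ.devel_surjOn hu (y := y) (by simpa using hy)
      exact ⟨⟨x, hx⟩, Subtype.ext hxy⟩
  exact ⟨Equiv.ofBijective φ hφ, fun x y => τ.intrinsicDist_sphere hu x.2 y.2⟩

end NCHypertree

namespace NCHT

variable {n : ℕ}

/-! ### Boolean subposets -/

theorem exists_edge_of_rank_eq_one {p : NCPart n} (h : p.rank = 1) :
    ∃ e : Finset (Fin (n + 1)), e.card = 2 ∧ p.1 = components {e} := by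
  have hne : p ≠ ⊥ := by
    rintro rfl
    simp at h
  obtain ⟨a, b, hab, hpab⟩ : ∃ a b, a ≠ b ∧ p.1 a b := by
    by_contra hcon
    push Not at hcon
    refine hne (le_antisymm (fun a b hab => ?_) bot_le)
    by_contra hne
    exact hcon a b hne hab
  refine ⟨{a, b}, Finset.card_pair hab, (eq_of_srank_le ?_ ?_).symm⟩
  · refine components_le_iff.2 fun e he x hx y hy => ?_
    rw [Finset.mem_singleton.1 he] at hx hy
    simp only [Finset.mem_insert, Finset.mem_singleton] at hx hy
    rcases hx with rfl | rfl <;> rcases hy with rfl | rfl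
    · exact p.1.refl _
    · exact hpab
    · exact p.1.symm hpab
    · exact p.1.refl _
  · rw [← rank_eq_srank, h, ← insert_empty_eq, components_insert, srank_merge,
      Finset.card_pair hab]
    · omega
    · intro y _ y' _ h
      rw [components_empty] at h
      exact h
    · exact ⟨a, by simp⟩

/-- A rank-preserving embedding of a Boolean lattice of full rank is the special Boolean subposet of
a noncrossing tree. -/
theorem exists_tree_of_boolean {P : Finset (Fin n) → NCPart n} (hmono : ∀ A B, A ⊆ B → P A ≤ P B)
    (hinj : Function.Injective P) (hrank : ∀ A, (P A).rank = A.card) :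
    ∃ τ : NCHypertree n, τ.IsTree ∧ τ.boolean = Set.range P ∧ ∀ A B, P A ≤ P B → A ⊆ B := by
  classical
  have h1 : ∀ i, ∃ e : Finset (Fin (n + 1)), e.card = 2 ∧ (P {i}).1 = components {e} :=
    fun i => exists_edge_of_rank_eq_one (by rw [hrank, Finset.card_singleton])
  choose e he2 hPe using h1
  have hle : ∀ i B, P {i} ≤ P B ↔ ∀ a ∈ e i, ∀ b ∈ e i, (P B).1 a b := by
    intro i B
    show (P {i}).1 ≤ (P B).1 ↔ _
    rw [hPe, components_le_iff]
    simp
  have hmerge : ∀ i B, ¬ P {i} ≤ P B → srank (merge (P B).1 (e i)) = B.card + 1 := by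
    intro i B h
    rw [srank_merge, ← rank_eq_srank, hrank, he2]
    · intro y hy y' hy' hyy
      by_contra hne
      refine h ((hle i B).2 ?_)
      have hei : e i = {y, y'} := by
        symm
        refine Finset.eq_of_subset_of_card_le ?_ ?_
        · intro x hx
          simp only [Finset.mem_insert, Finset.mem_singleton] at hx
          rcases hx with rfl | rfl <;> assumption
        · rw [he2, Finset.card_pair hne]
      intro a ha b hb
      rw [hei] at ha hb
      simp only [Finset.mem_insert, Finset.mem_singleton] at ha hb
      rcases ha with rfl | rfl <;> rcases hb with rfl | rfl
      · exact (P B).1.refl _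
      · exact hyy
      · exact (P B).1.symm hyy
      · exact (P B).1.refl _
    · exact Finset.card_pos.1 (by rw [he2]; exact two_pos)
  have hins : ∀ i B, i ∉ B → ¬ P {i} ≤ P B → (P (insert i B)).1 = merge (P B).1 (e i) := by
    intro i B hi h
    refine (eq_of_srank_le ?_ ?_).symm
    · refine merge_le_iff.2 ⟨hmono _ _ (Finset.subset_insert i B), ?_⟩
      exact (hle i _).1 (hmono _ _ (by simp))
    · rw [hmerge i B h, ← rank_eq_srank, hrank, Finset.card_insert_of_notMem hi]
  -- If `P {i} ≤ P B` with `i ∉ B`, replace an element `j` of `B` by `i`. By induction the new set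
  -- has a strictly larger image than `B.erase j`, so by rank its image equals `P B`, which
  -- contradicts injectivity.
  have hnot : ∀ (k : ℕ) (B : Finset (Fin n)) (i : Fin n), B.card = k → i ∉ B → ¬ P {i} ≤ P B := by
    intro k
    induction k with
    | zero =>
      intro B i hB _ h
      have := NCPart.rank_mono h
      rw [hrank, hrank, hB] at this
      simp at this
    | succ k ih =>
      intro B i hB hi h
      obtain ⟨j, hj⟩ := Finset.card_pos.1 (show 0 < B.card by omega)
      have hc : (B.erase j).card = k := by rw [Finset.card_erase_of_mem hj, hB]; rfl
      have hi' : i ∉ B.erase j := fun h => hi (Finset.mem_of_mem_erase h)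
      have hn := ih _ i hc hi'
      have h3 : merge (P (B.erase j)).1 (e i) = (P B).1 := by
        refine eq_of_srank_le ?_ ?_
        · exact merge_le_iff.2 ⟨hmono _ _ (Finset.erase_subset j B), (hle i _).1 h⟩
        · rw [hmerge i _ hn, ← rank_eq_srank, hrank, hc, hB]
      have h4 : P (insert i (B.erase j)) = P B := Subtype.ext ((hins i _ hi' hn).trans h3)
      have h5 := hinj h4
      exact hi (h5 ▸ Finset.mem_insert_self _ _)
  have hnot' : ∀ (B : Finset (Fin n)) (i : Fin n), i ∉ B → ¬ P {i} ≤ P B := fun B i => hnot _ B i rfl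
  have hcomp : ∀ A : Finset (Fin n), (P A).1 = components (A.image e) := by
    intro A
    induction A using Finset.induction_on with
    | empty =>
      have : P ∅ = ⊥ := by
        by_contra h
        have := NCPart.rank_pos h
        rw [hrank] at this
        simp at this
      rw [this, Finset.image_empty, components_empty]
      rfl
    | insert i A hi ih => rw [hins i A hi (hnot' A i hi), ih, Finset.image_insert, components_insert]
  have heinj : Function.Injective e := by
    intro i j h
    have : P {i} = P {j} := Subtype.ext (by rw [hPe, hPe, h])
    simpa using hinj this
  have htop : P Finset.univ = ⊤ := by
    refine NCPart.eq_of_rank_le le_top ?_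
    rw [hrank, NCPart.rank_top]
    simp
  have hX : ∀ i j, ¬ Interleave (e i) (e j) := by
    rintro i j ⟨a, b, c, d, hab, hbc, hcd, ha, hc, hb, hd⟩
    have hei : e i = {a, c} := by
      symm
      refine Finset.eq_of_subset_of_card_le ?_ ?_
      · intro x hx
        simp only [Finset.mem_insert, Finset.mem_singleton] at hx
        rcases hx with rfl | rfl <;> assumption
      · rw [he2, Finset.card_pair (hab.trans hbc).ne]
    have hej : e j = {b, d} := by
      symm
      refine Finset.eq_of_subset_of_card_le ?_ ?_
      · intro x hx
        simp only [Finset.mem_insert, Finset.mem_singleton] at hx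
        rcases hx with rfl | rfl <;> assumption
      · rw [he2, Finset.card_pair (hbc.trans hcd).ne]
    have hrel : (P {i, j}).1 a b := by
      refine (P {i, j}).2 a b c d hab hbc hcd ?_ ?_
      · rw [hcomp]
        exact components_rel (Finset.mem_image_of_mem e (by simp)) ha hc
      · rw [hcomp]
        exact components_rel (Finset.mem_image_of_mem e (by simp)) hb hd
    -- If the two edges crossed, noncrossingness would relate `a` to `b`. But crossing edges are
    -- disjoint, so membership in `e i` is constant on the components of the two edges and
    -- distinguishes `a` from `b`.
    let s : Setoid (Fin (n + 1)) := Setoid.comap (fun x => (x ∈ e i : Prop)) ⊥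
    have hs : (P {i, j}).1 ≤ s := by
      rw [hcomp]
      refine components_le_iff.2 fun f hf x hx y hy => ?_
      show (x ∈ e i) = (y ∈ e i)
      simp only [Finset.image_insert, Finset.image_singleton, Finset.mem_insert,
        Finset.mem_singleton] at hf
      rcases hf with rfl | rfl
      · simp [hx, hy]
      · have hd : ∀ z ∈ e j, z ∉ e i := by
          intro z hz hz'
          rw [hej] at hz
          rw [hei] at hz'
          simp only [Finset.mem_insert, Finset.mem_singleton] at hz hz'
          rcases hz with rfl | rfl <;> rcases hz' with h | h <;> subst h <;>
            simp only [Fin.lt_def] at * <;> omega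
        simp [hd x hx, hd y hy]
    have h5 : (a ∈ e i) = (b ∈ e i) := hs hrel
    have h6 : b ∈ e i := h5 ▸ ha
    rw [hei] at h6
    simp only [Finset.mem_insert, Finset.mem_singleton] at h6
    rcases h6 with rfl | rfl
    · exact lt_irrefl _ hab
    · exact lt_irrefl _ hbc
  let τ : NCHypertree n :=
    { edges := Finset.univ.image e
      two_le_card := by
        intro f hf
        obtain ⟨i, -, rfl⟩ := Finset.mem_image.1 hf
        exact (he2 i).ge
      connected := by
        intro a b
        rw [← hcomp, htop]
        trivial
      acyclic := by
        rintro ⟨k, v, f, hk, hv, hf, h⟩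
        obtain ⟨m, rfl⟩ : ∃ m, k = m + 1 := ⟨k - 1, by omega⟩
        obtain ⟨i, -, hi⟩ := Finset.mem_image.1 (h 0).1
        -- Round the cycle, the other edges join the two ends of `e i`, which puts `P {i}` below the
        -- element of the complementary set and contradicts `hnot'`.
        have hstep : ∀ t, t ≠ 0 → (P (Finset.univ.erase i)).1 (v t) (v (t + 1)) := by
          intro t ht
          obtain ⟨j, -, hj⟩ := Finset.mem_image.1 (h t).1
          have hji : j ≠ i := by
            rintro rfl
            exact ht (hf (hj.symm.trans hi))
          have h3 := (h t).2.2
          rw [finRotate_apply] at h3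
          rw [hcomp]
          refine components_rel (e := f t) ?_ (h t).2.1 h3
          rw [← hj]
          exact Finset.mem_image_of_mem e (by simp [hji])
        have hrel := rel_of_cycle hstep
        have h3 := (h 0).2.2
        rw [finRotate_apply] at h3
        have h10 : v (0 + 1) ≠ v 0 := by
          intro heq
          have := hv heq
          rw [zero_add, Fin.one_eq_zero_iff] at this
          omega
        refine hnot' (Finset.univ.erase i) i (by simp) ((hle i _).2 ?_)
        have hei : e i = {v (0 + 1), v 0} := by
          symm
          refine Finset.eq_of_subset_of_card_le ?_ ?_
          · intro x hx
            simp only [Finset.mem_insert, Finset.mem_singleton] at hx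
            rw [hi]
            rcases hx with rfl | rfl
            · exact h3
            · exact (h 0).2.1
          · rw [he2, Finset.card_pair h10]
        intro a ha b hb
        rw [hei] at ha hb
        simp only [Finset.mem_insert, Finset.mem_singleton] at ha hb
        rcases ha with rfl | rfl <;> rcases hb with rfl | rfl
        · exact Setoid.refl' _ _
        · exact hrel
        · exact Setoid.symm' _ hrel
        · exact Setoid.refl' _ _
      noncrossing := by
        intro f hf f' hf' hne
        obtain ⟨i, -, rfl⟩ := Finset.mem_image.1 hf
        obtain ⟨j, -, rfl⟩ := Finset.mem_image.1 hf'
        refine ⟨?_, hX i j, hX j i⟩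
        by_contra hcon
        have h2 : 2 ≤ (e i ∩ e j).card := by omega
        have h3 := Finset.eq_of_subset_of_card_le (Finset.inter_subset_left (s₁ := e i) (s₂ := e j))
          (by rw [he2]; exact h2)
        have h4 := Finset.eq_of_subset_of_card_le (Finset.inter_subset_right (s₁ := e i) (s₂ := e j))
          (by rw [he2]; exact h2)
        exact hne (h3.symm.trans h4) }
  refine ⟨τ, ?_, ?_, ?_⟩
  · intro f hf
    obtain ⟨i, -, rfl⟩ := Finset.mem_image.1 hf
    exact he2 i
  · ext p
    constructor
    · rintro ⟨F, hF, hp⟩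
      obtain ⟨A, -, rfl⟩ := Finset.subset_image_iff.1 hF
      exact ⟨A, Subtype.ext (by rw [hcomp, hp])⟩
    · rintro ⟨A, rfl⟩
      exact ⟨A.image e, Finset.image_subset_image (Finset.subset_univ A), hcomp A⟩
  · intro A B h
    have h' : components (A.image e) ≤ components (B.image e) := by
      rw [← hcomp, ← hcomp]; exact h
    have := τ.subset_of_components_le (Finset.image_subset_image (Finset.subset_univ A))
      (Finset.image_subset_image (Finset.subset_univ B)) h'
    exact (Finset.image_subset_image_iff heinj).1 this

end NCHT

namespace NCHT

variable {n : ℕ} {E : Type*} [NormedAddCommGroup E] [InnerProductSpace ℝ E]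

/-! ### Complete fans -/

/-- Nonnegative coefficients supported on a chain whose closed simplex lies in `K`. -/
structure IsCone (K : Set (NCLink n)) (t : NCPart n → ℝ) : Prop where
  nonneg : ∀ p, 0 ≤ t p
  bot : t ⊥ = 0
  top : t ⊤ = 0
  chain : ∃ c : Set (NCPart n), IsChain (· ≤ ·) c ∧ closedSimplex c ⊆ K ∧ ∀ p, t p ≠ 0 → p ∈ c

/-- Vectors that develop `K` onto a complete fan. -/
structure IsFan (K : Set (NCLink n)) (V : NCPart n → E) : Prop where
  gram : ∀ c : Set (NCPart n), IsChain (· ≤ ·) c → closedSimplex c ⊆ K → ∀ p ∈ c, ∀ q ∈ c,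
    ⟪V p, V q⟫ = gram n p.rank q.rank
  surj : ∀ y, ∃ t, IsCone K t ∧ ∑ p, t p • V p = y
  inj : ∀ t s, IsCone K t → IsCone K s → ∑ p, t p • V p = ∑ p, s p • V p → t = s

theorem IsCone.isChain {K : Set (NCLink n)} {t : NCPart n → ℝ} (h : IsCone K t) :
    IsChain (· ≤ ·) {p | t p ≠ 0} := by
  obtain ⟨c, hc, -, hs⟩ := h.chain
  exact hc.mono hs

theorem isCone_of_mem {K : Set (NCLink n)}
    (hK : ∀ x ∈ K, ∃ c : Set (NCPart n), IsChain (· ≤ ·) c ∧ closedSimplex c ⊆ K ∧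
      x ∈ closedSimplex c) {x : NCLink n} (hx : x ∈ K) : IsCone K x.1 :=
  ⟨x.2.1, x.2.2.1, x.2.2.2.1, hK x hx⟩

theorem gram_zero_left (s : ℕ) : gram n 0 s = 0 := by simp [gram]

theorem gram_top_left {s : ℕ} (hn : 1 ≤ n) (hs : s ≤ n) : gram n n s = 0 := by
  have : (n : ℝ) ≠ 0 := by exact_mod_cast (by omega : n ≠ 0)
  rw [gram, min_eq_right hs]
  field_simp
  ring

theorem develop_of_support {x : NCPart n → ℝ} {p : NCPart n} (h : ∀ q, x q ≠ 0 → q = p) :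
    develop x = x p • orthoVec n p.rank := by
  rw [develop, Finset.sum_eq_single_of_mem p (Finset.mem_univ p)]
  intro q _ hq
  rw [by_contra fun h' => hq (h q h'), zero_smul]

theorem NCLink.ne_zero_of_support {x : NCLink n} {p : NCPart n} (h : ∀ q, x.1 q ≠ 0 → q = p) :
    x.1 p ≠ 0 := by
  intro h0
  refine NCLink.develop_ne_zero x ?_
  rw [develop_of_support h, h0, zero_smul]

/-- An isometry of `K` with a unit sphere is a developing map of a complete fan. -/
theorem exists_isFan (hn : 1 ≤ n) {K : Set (NCLink n)}
    (hK : ∀ x ∈ K, ∃ c : Set (NCPart n), IsChain (· ≤ ·) c ∧ closedSimplex c ⊆ K ∧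
      x ∈ closedSimplex c) (φ : K ≃ Metric.sphere (0 : E) 1)
    (hφ : ∀ x y : K, intrinsicDist K x y = InnerProductGeometry.angle (φ x).1 (φ y).1) :
    ∃ V : NCPart n → E, IsFan K V := by
  classical
  let f : NCLink n → E := fun x => if h : x ∈ K then (φ ⟨x, h⟩).1 else 0
  have hf : ∀ x (h : x ∈ K), f x = (φ ⟨x, h⟩).1 := fun x h => dif_pos h
  have hfn : ∀ x ∈ K, ‖f x‖ = 1 := by
    intro x hx
    rw [hf x hx]
    simp
  have hinner : ∀ c : Set (NCPart n), IsChain (· ≤ ·) c → closedSimplex c ⊆ K →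
      ∀ x ∈ closedSimplex c, ∀ y ∈ closedSimplex c, ⟪f x, f y⟫ = ⟪develop x.1, develop y.1⟫ := by
    intro c hc hcK x hx y hy
    have h := hφ ⟨x, hcK hx⟩ ⟨y, hcK hy⟩
    rw [intrinsicDist_eq_simplexDist hc hcK hx hy, simplexDist, ← hf, ← hf] at h
    rw [← InnerProductGeometry.cos_angle_mul_norm_mul_norm (f x),
      ← InnerProductGeometry.cos_angle_mul_norm_mul_norm (develop x.1), h, hfn x (hcK hx),
      hfn y (hcK hy), NCLink.norm_develop, NCLink.norm_develop]
  -- The image of the unit vector in direction `p` is rescaled so that `V p` corresponds to the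
  -- orthoscheme vertex itself. The improper elements get the vector `0`, in accordance with their
  -- vanishing Gram entries.
  let V : NCPart n → E := fun p =>
    if h : ∃ x ∈ K, ∀ q, x.1 q ≠ 0 → q = p then (h.choose.1 p)⁻¹ • f h.choose else 0
  have hV : ∀ c : Set (NCPart n), closedSimplex c ⊆ K → ∀ p ∈ c, p ≠ ⊥ → p ≠ ⊤ →
      ∃ x ∈ closedSimplex c, (∀ q, x.1 q ≠ 0 → q = p) ∧ V p = (x.1 p)⁻¹ • f x := by
    intro c hcK p hp hb ht
    have h : ∃ x ∈ K, ∀ q, x.1 q ≠ 0 → q = p := by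
      obtain ⟨-, x, hx⟩ := exists_point (t := Pi.single p (1 : ℝ))
        (fun q => by rcases eq_or_ne q p with rfl | h <;> simp [*])
        (by simp [hb.symm]) (by simp [ht.symm])
        (by
          intro q hq r hr hqr
          rw [Set.mem_ofPred_eq] at hq hr
          have h1 : q = p := by_contra fun h => hq (by simp [h])
          have h2 : r = p := by_contra fun h => hr (by simp [h])
          exact absurd (h1.trans h2.symm) hqr)
        (fun h => by simpa using congrFun h p)
      have hs : ∀ q, x.1 q ≠ 0 → q = p := by
        intro q hq
        by_contra h
        exact hq (by rw [hx]; simp [h])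
      exact ⟨x, hcK fun q hq => by rw [hs q hq]; exact hp, hs⟩
    refine ⟨h.choose, fun q hq => ?_, h.choose_spec.2, dif_pos h⟩
    rw [h.choose_spec.2 q hq]
    exact hp
  have hV0 : ∀ p, p = ⊥ ∨ p = ⊤ → V p = 0 := by
    intro p hp
    refine dif_neg ?_
    rintro ⟨x, -, hx⟩
    refine NCLink.ne_zero_of_support hx ?_
    rcases hp with rfl | rfl
    · exact x.2.2.1
    · exact x.2.2.2.1
  have hg0 : ∀ p q : NCPart n, p = ⊥ ∨ p = ⊤ → gram n p.rank q.rank = 0 := by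
    rintro p q (rfl | rfl)
    · rw [NCPart.rank_bot, gram_zero_left]
    · rw [NCPart.rank_top, gram_top_left hn q.rank_le]
  have hgram : ∀ c : Set (NCPart n), IsChain (· ≤ ·) c → closedSimplex c ⊆ K → ∀ p ∈ c, ∀ q ∈ c,
      ⟪V p, V q⟫ = gram n p.rank q.rank := by
    intro c hc hcK p hp q hq
    by_cases hp0 : p = ⊥ ∨ p = ⊤
    · rw [hV0 p hp0, inner_zero_left, hg0 p q hp0]
    by_cases hq0 : q = ⊥ ∨ q = ⊤
    · rw [hV0 q hq0, inner_zero_right, gram_comm, hg0 q p hq0]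
    rw [not_or] at hp0 hq0
    obtain ⟨x, hx, hxs, hxV⟩ := hV c hcK p hp hp0.1 hp0.2
    obtain ⟨y, hy, hys, hyV⟩ := hV c hcK q hq hq0.1 hq0.2
    have hx0 := NCLink.ne_zero_of_support hxs
    have hy0 := NCLink.ne_zero_of_support hys
    rw [hxV, hyV, real_inner_smul_left, real_inner_smul_right, hinner c hc hcK x hx y hy,
      develop_of_support hxs, develop_of_support hys, real_inner_smul_left, real_inner_smul_right,
      inner_orthoVec p.rank_le q.rank_le]
    field_simp
  -- Linearity of `f` on simplices: `f x` and the combination of the vectors `V p` are unit vectors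
  -- with inner product one.
  have hsum : ∀ x ∈ K, ∑ p, x.1 p • V p = f x := by
    intro x hx
    obtain ⟨c, hc, hcK, hxc⟩ := hK x hx
    have h1 : ∀ p, x.1 p * ⟪f x, V p⟫ = x.1 p * ⟪develop x.1, orthoVec n p.rank⟫ := by
      intro p
      by_cases hp : x.1 p = 0
      · simp [hp]
      obtain ⟨y, hy, hys, hyV⟩ := hV c hcK p (hxc p hp) (by rintro rfl; exact hp x.2.2.1)
        (by rintro rfl; exact hp x.2.2.2.1)
      have hy0 := NCLink.ne_zero_of_support hys
      rw [hyV, real_inner_smul_right, hinner c hc hcK x hxc y hy, develop_of_support hys,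
        real_inner_smul_right]
      field_simp
    have h2 : ⟪f x, ∑ p, x.1 p • V p⟫ = 1 := by
      rw [inner_sum]
      simp only [real_inner_smul_right, h1]
      simp only [← real_inner_smul_right]
      rw [← inner_sum]
      show ⟪develop x.1, develop x.1⟫ = 1
      rw [real_inner_self_eq_norm_sq, NCLink.norm_develop, one_pow]
    have h3 : ⟪∑ p, x.1 p • V p, ∑ p, x.1 p • V p⟫ = 1 := by
      rw [inner_develop fun p q hp hq => hgram c hc hcK p (hxc p hp) q (hxc q hq),
        real_inner_self_eq_norm_sq, NCLink.norm_develop, one_pow]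
    rw [← sub_eq_zero, ← inner_self_eq_zero (𝕜 := ℝ), inner_sub_left, inner_sub_right,
      inner_sub_right, h3, real_inner_comm, h2, real_inner_self_eq_norm_sq, hfn x hx]
    norm_num
  have hscale : ∀ t, IsCone K t → t ≠ 0 → 0 < ‖develop t‖ ∧ ∃ x ∈ K,
      t = fun p => ‖develop t‖ * x.1 p := by
    intro t ht h0
    obtain ⟨hpos, x, hx⟩ := exists_point ht.nonneg ht.bot ht.top ht.isChain h0
    obtain ⟨c, hc, hcK, hs⟩ := ht.chain
    refine ⟨hpos, x, hcK fun p hp => hs p fun h => hp (by rw [hx, h, mul_zero]), funext fun p => ?_⟩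
    rw [hx, mul_inv_cancel_left₀ hpos.ne']
  have hnorm : ∀ t, IsCone K t → ‖∑ p, t p • V p‖ = ‖develop t‖ := by
    intro t ht
    obtain ⟨c, hc, hcK, hs⟩ := ht.chain
    rw [norm_eq_sqrt_real_inner, norm_eq_sqrt_real_inner,
      inner_develop fun p q hp hq => hgram c hc hcK p (hs p hp) q (hs q hq)]
  refine ⟨V, hgram, fun y => ?_, fun t s ht hs h => ?_⟩
  · by_cases hy : y = 0
    · refine ⟨0, ⟨fun _ => le_rfl, rfl, rfl, ∅, IsChain.empty, fun x hx => ?_,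
        fun p hp => absurd rfl hp⟩, by simp [hy]⟩
      refine absurd ?_ (NCLink.develop_ne_zero x)
      rw [develop]
      refine Finset.sum_eq_zero fun p _ => ?_
      rw [by_contra fun h => (hx p h : p ∈ (∅ : Set (NCPart n))), zero_smul]
    · have hpos : 0 < ‖y‖ := norm_pos_iff.2 hy
      obtain ⟨⟨x, hx⟩, hxy⟩ := φ.surjective ⟨‖y‖⁻¹ • y, by
        simp [norm_smul, hpos.ne']⟩
      have h1 := isCone_of_mem hK hx
      obtain ⟨c, hc, hcK, hs⟩ := h1.chain
      refine ⟨fun p => ‖y‖ * x.1 p, ⟨fun p => mul_nonneg hpos.le (h1.nonneg p), ?_, ?_, c, hc, hcK,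
        fun p hp => hs p (right_ne_zero_of_mul hp)⟩, ?_⟩
      · rw [h1.bot, mul_zero]
      · rw [h1.top, mul_zero]
      · simp only [mul_smul]
        rw [← Finset.smul_sum, hsum x hx, hf x hx, hxy]
        simp [smul_smul, hpos.ne']
  · have hd : ‖develop t‖ = ‖develop s‖ := by rw [← hnorm t ht, ← hnorm s hs, h]
    by_cases ht0 : t = 0
    · have : develop s = 0 := by
        rw [← norm_eq_zero, ← hd, ht0]
        simp [develop]
      rw [ht0, eq_zero_of_develop_eq_zero hs.nonneg hs.bot hs.top this]
    by_cases hs0 : s = 0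
    · have : develop t = 0 := by
        rw [← norm_eq_zero, hd, hs0]
        simp [develop]
      exact absurd (eq_zero_of_develop_eq_zero ht.nonneg ht.bot ht.top this) ht0
    obtain ⟨hpos, x, hx, htx⟩ := hscale t ht ht0
    obtain ⟨-, y, hy, hsy⟩ := hscale s hs hs0
    rw [← hd] at hsy
    have hxs : ∀ z ∈ K, ∑ p, (‖develop t‖ * z.1 p) • V p = ‖develop t‖ • f z := by
      intro z hz
      rw [← hsum z hz, Finset.smul_sum]
      simp only [mul_smul]
    have h1 : ‖develop t‖ • f x = ‖develop t‖ • f y := by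
      rw [← hxs x hx, ← hxs y hy]
      have h2 : ∀ p, ‖develop t‖ * x.1 p = t p := fun p => (congrFun htx p).symm
      have h3 : ∀ p, ‖develop t‖ * y.1 p = s p := fun p => (congrFun hsy p).symm
      simp only [h2, h3, h]
    have h2 : f x = f y := smul_right_injective E hpos.ne' h1
    rw [hf x hx, hf y hy] at h2
    have h3 : x = y := congrArg Subtype.val (φ.injective (Subtype.ext h2))
    rw [htx, hsy, h3]

end NCHT

namespace NCHT

variable {n : ℕ} {E : Type*} [NormedAddCommGroup E] [InnerProductSpace ℝ E]

/-! ### Maximal chains of a complete fan -/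

/-- A maximal chain of noncrossing partitions whose closed simplex lies in `K`. -/
structure IsFlag (K : Set (NCLink n)) (F : ℕ → NCPart n) : Prop where
  rank : ∀ r ≤ n, (F r).rank = r
  isChain : IsChain (· ≤ ·) (F '' Set.Iic n)
  subset : closedSimplex (F '' Set.Iic n) ⊆ K

theorem eq_of_rank_eq {c : Set (NCPart n)} (hc : IsChain (· ≤ ·) c) {p q : NCPart n} (hp : p ∈ c)
    (hq : q ∈ c) (h : p.rank = q.rank) : p = q := by
  rcases hc.total hp hq with hpq | hqp
  · exact NCPart.eq_of_rank_le hpq h.ge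
  · exact (NCPart.eq_of_rank_le hqp h.le).symm

theorem isChain_insert_bounds {c : Set (NCPart n)} (hc : IsChain (· ≤ ·) c) :
    IsChain (· ≤ ·) (insert ⊥ (insert ⊤ c)) :=
  (hc.insert fun _ _ _ => Or.inr le_top).insert fun _ _ _ => Or.inl bot_le

theorem closedSimplex_insert_bounds (c : Set (NCPart n)) :
    closedSimplex (insert ⊥ (insert ⊤ c)) ⊆ closedSimplex c := by
  refine closedSimplex_mono fun p hp hb ht => ?_
  exact (hp.resolve_left hb).resolve_left ht

theorem IsFlag.of_chain {K : Set (NCLink n)} {c : Set (NCPart n)} (hc : IsChain (· ≤ ·) c)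
    (hcK : closedSimplex c ⊆ K) {F : ℕ → NCPart n} (hF : ∀ r ≤ n, (F r).rank = r)
    (hFc : ∀ r ≤ n, F r ∈ insert ⊥ (insert ⊤ c)) : IsFlag K F where
  rank := hF
  isChain := (isChain_insert_bounds hc).mono (Set.image_subset_iff.2 hFc)
  subset := ((closedSimplex_mono fun _ hp _ _ => Set.image_subset_iff.2 hFc hp).trans
    (closedSimplex_insert_bounds c)).trans hcK

namespace IsFlag

variable {K : Set (NCLink n)} {F : ℕ → NCPart n}

theorem mem (r : ℕ) (hr : r ≤ n) : F r ∈ F '' Set.Iic n := ⟨r, hr, rfl⟩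

theorem mono (hF : IsFlag K F) {r s : ℕ} (hrs : r ≤ s) (hs : s ≤ n) : F r ≤ F s := by
  rcases hF.isChain.total (mem r (hrs.trans hs)) (mem s hs) with h | h
  · exact h
  · have := NCPart.rank_mono h
    rw [hF.rank s hs, hF.rank r (hrs.trans hs)] at this
    rw [le_antisymm hrs this]

theorem eq_bot (hF : IsFlag K F) : F 0 = ⊥ := by
  by_contra h
  have := NCPart.rank_pos h
  rw [hF.rank 0 (Nat.zero_le n)] at this
  exact lt_irrefl _ this

theorem eq_top (hF : IsFlag K F) : F n = ⊤ := by
  by_contra h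
  have := NCPart.rank_lt_top h
  rw [hF.rank n le_rfl] at this
  exact lt_irrefl _ this

theorem ne_bot (hF : IsFlag K F) {r : ℕ} (hr : 0 < r) (hrn : r ≤ n) : F r ≠ ⊥ := by
  intro h
  have := hF.rank r hrn
  rw [h, NCPart.rank_bot] at this
  exact hr.ne this

theorem ne_top (hF : IsFlag K F) {r : ℕ} (hr : r < n) : F r ≠ ⊤ := by
  intro h
  have := hF.rank r hr.le
  rw [h, NCPart.rank_top] at this
  exact hr.ne' this

theorem inner_vec {V : NCPart n → E} (hV : IsFan K V) (hF : IsFlag K F) {r s : ℕ} (hr : r ≤ n)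
    (hs : s ≤ n) : ⟪V (F r), V (F s)⟫ = gram n r s := by
  rw [hV.gram _ hF.isChain hF.subset _ (mem r hr) _ (mem s hs), hF.rank r hr, hF.rank s hs]

/-- Elements of flags are determined by their vectors. -/
theorem eq_of_vec_eq {V : NCPart n → E} (hV : IsFan K V) (hF : IsFlag K F) {F' : ℕ → NCPart n}
    (hF' : IsFlag K F') {s : ℕ} (hs : s ≤ n) (h : V (F s) = V (F' s)) : F s = F' s := by
  classical
  rcases Nat.eq_zero_or_pos s with rfl | h0
  · rw [hF.eq_bot, hF'.eq_bot]
  rcases hs.eq_or_lt with rfl | hsn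
  · rw [hF.eq_top, hF'.eq_top]
  have key : ∀ G : ℕ → NCPart n, IsFlag K G → IsCone K (Pi.single (G s) (1 : ℝ)) := by
    intro G hG
    refine ⟨fun q => ?_, ?_, ?_, _, hG.isChain, hG.subset, fun q hq => ?_⟩
    · rcases eq_or_ne q (G s) with rfl | h <;> simp [*]
    · simp [(hG.ne_bot h0 hs).symm]
    · simp [(hG.ne_top hsn).symm]
    · have : q = G s := by_contra fun h => hq (by simp [h])
      rw [this]
      exact mem s hs
  have := hV.inj _ _ (key F hF) (key F' hF') (by
    simp only [Pi.single_apply, ite_smul, one_smul, zero_smul]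
    rw [Finset.sum_ite_eq' Finset.univ (F s), Finset.sum_ite_eq' Finset.univ (F' s)]
    simpa using h)
  have h1 := congrFun this (F s)
  rw [Pi.single_eq_same, Pi.single_apply] at h1
  by_contra hne
  rw [if_neg hne] at h1
  exact one_ne_zero h1

end IsFlag

theorem exists_isFlag [FiniteDimensional ℝ E] (hE : Module.finrank ℝ E = n - 1)
    {K : Set (NCLink n)} {V : NCPart n → E} (hV : IsFan K V) :
    ∃ F, IsFlag K F ∧ Submodule.span ℝ (V '' (F '' Set.Iic n)) = ⊤ := by
  classical
  let ι := {c : Finset (NCPart n) // IsChain (· ≤ ·) (c : Set (NCPart n)) ∧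
    closedSimplex (c : Set (NCPart n)) ⊆ K ∧ ⊥ ∉ c ∧ ⊤ ∉ c}
  -- The finitely many spans of chains cover the space. A real vector space is not a finite union of
  -- proper subspaces, so one of these spans is everything.
  obtain ⟨⟨c, hc, hcK, hb, ht⟩, hspan⟩ := Subspace.exists_eq_top_of_iUnion_eq_univ (k := ℝ)
    (p := fun i : ι => Submodule.span ℝ (V '' i.1)) (by
      refine Set.eq_univ_of_forall fun y => ?_
      obtain ⟨t, hty, rfl⟩ := hV.surj y
      obtain ⟨c, hc, hcK, hs⟩ := hty.chain
      refine Set.mem_iUnion.2 ⟨⟨Finset.univ.filter fun p => t p ≠ 0, ?_, ?_, ?_, ?_⟩, ?_⟩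
      · simpa using hty.isChain
      · refine (closedSimplex_mono fun p hp _ _ => hs p ?_).trans hcK
        simpa using hp
      · simp [hty.bot]
      · simp [hty.top]
      · refine Submodule.sum_mem _ fun p _ => ?_
        by_cases hp : t p = 0
        · rw [hp, zero_smul]
          exact Submodule.zero_mem _
        · exact Submodule.smul_mem _ _ (Submodule.subset_span ⟨p, by simp [hp], rfl⟩))
  -- A spanning chain has at least `n - 1` proper elements. Their ranks are distinct and lie
  -- strictly between `0` and `n`, so every such rank occurs.
  have hcard : n - 1 ≤ c.card := by
    rw [← hE, ← finrank_top ℝ E, ← hspan, ← Finset.coe_image]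
    exact (finrank_span_finset_le_card (R := ℝ) (c.image V)).trans Finset.card_image_le
  have himage : c.image NCPart.rank = Finset.Ioo 0 n := by
    refine Finset.eq_of_subset_of_card_le ?_ ?_
    · intro r hr
      obtain ⟨p, hp, rfl⟩ := Finset.mem_image.1 hr
      rw [Finset.mem_Ioo]
      exact ⟨NCPart.rank_pos fun h => hb (h ▸ hp), NCPart.rank_lt_top fun h => ht (h ▸ hp)⟩
    · rw [Nat.card_Ioo, Finset.card_image_of_injOn]
      · omega
      · exact fun p hp q hq h => eq_of_rank_eq hc hp hq h
  have hex : ∀ r, ∃ p : NCPart n, r ≤ n → p.rank = r ∧ p ∈ insert ⊥ (insert ⊤ (c : Set (NCPart n))) := by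
    intro r
    rcases Nat.eq_zero_or_pos r with rfl | h0
    · exact ⟨⊥, fun _ => ⟨NCPart.rank_bot, Or.inl rfl⟩⟩
    rcases lt_or_ge r n with h | h
    · have : r ∈ c.image NCPart.rank := by rw [himage, Finset.mem_Ioo]; exact ⟨h0, h⟩
      obtain ⟨p, hp, rfl⟩ := Finset.mem_image.1 this
      exact ⟨p, fun _ => ⟨rfl, Or.inr (Or.inr hp)⟩⟩
    · exact ⟨⊤, fun h' => ⟨by rw [NCPart.rank_top]; omega, Or.inr (Or.inl rfl)⟩⟩
  choose F hF using hex
  have hflag : IsFlag K F := .of_chain hc hcK (fun r hr => (hF r hr).1) fun r hr => (hF r hr).2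
  refine ⟨F, hflag, top_unique (hspan ▸ Submodule.span_mono (Set.image_mono fun p hp => ?_))⟩
  refine ⟨p.rank, p.rank_le, ?_⟩
  exact eq_of_rank_eq (isChain_insert_bounds hc) (hF _ p.rank_le).2 (Or.inr (Or.inr hp))
    (hF _ p.rank_le).1

/-- Near a point of the relative interior of a cone, all cones contain that point. -/
theorem exists_isCone_near {K : Set (NCLink n)} {V : NCPart n → E} (hV : IsFan K V)
    {t₀ : NCPart n → ℝ} (ht₀ : IsCone K t₀) (z : E) :
    ∃ ε > (0 : ℝ), ∃ t, IsCone K t ∧ ∑ p, t p • V p = ∑ p, t₀ p • V p + ε • z ∧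
      ∀ p, t₀ p ≠ 0 → t p ≠ 0 := by
  set y := ∑ p, t₀ p • V p with hy
  let ε : ℕ → ℝ := fun k => 1 / ((k : ℝ) + 1)
  have hε : ∀ k, 0 < ε k := fun k => Nat.one_div_pos_of_nat
  have hε1 : ∀ k, ε k ≤ 1 := by
    intro k
    rw [div_le_one (by positivity)]
    have : (0 : ℝ) ≤ k := Nat.cast_nonneg k
    linarith
  choose t ht htV using fun k => hV.surj (y + ε k • z)
  set M := ‖y‖ + ‖z‖ with hM
  have hnorm : ∀ k, ‖develop (t k)‖ ≤ M := by
    intro k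
    obtain ⟨c, hc, hcK, hs⟩ := (ht k).chain
    have : ‖develop (t k)‖ = ‖y + ε k • z‖ := by
      rw [← htV k, norm_eq_sqrt_real_inner, norm_eq_sqrt_real_inner,
        inner_develop fun p q hp hq => hV.gram c hc hcK p (hs p hp) q (hs q hq)]
    rw [this]
    refine (norm_add_le _ _).trans (add_le_add_right ?_ _)
    rw [norm_smul, Real.norm_of_nonneg (hε k).le]
    exact mul_le_of_le_one_left (norm_nonneg z) (hε1 k)
  -- The coefficients of all `t k` are bounded since the Gram entries of proper elements are
  -- positive. Hence a subsequence converges.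
  have hbox : ∀ p, ∃ B : ℝ, ∀ k, t k p ≤ B := by
    intro p
    by_cases hp : p = ⊥ ∨ p = ⊤
    · refine ⟨0, fun k => le_of_eq ?_⟩
      rcases hp with rfl | rfl
      · exact (ht k).bot
      · exact (ht k).top
    rw [not_or] at hp
    have hg := gram_pos_of_proper hp.1 hp.2 hp.1 hp.2
    refine ⟨Real.sqrt (M ^ 2 / gram n p.rank p.rank), fun k => Real.le_sqrt_of_sq_le ?_⟩
    rw [le_div_iff₀ hg]
    exact (coeff_sq_le (ht k).nonneg (ht k).bot (ht k).top p).trans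
      (pow_le_pow_left₀ (norm_nonneg _) (hnorm k) 2)
  choose B hB using hbox
  obtain ⟨s, -, ψ, hψ, hlim⟩ := (isCompact_univ_pi fun p => isCompact_Icc (a := (0 : ℝ)) (b := B p)
    ).tendsto_subseq (x := t) fun k p _ => ⟨(ht k).nonneg p, hB p k⟩
  rw [tendsto_pi_nhds] at hlim
  -- Coefficients that are nonzero in the limit `s` are nonzero late in the sequence. So `s` is
  -- supported on the chain of some `t (ψ k)` and is itself a cone point over `y`. Uniqueness gives
  -- `s = t₀`, hence this `t (ψ k)` is nonzero on the support of `t₀`.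
  have hsupp : ∃ k, ∀ p, s p ≠ 0 → t (ψ k) p ≠ 0 := by
    refine (Filter.eventually_all.2 fun p => ?_ :
      ∀ᶠ k in Filter.atTop, ∀ p, s p ≠ 0 → t (ψ k) p ≠ 0).exists
    by_cases hp : s p = 0
    · exact Filter.Eventually.of_forall fun k h => absurd hp h
    · filter_upwards [(hlim p).eventually_ne hp] with k hk _
      exact hk
  obtain ⟨k, hk⟩ := hsupp
  have hs : IsCone K s := by
    refine ⟨fun p => ge_of_tendsto' (hlim p) fun j => (ht _).nonneg p, ?_, ?_, ?_⟩
    · exact tendsto_nhds_unique (hlim ⊥) (by simp [(ht _).bot])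
    · exact tendsto_nhds_unique (hlim ⊤) (by simp [(ht _).top])
    · obtain ⟨c, hc, hcK, h⟩ := (ht (ψ k)).chain
      exact ⟨c, hc, hcK, fun p hp => h p (hk p hp)⟩
  have hεlim : Filter.Tendsto (fun j => ε (ψ j)) Filter.atTop (nhds 0) :=
    tendsto_one_div_add_atTop_nhds_zero_nat.comp hψ.tendsto_atTop
  have hsy : ∑ p, s p • V p = y := by
    refine tendsto_nhds_unique (f := fun j => ∑ p, t (ψ j) p • V p) (l := Filter.atTop)
      (tendsto_finsetSum _ fun p _ => (hlim p).smul_const (V p)) ?_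
    simp only [htV]
    simpa using (hεlim.smul_const z).const_add y
  have hst : s = t₀ := hV.inj s t₀ hs ht₀ hsy
  exact ⟨ε (ψ k), hε _, t (ψ k), ht _, htV _, fun p hp => hk p (hst ▸ hp)⟩

end NCHT

namespace NCHT

variable {n : ℕ} {E : Type*} [NormedAddCommGroup E] [InnerProductSpace ℝ E] {K : Set (NCLink n)}
  {V : NCPart n → E}

/-! ### Apartments -/

/-- The function `r ↦ min r s` is affine except for a bend at `s`, so its second difference at `r +
1` vanishes unless `s = r + 1`. -/
theorem gram_flip {r s : ℕ} (hrs : s ≠ r + 1) :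
    gram n (r + 2) s + gram n r s - gram n (r + 1) s = gram n (r + 1) s := by
  have h : ((min (r + 2) s : ℕ) : ℝ) + (min r s : ℕ) = 2 * (min (r + 1) s : ℕ) := by
    rcases lt_or_gt_of_ne hrs with h | h
    · rw [min_eq_right (by omega), min_eq_right (by omega), min_eq_right (by omega)]
      ring
    · rw [min_eq_left (by omega), min_eq_left (by omega), min_eq_left (by omega)]
      push_cast
      ring
  simp only [gram]
  push_cast at h ⊢
  linear_combination h

theorem gram_flip_self (r : ℕ) :
    gram n (r + 2) (r + 1) + gram n r (r + 1) - gram n (r + 1) (r + 1) =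
      gram n (r + 1) (r + 1) - 1 := by
  simp only [gram, min_self]
  rw [min_eq_right (by omega), min_eq_left (by omega)]
  push_cast
  ring

/-- The element of a flag at a given rank can be exchanged for the one on the other side of the
wall. -/
theorem IsFlag.exists_flip (hV : IsFan K V) {F : ℕ → NCPart n} (hF : IsFlag K F) {r : ℕ}
    (hr : r + 2 ≤ n) :
    ∃ F', IsFlag K F' ∧ (∀ s ≠ r + 1, F' s = F s) ∧
      V (F' (r + 1)) = V (F (r + 2)) + V (F r) - V (F (r + 1)) := by
  classical
  -- The candidate for the new vector. It has the norm of `V (F (r + 1))` and the same inner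
  -- products with the other vectors of the flag, so it is the mirror image in the wall that these
  -- span.
  obtain ⟨z, hz⟩ : ∃ z, z = V (F (r + 2)) + V (F r) - V (F (r + 1)) := ⟨_, rfl⟩
  have hFz : ∀ s ≤ n, s ≠ r + 1 → ⟪z, V (F s)⟫ = gram n (r + 1) s := by
    intro s hs hsr
    rw [hz, inner_sub_left, inner_add_left, hF.inner_vec hV hr hs, hF.inner_vec hV (by omega) hs,
      hF.inner_vec hV (by omega) hs, gram_flip hsr]
  have hFz' : ⟪z, V (F (r + 1))⟫ = gram n (r + 1) (r + 1) - 1 := by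
    rw [hz, inner_sub_left, inner_add_left, hF.inner_vec hV hr (by omega), hF.inner_vec hV (by omega) (by omega),
      hF.inner_vec hV (by omega) (by omega), gram_flip_self]
  have hzz : ⟪z, z⟫ = gram n (r + 1) (r + 1) := by
    nth_rw 2 [hz]
    rw [inner_sub_right, inner_add_right, hFz _ hr (by omega), hFz _ (by omega) (by omega), hFz']
    have := gram_flip_self (n := n) r
    rw [gram_comm n (r + 1) (r + 2), gram_comm n (r + 1) r]
    linarith
  -- A point in the relative interior of the wall, all proper elements of the flag except that of
  -- rank `r + 1` having coefficient one. A cone containing a small displacement of it towards `z`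
  -- contains the wall.
  let t₀ : NCPart n → ℝ := fun p => if ∃ s, 0 < s ∧ s < n ∧ s ≠ r + 1 ∧ F s = p then 1 else 0
  have ht₀ : ∀ p, t₀ p ≠ 0 → ∃ s, 0 < s ∧ s < n ∧ s ≠ r + 1 ∧ F s = p := by
    intro p hp
    by_contra h
    exact hp (if_neg h)
  have hcone : IsCone K t₀ := by
    refine ⟨fun p => ?_, ?_, ?_, _, hF.isChain, hF.subset, fun p hp => ?_⟩
    · simp only [t₀]
      split_ifs <;> norm_num
    · refine if_neg ?_
      rintro ⟨s, h0, hs, -, h⟩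
      exact hF.ne_bot h0 hs.le h
    · refine if_neg ?_
      rintro ⟨s, h0, hs, -, h⟩
      exact hF.ne_top hs h
    · obtain ⟨s, -, hs, -, rfl⟩ := ht₀ p hp
      exact IsFlag.mem s hs.le
  obtain ⟨ε, hε, t, ht, htV, hsupp⟩ := exists_isCone_near hV hcone z
  obtain ⟨c, hc, hcK, hs⟩ := ht.chain
  have hFc : ∀ s ≤ n, s ≠ r + 1 → F s ∈ insert ⊥ (insert ⊤ c) := by
    intro s hsn hsr
    rcases Nat.eq_zero_or_pos s with rfl | h0
    · rw [hF.eq_bot]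
      exact Or.inl rfl
    rcases hsn.eq_or_lt with rfl | hsn
    · rw [hF.eq_top]
      exact Or.inr (Or.inl rfl)
    · refine Or.inr (Or.inr (hs _ (hsupp _ ?_)))
      have : t₀ (F s) = 1 := if_pos ⟨s, h0, hsn, hsr, rfl⟩
      rw [this]
      exact one_ne_zero
  have hc' := isChain_insert_bounds hc
  have hcK' := (closedSimplex_insert_bounds c).trans hcK
  have hcF : ∀ p ∈ c, p.rank ≠ r + 1 → p = F p.rank := fun p hp hpr =>
    eq_of_rank_eq hc' (Or.inr (Or.inr hp)) (hFc _ p.rank_le hpr) (hF.rank _ p.rank_le).symm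
  -- The displacement identity is paired with a vector orthogonal to the wall.
  have hortho : ∀ q : E, (∀ s ≤ n, s ≠ r + 1 → ⟪V (F s), q⟫ = 0) →
      ε * ⟪z, q⟫ = ∑ p, t p * ⟪V p, q⟫ := by
    intro q hq
    have h := congrArg (fun v => ⟪v, q⟫) htV
    simp only [inner_add_left, sum_inner, real_inner_smul_left] at h
    rw [h, Finset.sum_eq_zero, zero_add]
    intro p _
    by_cases hp : t₀ p = 0
    · rw [hp, zero_mul]
    · obtain ⟨s, -, hsn, hsr, rfl⟩ := ht₀ p hp
      rw [hq s hsn.le hsr, mul_zero]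
  -- Without an element of rank `r + 1` the cone would lie in the wall. Pairing with the normal
  -- vector `z - V (F (r + 1))` then gives `ε = 0`, since `z` has inner product one with it.
  obtain ⟨p', hp', hpr⟩ : ∃ p' ∈ c, p'.rank = r + 1 := by
    by_contra hcon
    push Not at hcon
    have h := hortho (z - V (F (r + 1))) fun s hs hsr => by
      rw [inner_sub_right, real_inner_comm, hFz s hs hsr, hF.inner_vec hV hs (by omega), gram_comm,
        sub_self]
    rw [inner_sub_right, hzz, hFz', Finset.sum_eq_zero] at h
    · linarith
    · intro p _
      by_cases hp : t p = 0
      · rw [hp, zero_mul]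
      · have hpc := hs p hp
        have hpn := hcon p hpc
        rw [hcF p hpc hpn, inner_sub_right, real_inner_comm, hFz _ p.rank_le hpn,
          hF.inner_vec hV p.rank_le (by omega), gram_comm, sub_self, mul_zero]
  have hFp : ∀ s ≤ n, s ≠ r + 1 → ⟪V (F s), V p'⟫ = gram n (r + 1) s := by
    intro s hsn hsr
    rw [hV.gram _ hc' hcK' _ (hFc s hsn hsr) _ (Or.inr (Or.inr hp')), hF.rank s hsn, hpr, gram_comm]
  have hpp : ⟪V p', V p'⟫ = gram n (r + 1) (r + 1) := by
    rw [hV.gram _ hc' hcK' _ (Or.inr (Or.inr hp')) _ (Or.inr (Or.inr hp')), hpr]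
  have hq : ∀ s ≤ n, s ≠ r + 1 → ⟪V (F s), z - V p'⟫ = 0 := fun s hs hsr => by
    rw [inner_sub_right, real_inner_comm, hFz s hs hsr, hFp s hs hsr, sub_self]
  -- The vector `z - V p'` is orthogonal to the wall as well. Pairing with it yields `(ε + t p') *
  -- (gram n (r + 1) (r + 1) - ⟪V p', z⟫) = 0` with a positive first factor, and two vectors of
  -- equal norm whose inner product is the square of that norm coincide.
  have hzp : V p' = z := by
    have h := hortho (z - V p') hq
    rw [Finset.sum_eq_single_of_mem p' (Finset.mem_univ _), inner_sub_right, inner_sub_right, hzz,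
      hpp, real_inner_comm (V p') z] at h
    · have h1 : (ε + t p') * (gram n (r + 1) (r + 1) - ⟪V p', z⟫) = 0 := by linarith
      have h2 : ε + t p' ≠ 0 := (add_pos_of_pos_of_nonneg hε (ht.nonneg p')).ne'
      have h3 := (mul_eq_zero.1 h1).resolve_left h2
      rw [← sub_eq_zero, ← inner_self_eq_zero (𝕜 := ℝ), inner_sub_left, inner_sub_right,
        inner_sub_right, hzz, hpp, real_inner_comm (V p') z]
      linarith
    · intro p _ hpp'
      by_cases hp : t p = 0
      · rw [hp, zero_mul]
      · have hpc := hs p hp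
        have hpn : p.rank ≠ r + 1 := fun h => hpp' (eq_of_rank_eq hc hpc hp' (h.trans hpr.symm))
        rw [hcF p hpc hpn, hq _ p.rank_le hpn, mul_zero]
  refine ⟨Function.update F (r + 1) p', .of_chain hc hcK ?_ ?_, fun s hsr => ?_, ?_⟩
  · intro s hsn
    rcases eq_or_ne s (r + 1) with rfl | h
    · rw [Function.update_self, hpr]
    · rw [Function.update_of_ne h, hF.rank s hsn]
  · intro s hsn
    rcases eq_or_ne s (r + 1) with rfl | h
    · rw [Function.update_self]
      exact Or.inr (Or.inr hp')
    · rw [Function.update_of_ne h]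
      exact hFc s hsn h
  · rw [Function.update_of_ne hsr]
  · rw [Function.update_self, hzp, hz]

/-- The increments of a flag. -/
def step (V : NCPart n → E) (F : ℕ → NCPart n) (i : Fin n) : E := V (F (i + 1)) - V (F i)

theorem IsFlag.vec_eq_sum (hV : IsFan K V) {F : ℕ → NCPart n} (hF : IsFlag K F) {s : ℕ}
    (hs : s ≤ n) : V (F s) = ∑ i with i.1 < s, step V F i := by
  have h0 : V (F 0) = 0 := by
    rw [← inner_self_eq_zero (𝕜 := ℝ), hF.inner_vec hV (Nat.zero_le n) (Nat.zero_le n), gram_zero_left]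
  have h := Finset.sum_range_sub (fun i => V (F i)) s
  rw [h0, sub_zero] at h
  rw [← h]
  symm
  refine Finset.sum_bij (fun i _ => i.1) ?_ ?_ ?_ ?_
  · intro i hi
    simpa using hi
  · intro i _ j _ h
    exact Fin.ext h
  · intro k hk
    rw [Finset.mem_range] at hk
    exact ⟨⟨k, hk.trans_le hs⟩, by simpa using hk, rfl⟩
  · intro i _
    rfl

/-- The inner products of the increments are mixed second differences of `gram`. The minimum
contributes the identity matrix and the product contributes `-1 / n`, as for the projections of an
orthonormal basis. -/
theorem IsFlag.isFrame (hV : IsFan K V) {F : ℕ → NCPart n} (hF : IsFlag K F)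
    (hspan : Submodule.span ℝ (V '' (F '' Set.Iic n)) = ⊤) :
    IsFrame (fun _ => (1 : ℝ)) (step V F) where
  pos _ := one_pos
  inner i j := by
    have hi : i.1 + 1 ≤ n := i.2
    have hj : j.1 + 1 ≤ n := j.2
    rw [step, step, inner_sub_left, inner_sub_right, inner_sub_right, hF.inner_vec hV hi hj,
      hF.inner_vec hV hi j.2.le, hF.inner_vec hV i.2.le hj, hF.inner_vec hV i.2.le j.2.le]
    have hn : (n : ℝ) ≠ 0 := by exact_mod_cast (by omega : n ≠ 0)
    simp only [gram, Finset.sum_const, Finset.card_univ, Fintype.card_fin, nsmul_eq_mul, mul_one]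
    have key : ((min (i.1 + 1) (j.1 + 1) : ℕ) : ℝ) - (min (i.1 + 1) j.1 : ℕ) -
        ((min i.1 (j.1 + 1) : ℕ) - (min i.1 j.1 : ℕ)) = if i = j then 1 else 0 := by
      rcases lt_trichotomy i.1 j.1 with h | h | h
      · rw [min_eq_left (by omega), min_eq_left (by omega), min_eq_left (by omega),
          min_eq_left (by omega), if_neg (by rintro rfl; exact lt_irrefl _ h)]
        push_cast
        ring
      · rw [if_pos (Fin.ext h), h, min_self, min_self, min_eq_right (by omega), min_eq_left (by omega)]
        push_cast
        ring
      · rw [min_eq_right (by omega), min_eq_right (by omega), min_eq_right (by omega),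
          min_eq_right (by omega), if_neg (by rintro rfl; exact lt_irrefl _ h)]
        push_cast
        ring
    rw [← key]
    push_cast
    field_simp
    ring
  span y := by
    have hy : y ∈ Submodule.span ℝ (Set.range (step V F)) := by
      refine (top_le_iff.1 ?_ : Submodule.span ℝ (Set.range (step V F)) = ⊤) ▸ Submodule.mem_top
      rw [← hspan, Submodule.span_le]
      rintro _ ⟨_, ⟨s, hs, rfl⟩, rfl⟩
      rw [hF.vec_eq_sum hV hs]
      exact Submodule.sum_mem _ fun i _ => Submodule.subset_span ⟨i, rfl⟩
    obtain ⟨c, hc⟩ := (Submodule.mem_span_range_iff_exists_fun ℝ).1 hy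
    exact ⟨c, hc.symm⟩

/-- The increments of a flag can be permuted. -/
theorem IsFlag.exists_perm (hV : IsFan K V) {F : ℕ → NCPart n} (hF : IsFlag K F)
    (w : Equiv.Perm (Fin n)) : ∃ F', IsFlag K F' ∧ step V F' = step V F ∘ w := by
  rcases n with _ | m
  · exact ⟨F, hF, funext fun i => i.elim0⟩
  have hw : w ∈ Submonoid.closure (Set.range fun i : Fin m => Equiv.swap i.castSucc i.succ) := by
    rw [Equiv.Perm.mclosure_swap_castSucc_succ]
    trivial
  induction hw using Submonoid.closure_induction generalizing F with
  | mem x hx =>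
    obtain ⟨i, rfl⟩ := hx
    -- Replacing the element of rank `i + 1` by its mirror image exchanges the increments numbered
    -- `i` and `i + 1`.
    obtain ⟨F', hF', hne, hflip⟩ := hF.exists_flip hV (r := i) (by omega)
    refine ⟨F', hF', funext fun j => ?_⟩
    rw [Function.comp_apply]
    rcases eq_or_ne j i.castSucc with rfl | h1
    · rw [Equiv.swap_apply_left, step, step, Fin.val_castSucc, Fin.val_succ, hflip, hne i (by omega)]
      abel
    rcases eq_or_ne j i.succ with rfl | h2
    · rw [Equiv.swap_apply_right, step, step, Fin.val_castSucc, Fin.val_succ, hflip,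
        hne (i + 1 + 1) (by omega)]
      abel
    · rw [Equiv.swap_apply_of_ne_of_ne h1 h2, step, step, hne, hne]
      · exact fun h => h2 (Fin.ext h)
      · exact fun h => h1 (Fin.ext (by simpa using h))
  | one => exact ⟨F, hF, rfl⟩
  | mul x y _ _ ihx ihy =>
    obtain ⟨F₁, hF₁, h₁⟩ := ihx hF
    obtain ⟨F₂, hF₂, h₂⟩ := ihy hF₁
    exact ⟨F₂, hF₂, by rw [h₂, h₁]; rfl⟩

/-- Each ordering of the increments of a flag is realized by a flag. -/
theorem IsFlag.exists_list (hV : IsFan K V) {F : ℕ → NCPart n} (hF : IsFlag K F)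
    {l : List (Fin n)} (hl : l.Nodup) (hlu : l.toFinset = Finset.univ) :
    ∃ F', IsFlag K F' ∧ ∀ s ≤ n, V (F' s) = ∑ j ∈ (l.take s).toFinset, step V F j := by
  have hmem : ∀ x, x ∈ l := fun x => by rw [← List.mem_toFinset, hlu]; exact Finset.mem_univ x
  have hlen : l.length = n := by
    rw [← List.toFinset_card_of_nodup hl, hlu, Finset.card_univ, Fintype.card_fin]
  let w : Equiv.Perm (Fin n) := (finCongr hlen.symm).trans (hl.getEquivOfForallMemList l hmem)
  have hw : ∀ i : Fin n, w i = l[i.1]'(by omega) := fun i => rfl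
  obtain ⟨F', hF', h⟩ := hF.exists_perm hV w
  refine ⟨F', hF', fun s hs => ?_⟩
  rw [hF'.vec_eq_sum hV hs, h]
  refine Finset.sum_bij (fun i _ => w i) ?_ (fun i _ j _ h => w.injective h) ?_ fun i _ => rfl
  · intro i hi
    rw [hw, List.mem_toFinset, List.mem_take_iff_getElem]
    exact ⟨i, by simp at hi; omega, rfl⟩
  · intro j hj
    rw [List.mem_toFinset, List.mem_take_iff_getElem] at hj
    obtain ⟨i, hi, rfl⟩ := hj
    exact ⟨⟨i, by omega⟩, by simp; omega, rfl⟩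

/-- A set of simplices that develops onto a complete fan is the sphere of a noncrossing tree. -/
theorem IsFan.exists_tree (hn : 1 ≤ n) [FiniteDimensional ℝ E] (hE : Module.finrank ℝ E = n - 1)
    (hK : ∀ x ∈ K, ∃ c : Set (NCPart n), IsChain (· ≤ ·) c ∧ closedSimplex c ⊆ K ∧
      x ∈ closedSimplex c) (hV : IsFan K V) : ∃ τ : NCHypertree n, τ.IsTree ∧ τ.sphere = K := by
  classical
  obtain ⟨F, hF, hspan⟩ := exists_isFlag hE hV
  have hu := hF.isFrame hV hspan
  set u := step V F with hu_def
  have : Nonempty (Fin n) := ⟨⟨0, hn⟩⟩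
  have hchain : ∀ 𝒜 : Finset (Finset (Fin n)), IsChain (· ⊆ ·) (𝒜 : Set (Finset (Fin n))) →
      ∃ G, IsFlag K G ∧ ∀ A ∈ 𝒜, V (G A.card) = ∑ i ∈ A, u i := by
    intro 𝒜 h𝒜
    obtain ⟨l, hl, hlu, hA⟩ := exists_list_of_isChain Finset.univ 𝒜 (fun A _ => Finset.subset_univ A) h𝒜
    obtain ⟨G, hG, hGV⟩ := hF.exists_list hV hl hlu
    refine ⟨G, hG, fun A hA' => ?_⟩
    obtain ⟨i, hi, rfl⟩ := hA A hA'
    rw [List.toFinset_card_of_nodup (hl.sublist (List.take_sublist i l)), List.length_take,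
      min_eq_left hi, hGV i]
    rw [← List.toFinset_card_of_nodup hl, hlu, Finset.card_univ, Fintype.card_fin] at hi
    exact hi
  have hcard : ∀ A : Finset (Fin n), A.card ≤ n := fun A => by
    simpa using Finset.card_le_univ A
  have hex : ∀ A : Finset (Fin n), ∃ G, IsFlag K G ∧ V (G A.card) = ∑ i ∈ A, u i := by
    intro A
    obtain ⟨G, hG, h⟩ := hchain {A} (by simp)
    exact ⟨G, hG, h A (Finset.mem_singleton_self A)⟩
  choose G hG hGV using hex
  -- The element whose vector is the partial sum over `A`. By `eq_of_vec_eq` it does not depend on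
  -- the flag, so it can be computed in any flag that passes through this sum.
  let P : Finset (Fin n) → NCPart n := fun A => G A A.card
  have hP : ∀ A H, IsFlag K H → V (H A.card) = ∑ i ∈ A, u i → H A.card = P A := by
    intro A H hH h
    exact hH.eq_of_vec_eq hV (hG A) (hcard A) (h.trans (hGV A).symm)
  have hrank : ∀ A, (P A).rank = A.card := fun A => (hG A).rank _ (hcard A)
  have hmono : ∀ A B, A ⊆ B → P A ≤ P B := by
    intro A B hAB
    obtain ⟨H, hH, h⟩ := hchain {A, B} (by
      rw [Finset.coe_insert, Finset.coe_singleton]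
      exact IsChain.pair hAB)
    rw [← hP A H hH (h A (by simp)), ← hP B H hH (h B (by simp))]
    exact hH.mono (Finset.card_le_card hAB) (hcard B)
  have hinj : Function.Injective P := by
    intro A B hAB
    -- If two partial sums agree, the indicator functions of `A` and `B` differ by a constant.
    -- Comparing ranks gives equal cardinalities, so the constant is zero.
    have hind : ∀ C : Finset (Fin n), ∑ i ∈ C, u i = ∑ i, (if i ∈ C then (1 : ℝ) else 0) • u i := by
      intro C
      simp only [ite_smul, one_smul, zero_smul]
      rw [Finset.sum_ite_mem, Finset.univ_inter]
    have h := congrArg V hAB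
    change V (G A A.card) = V (G B B.card) at h
    rw [hGV, hGV, hind, hind] at h
    obtain ⟨a, ha⟩ := hu.coeff_eq h
    have h1 : A.card = B.card := by rw [← hrank, ← hrank, hAB]
    have h2 := Finset.sum_congr rfl fun i (_ : i ∈ Finset.univ) => ha i
    rw [Finset.sum_add_distrib, Finset.sum_boole, Finset.sum_boole, Finset.filter_univ_mem,
      Finset.filter_univ_mem, h1] at h2
    have h3 : (n : ℝ) * a = 0 := by
      simp only [Finset.sum_const, Finset.card_univ, Fintype.card_fin, nsmul_eq_mul] at h2
      linarith
    have ha0 : a = 0 :=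
      (mul_eq_zero.1 h3).resolve_left (by exact_mod_cast (by omega : n ≠ 0))
    ext i
    have := ha i
    rw [ha0, zero_add] at this
    by_cases hA : i ∈ A <;> by_cases hB : i ∈ B <;> simp [hA, hB] at this ⊢
  obtain ⟨τ, hτ, hτP, hle⟩ := exists_tree_of_boolean hmono hinj hrank
  refine ⟨τ, hτ, Set.Subset.antisymm (fun x hx => ?_) fun x hx => ?_⟩
  -- The support of a point of the sphere of `τ` is a chain of sets under `P`, and one flag of `K`
  -- passes through all of it.
  · obtain ⟨H, hH, h⟩ := hchain (Finset.univ.filter fun A => x.1 (P A) ≠ 0) (by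
      intro A hA B hB _
      have hA' : x.1 (P A) ≠ 0 := by simpa using hA
      have hB' : x.1 (P B) ≠ 0 := by simpa using hB
      exact (x.2.2.2.2.1.total hA' hB').imp (hle A B) (hle B A))
    refine hH.subset fun p hp => ?_
    obtain ⟨A, rfl⟩ := hτP ▸ hx p hp
    rw [← hP A H hH (h A (by simpa using hp))]
    exact IsFlag.mem _ (hcard A)
  -- The developed image of `x` is decomposed into layers in the frame of increments. This gives a
  -- second cone point of `K` with the same image, supported on the range of `P`, and uniqueness in
  -- the fan identifies it with `x`.
  · obtain ⟨a, ha⟩ := hu.span (∑ p, x.1 p • V p)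
    obtain ⟨t, b, ht, htb⟩ := exists_isLayer a
    let s : NCPart n → ℝ := fun p => ∑ A with P A = p, t A
    have hs0 : ∀ p, s p ≠ 0 → ∃ A, t A ≠ 0 ∧ P A = p := by
      intro p hp
      obtain ⟨A, hA, hA0⟩ := Finset.exists_ne_zero_of_sum_ne_zero hp
      exact ⟨A, hA0, (Finset.mem_filter.1 hA).2⟩
    have hzero : ∀ p, (∀ A, P A = p → t A = 0) → s p = 0 := fun p h => by
      by_contra hp
      obtain ⟨A, hA, hAp⟩ := hs0 p hp
      exact hA (h A hAp)
    have hs : IsCone K s := by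
      refine ⟨fun p => Finset.sum_nonneg fun A _ => ht.nonneg A, hzero _ fun A hA => ?_,
        hzero _ fun A hA => ?_, ?_⟩
      · have h1 := hrank A
        rw [hA, NCPart.rank_bot] at h1
        rw [Finset.card_eq_zero.1 h1.symm, ht.empty]
      · have h1 := hrank A
        rw [hA, NCPart.rank_top] at h1
        rw [(Finset.card_eq_iff_eq_univ A).1 (by rw [← h1, Fintype.card_fin]), ht.univ]
      · obtain ⟨H, hH, h⟩ := hchain (Finset.univ.filter fun A => t A ≠ 0) (by simpa using ht.chain)
        refine ⟨_, hH.isChain, hH.subset, fun p hp => ?_⟩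
        obtain ⟨A, hA, rfl⟩ := hs0 p hp
        rw [← hP A H hH (h A (by simpa using hA))]
        exact IsFlag.mem _ (hcard A)
    have hsum : ∑ p, s p • V p = ∑ p, x.1 p • V p := by
      rw [ha]
      simp only [htb, add_smul, Finset.sum_add_distrib]
      rw [← Finset.smul_sum, hu.sum_eq_zero, smul_zero, zero_add, ← IsFrame.sum_layer]
      simp only [s, Finset.sum_smul]
      rw [← Finset.sum_fiberwise Finset.univ P fun A => t A • ∑ i ∈ A, u i]
      refine Finset.sum_congr rfl fun p _ => Finset.sum_congr rfl fun A hA => ?_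
      rw [← (Finset.mem_filter.1 hA).2, ← hGV A]
    have hxs := hV.inj _ _ hs (isCone_of_mem hK hx) hsum
    intro p hp
    rw [← hxs] at hp
    obtain ⟨A, -, rfl⟩ := hs0 p hp
    rw [hτP]
    exact ⟨A, rfl⟩

end NCHT

namespace NCHypertree

open NCHT

variable {n : ℕ}

/-! ### Chambers and apartments -/

theorem edges_eq_of_subset {τ τ' : NCHypertree n} (hτ : τ.IsTree) (hτ' : τ'.IsTree)
    (h : τ.edges ⊆ τ'.edges) : τ = τ' :=
  NCHypertree.ext (Finset.eq_of_subset_of_card_le h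
    (by rw [(isTree_iff_card _).1 hτ, (isTree_iff_card _).1 hτ']))

/-- For `n ≤ 1` the link is empty, so injectivity cannot be read off from points. But there every
hyperedge is the full vertex set, so there is at most one tree. -/
theorem tree_eq_of_le_one (hn : n ≤ 1) {τ τ' : NCHypertree n} (hτ : τ.IsTree) (hτ' : τ'.IsTree) :
    τ = τ' := by
  have hle : ∀ e : Finset (Fin (n + 1)), e.card ≤ n + 1 := fun e => by
    simpa using Finset.card_le_univ e
  have huniv : ∀ (σ : NCHypertree n), ∀ e ∈ σ.edges, e = Finset.univ := fun σ e he => by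
    refine (Finset.card_eq_iff_eq_univ e).1 ?_
    have := σ.two_le_card e he
    have := hle e
    rw [Fintype.card_fin]
    omega
  refine edges_eq_of_subset hτ hτ' fun e he => ?_
  have hn1 : 1 ≤ n := by
    have := τ.two_le_card e he
    have := hle e
    omega
  obtain ⟨e', he'⟩ := τ'.edges_nonempty hn1
  rwa [huniv τ e he, ← huniv τ' e' he']

/-- A point in the relative interior of the simplex of a chain. -/
theorem exists_interior_point {c : Set (NCPart n)} (hc : IsChain (· ≤ ·) c)
    (hne : ∃ p ∈ c, p ≠ ⊥ ∧ p ≠ ⊤) :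
    ∃ x : NCLink n, ∀ p, x.1 p ≠ 0 ↔ p ∈ c ∧ p ≠ ⊥ ∧ p ≠ ⊤ := by
  classical
  let t : NCPart n → ℝ := fun p => if p ∈ c ∧ p ≠ ⊥ ∧ p ≠ ⊤ then 1 else 0
  have ht : ∀ p, t p ≠ 0 ↔ p ∈ c ∧ p ≠ ⊥ ∧ p ≠ ⊤ := by
    intro p
    simp only [t]
    split_ifs with h <;> simp [h]
  obtain ⟨hpos, x, hx⟩ := exists_point (t := t)
    (fun p => by simp only [t]; split_ifs <;> norm_num) (by simp [t]) (by simp [t])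
    (hc.mono fun p hp => ((ht p).1 hp).1)
    (by
      obtain ⟨p, hp⟩ := hne
      exact fun h => (ht p).2 hp (congrFun h p))
  refine ⟨x, fun p => ?_⟩
  rw [← ht, hx, mul_ne_zero_iff, and_iff_right (inv_ne_zero hpos.ne')]

/-- Two strict chains of the same length, one contained in the other, agree term by term. Cancelling
in the permutation identities recovers the cycles, and these recover the hyperedges. -/
theorem eq_of_hasStandardName {l l' : List (Finset (Fin (n + 1)))}
    {c : Fin (l.length + 1) → NCPart n} {c' : Fin (l'.length + 1) → NCPart n}
    (h : HasStandardName l c) (h' : HasStandardName l' c') (hl : ∀ e ∈ l, 2 ≤ e.card)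
    (hl' : ∀ e ∈ l', 2 ≤ e.card) (hlen : l.length = l'.length)
    (hsub : Set.range c ⊆ Set.range c') : l = l' := by
  have hc : ∀ i, c i = c' (Fin.cast (by rw [hlen]) i) := by
    have hmono' : StrictMono (c' ∘ Fin.cast (congrArg (· + 1) hlen)) :=
      h'.1.comp fun a b hab => hab
    refine congrFun (StrictMono.range_inj h.1 hmono' |>.1 ?_)
    have hr : Set.range (c' ∘ Fin.cast (congrArg (· + 1) hlen)) = Set.range c' :=
      (finCongr (congrArg (· + 1) hlen)).surjective.range_comp c'
    rw [hr]
    refine Set.eq_of_subset_of_ncard_le hsub ?_ (Set.toFinite _)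
    rw [← Set.image_univ, ← Set.image_univ, Set.ncard_image_of_injective _ h.1.injective,
      Set.ncard_image_of_injective _ h'.1.injective, Set.ncard_univ, Set.ncard_univ]
    simp [hlen]
  refine List.ext_get hlen fun i hi hi' => ?_
  refine edgePerm_injOn (hl _ (List.get_mem _ _)) (hl' _ (List.get_mem _ _)) ?_
  have h1 := h.2.2.2 ⟨i, hi⟩
  have h2 := h'.2.2.2 ⟨i, hi'⟩
  rw [hc, hc] at h1
  exact mul_right_cancel (h1.trans h2.symm)

theorem IsProperOrdering.two_le_card {τ : NCHypertree n} {l : List (Finset (Fin (n + 1)))}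
    (hl : τ.IsProperOrdering l) {e : Finset (Fin (n + 1))} (he : e ∈ l) : 2 ≤ e.card :=
  τ.two_le_card e (by rw [← hl.2.1]; exact List.mem_toFinset.2 he)

theorem IsProperOrdering.length {τ : NCHypertree n} {l : List (Finset (Fin (n + 1)))}
    (hl : τ.IsProperOrdering l) : l.length = τ.edges.card := by
  rw [← List.toFinset_card_of_nodup hl.1, hl.2.1]

/-- An interior point of one partition simplex of `τ` has the whole chain as its support. If it lies
in `τ'.simplex`, the chain is a chain of `τ'` as well, and its name lists the edges of both trees.
-/
theorem simplex_injOn : Set.InjOn simplex {τ : NCHypertree n | τ.IsTree} := by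
  intro τ hτ τ' hτ' h
  rcases le_or_gt n 1 with hn | hn
  · exact tree_eq_of_le_one hn hτ hτ'
  obtain ⟨l, hl⟩ := exists_isProperOrdering τ
  obtain ⟨c, hc, -⟩ := hl.exists_hasStandardName
  have hlen : l.length = n := hl.length.trans ((isTree_iff_card _).1 hτ)
  obtain ⟨x, hx⟩ := exists_interior_point (c := Set.range c) hc.1.monotone.isChain_range
    ⟨c ⟨1, by omega⟩, ⟨_, rfl⟩, by
      rw [← hc.2.1]
      exact (hc.1 (Fin.mk_lt_mk.2 one_pos)).ne', by
      rw [← hc.2.2.1]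
      exact (hc.1 (Fin.mk_lt_mk.2 (by omega))).ne⟩
  have hxτ : x ∈ τ'.simplex := h ▸ ⟨l, hl, c, hc, fun p hp => ((hx p).1 hp).1⟩
  obtain ⟨l', hl', c', hc', hx'⟩ := hxτ
  have hlen' : l'.length = n := hl'.length.trans ((isTree_iff_card _).1 hτ')
  have := eq_of_hasStandardName hc hc' (fun _ => hl.two_le_card) (fun _ => hl'.two_le_card)
    (hlen.trans hlen'.symm) (fun p hp => by
      by_cases hb : p = ⊥
      · exact ⟨0, by rw [hb]; exact hc'.2.1⟩
      by_cases ht : p = ⊤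
      · exact ⟨Fin.last _, by rw [ht]; exact hc'.2.2.1⟩
      · exact hx' p ((hx p).2 ⟨hp, hb, ht⟩))
  refine NCHypertree.ext ?_
  rw [← hl.2.1, ← hl'.2.1, this]

theorem bijOn_simplex : Set.BijOn simplex {τ : NCHypertree n | τ.IsTree} (chambers n) := by
  refine ⟨fun τ hτ => ⟨τ, (isTree_iff_card _).1 hτ, rfl⟩, simplex_injOn, ?_⟩
  rintro _ ⟨τ, hτ, rfl⟩
  exact ⟨τ, (isTree_iff_card _).2 hτ, rfl⟩

/-- An edge `e` gives an element of rank one, which is a vertex of the sphere and hence the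
partition into components of some set of edges of `τ'`. Any edge in this set must lie inside `e`,
hence equal it. -/
theorem sphere_injOn : Set.InjOn sphere {τ : NCHypertree n | τ.IsTree} := by
  intro τ hτ τ' hτ' h
  rcases le_or_gt n 1 with hn | hn
  · exact tree_eq_of_le_one hn hτ hτ'
  refine edges_eq_of_subset hτ hτ' fun e he => ?_
  have he1 : ({e} : Finset _) ⊆ τ.edges := Finset.singleton_subset_iff.2 he
  have hrank : (τ.part {e} he1).rank = 1 := by
    rw [rank_eq_srank]
    show srank (components _) = 1
    rw [τ.srank_components he1, Finset.sum_singleton, hτ e he]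
  obtain ⟨x, hx⟩ := exists_interior_point (c := {τ.part {e} he1}) (by simp)
    ⟨_, rfl, fun h => by rw [h, NCPart.rank_bot] at hrank; omega,
      fun h => by rw [h, NCPart.rank_top] at hrank; omega⟩
  have hxτ : x ∈ τ'.sphere := h ▸ fun p hp => by
    rw [((hx p).1 hp).1]
    exact ⟨{e}, he1, rfl⟩
  obtain ⟨F, hF, hp⟩ := hxτ (τ.part {e} he1) ((hx _).2
    ⟨rfl, fun h => by rw [h, NCPart.rank_bot] at hrank; omega,
      fun h => by rw [h, NCPart.rank_top] at hrank; omega⟩)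
  change components {e} = components F at hp
  have hFne : F.Nonempty := by
    rw [Finset.nonempty_iff_ne_empty]
    rintro rfl
    have : (τ.part {e} he1).rank = srank (components {e}) := rank_eq_srank _
    rw [hp, components_empty, srank_bot] at this
    omega
  obtain ⟨e', he'⟩ := hFne
  have hsub : e' ⊆ e := by
    intro a ha
    by_contra hae
    obtain ⟨b, hb, hab⟩ := Finset.exists_mem_ne (τ'.two_le_card e' (hF he')) a
    have hrel : components {e} a b := hp ▸ components_rel he' ha hb
    refine hab (components_induction (P := fun x => x = a) rfl ?_ hrel)
    rintro f hf x hx y _ _ rfl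
    rw [Finset.mem_singleton.1 hf] at hx
    exact absurd hx hae
  rw [← Finset.eq_of_subset_of_card_le hsub (by rw [hτ e he, hτ' e' (hF he')])]
  exact hF he'

theorem exists_chain_of_mem_space {𝒦 : UpperSet (NCHypertree n)} {x : NCLink n}
    (hx : x ∈ space 𝒦) : ∃ c : Set (NCPart n), IsChain (· ≤ ·) c ∧ closedSimplex c ⊆ space 𝒦 ∧
      x ∈ closedSimplex c := by
  simp only [space, Set.mem_iUnion] at hx
  obtain ⟨τ, hτ, l, hl, c, hc, hx⟩ := hx
  refine ⟨Set.range c, hc.1.monotone.isChain_range, fun y hy => ?_, hx⟩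
  exact Set.mem_iUnion₂.2 ⟨τ, hτ, l, hl, c, hc, hy⟩

theorem bijOn_sphere (hn : 1 ≤ n) :
    Set.BijOn sphere {τ : NCHypertree n | τ.IsTree} (apartments n) := by
  refine ⟨fun τ hτ => ⟨?_, ?_⟩, sphere_injOn, ?_⟩
  · obtain ⟨𝒦, -, h⟩ := τ.exists_upperSet_sphere
    exact ⟨𝒦, h⟩
  · have h := τ.isUnitSphere_sphere hn
    rwa [(isTree_iff_card _).1 hτ] at h
  -- Only the covering of `space 𝒦` by closed partition simplices is used from the subcomplex
  -- structure; the isometry does the rest by way of the fan.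
  · rintro _ ⟨⟨𝒦, rfl⟩, φ, hφ⟩
    have hK := fun x (hx : x ∈ space 𝒦) => exists_chain_of_mem_space hx
    obtain ⟨V, hV⟩ := exists_isFan hn hK φ hφ
    obtain ⟨τ, hτ, h⟩ := hV.exists_tree hn finrank_euclideanSpace_fin hK
    exact ⟨τ, hτ, h⟩

end NCHypertree

end

/-! ### Simplices and spheres: the theorem. -/

theorem mainTheorem2 (n : ℕ) (hn : 1 ≤ n) :
    (∀ τ : NCHypertree n,
      (∃ 𝒦 : UpperSet (NCHypertree n), τ ∈ 𝒦 ∧ NCHypertree.space 𝒦 = τ.sphere) ∧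
      τ.simplex ⊆ τ.sphere ∧
      NCHT.IsUnitSphere (τ.edges.card - 1) τ.sphere) ∧
    Set.BijOn NCHypertree.simplex {τ : NCHypertree n | τ.IsTree} (NCHypertree.chambers n) ∧
    Set.BijOn NCHypertree.sphere {τ : NCHypertree n | τ.IsTree} (NCHypertree.apartments n) ∧
    ∃ Φ : NCHypertree.chambers n ≃ NCHypertree.apartments n,
      ∀ (τ : NCHypertree n) (S : NCHypertree.chambers n),
        τ.IsTree → S.1 = τ.simplex → (Φ S).1 = τ.sphere := by
  have h₁ := NCHypertree.bijOn_simplex (n := n)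
  have h₂ := NCHypertree.bijOn_sphere hn
  refine ⟨fun τ => ⟨τ.exists_upperSet_sphere, τ.simplex_subset_sphere, τ.isUnitSphere_sphere hn⟩,
    h₁, h₂, (h₁.equiv _).symm.trans (h₂.equiv _), fun τ S hτ hS => ?_⟩
  have h : (h₁.equiv _).symm S = ⟨τ, hτ⟩ := by
    rw [Equiv.symm_apply_eq]
    exact Subtype.ext hS
  rw [Equiv.trans_apply, h]
  rfl
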